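/- Let $n\ge 3$ and $\lambda>0$. Write $\mathbb S^{k}$ for the unit sphere of $\mathbb R^{k+1}$, $\omega_{k}=2\pi^{(k+1)/2}/\Gamma(\tfrac{k+1}{2})$ for its volume, and $$\Lambda^{-1}(y)=\Big(\tfrac{2y}{1+|y|^2},\tfrac{-1+|y|^2}{1+|y|^2}\Big)\in\mathbb S^{n-1},\qquad y\in\mathbb R^{n-1},$$ for the inverse stereographic projection. Let $\Sigma_\lambda=\{x\in\mathbb R^n: x_n^2+(x_1^2+\dots+x_{n-1}^2)\cosh^2\lambda=1\}$ and, for $\psi\in\mathbb S^{n-2}$ and $c>0$, let $$\mathrm S_{\psi,c}=\{\Lambda^{-1}(c\psi+c(\tanh\lambda)\,\omega):\omega\in\mathbb S^{n-2}\}.$$ Let $(Y^m_l)_{1\le l\le d_m}$ be, for every $m\ge0$, an orthonormal basis in $L^2(\mathbb S^{n-2})$ of the $d_m$-dimensional space of spherical harmonics of degree $m$ on $\mathbb S^{n-2}$. Let $f:\mathbb S^{n-1}\to\mathbb C$ be continuous and such that $$f^{**}(x)=\frac{f(\Lambda^{-1}(x))}{|x|^{n-2}(1+|x|^2)^{n-2}}$$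 belongs to $L^1(\mathbb R^{n-1}\setminus\{0\})$. Let $(Sf)(\mathrm S_{\psi,c})=\int_{\mathrm S_{\psi,c}}f\,d\mathrm S_{\psi,c}$ be the integral of $f$ over $\mathrm S_{\psi,c}$ with respect to $(n-2)$-dimensional surface measure, and define for $r,c>0$ $$f_{m,l}(r)=\int_{\mathbb S^{n-2}}f(\Lambda^{-1}(r\zeta))\,\overline{Y^m_l(\zeta)}\,d\zeta,\qquad \mathcal K_{m,l}(c)=\frac{1}{(2c\tanh\lambda)^{n-2}\,\omega_{n-3}}\int_{\mathbb S^{n-2}}(Sf)(\mathrm S_{\psi,c})\,\overline{Y^m_l(\psi)}\,d\psi ,$$ so that $\sum_{m,l}f_{m,l}(r)Y^m_l(\zeta)$ is the spherical harmonic expansion of $f\circ\Lambda^{-1}$. Let $C^{\nu}_m$ denote the Gegenbauer polynomial of degree $m$ and order $\nu$, normalized by $C^\nu_m(1)=1$ (so $C^0_m$ is the Chebyshev polynomial $T_m$), put $t=\tanh\lambda$, and let $$h_{m,\lambda}(x)=2^{4-n}\,t^{3-n}\,x\,C_m^{\frac{n-3}{2}}\!\Big(\frac{x^2+1-t^2}{2x}\Big)\big((1+t-x)(1+t+x)(x-1+t)(x+1-t)\big)^{\frac{n-4}{2}}$$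 for $1-t\le x\le 1+t$, and $h_{m,\lambda}(x)=0$ for all other $x$. Let $\mathcal MF(s)=\int_0^\infty y^{s-1}F(y)\,dy$ be the Mellin transform. Then: (a) The sets $\mathrm S_{\psi,c}$ ($\psi\in\mathbb S^{n-2}$, $c>0$) are exactly the intersections of $\mathbb S^{n-1}$ with hyperplanes tangent to $\Sigma_\lambda$ that contain more than one point. (b) Let $m\ge0$, $1\le l\le d_m$ and $\varrho\in(0,1)$. The integrals defining $\mathcal M(\mathcal K_{m,l})(s)$ and $\mathcal M(h_{m,\lambda})(1-s)$ converge absolutely for all $s$ with $\Re s=\varrho$, and $\mathcal M(h_{m,\lambda})(1-s)\ne0$ for almost every such $s$. For every $r>0$ $$f_{m,l}(r)=\frac{(1+r^2)^{n-2}}{2\pi i}\int_{\varrho-i\infty}^{\varrho+i\infty}r^{-s}\,\frac{\mathcal M(\mathcal K_{m,l})(s)}{\mathcal M(h_{m,\lambda})(1-s)}\,ds ,$$ where the integral is understood in the following sense. With $I(T)=\frac{1}{2\pi i}\int_{\varrho-iT}^{\varrho+iT}r^{-s}\frac{\mathcal M(\mathcal K_{m,l})(s)}{\mathcal M(h_{m,\lambda})(1-s)}ds$: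 (i) if $u\mapsto (f_{m,l}(u)-f_{m,l}(r))/(u-r)$ is integrable in a neighbourhood of $r$ (for instance, if $f_{m,l}$ is differentiable at $r$ or Hölder continuous near $r$), then $(1+r^2)^{n-2}I(T)\to f_{m,l}(r)$ as $T\to\infty$; (ii) for every $r>0$ without exception, the integral is Cesàro summable to this value, i.e. $(1+r^2)^{n-2}\,\frac1T\int_0^T I(\tau)\,d\tau\to f_{m,l}(r)$ as $T\to\infty$; in particular, the formula holds in the ordinary sense at every $r$ where $\lim_{T\to\infty}I(T)$ exists. -/

import Mathlib

open MeasureTheory Metric Set Filter Topology Polynomial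
open scoped ComplexConjugate

namespace SpheroidTransform

/-! Throughout, `d = n - 1`: the unit sphere `S^{n-1}` lies in `ℝ^{d+1}`, the stereographic image is
`ℝ^d`, whose unit sphere is `S^{n-2} = S^{d-1}`.  The distinguished axis is the last one. -/

/-- The standard volume `ω_k = 2 π^{(k+1)/2} / Γ((k+1)/2)` of the unit sphere `S^k`. -/
noncomputable def sphereVolume (k : ℕ) : ℝ :=
  2 * Real.pi ^ (((k : ℝ) + 1) / 2) / Real.Gamma (((k : ℝ) + 1) / 2)

/-- The spheroid `x_n² + (x_1² + ⋯ + x_{n-1}²) cosh² λ = 1`. -/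
def spheroid (d : ℕ) (lam : ℝ) : Set (EuclideanSpace ℝ (Fin (d + 1))) :=
  {x | x (Fin.last d) ^ 2 + (∑ i : Fin d, x i.castSucc ^ 2) * Real.cosh lam ^ 2 = 1}

/-- The hyperplane through `p` orthogonal to half the gradient at `p` of the quadratic form
that defines the spheroid. -/
def tangentHyperplane {d : ℕ} (lam : ℝ) (p : EuclideanSpace ℝ (Fin (d + 1))) :
    Set (EuclideanSpace ℝ (Fin (d + 1))) :=
  {x | p (Fin.last d) * (x (Fin.last d) - p (Fin.last d)) +
    Real.cosh lam ^ 2 * ∑ i : Fin d, p i.castSucc * (x i.castSucc - p i.castSucc) = 0}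

/-- The subspheres cut out of the unit sphere by the hyperplanes tangent to the spheroid.  The two
tangent hyperplanes at the poles meet the unit sphere in a single point only and give no
subsphere. -/
def tangentSubspheres (d : ℕ) (lam : ℝ) : Set (Set (EuclideanSpace ℝ (Fin (d + 1)))) :=
  {T | ∃ p ∈ spheroid d lam, T = sphere 0 1 ∩ tangentHyperplane lam p ∧ T.Nontrivial}

/-- The inverse stereographic projection `Λ⁻¹`. -/
noncomputable def stereoInv {d : ℕ} (y : EuclideanSpace ℝ (Fin d)) :
    EuclideanSpace ℝ (Fin (d + 1)) :=
  WithLp.toLp 2 (Fin.snoc (α := fun _ => ℝ) (fun i => 2 * y i / (1 + ‖y‖ ^ 2))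
    ((-1 + ‖y‖ ^ 2) / (1 + ‖y‖ ^ 2)))

/-- The subsphere `S_{ψ,c} = {Λ⁻¹(c ψ + c (tanh λ) ω) : ω ∈ S^{n-2}}`. -/
noncomputable def subsphere {d : ℕ} (lam : ℝ) (ψ : sphere (0 : EuclideanSpace ℝ (Fin d)) 1)
    (c : ℝ) : Set (EuclideanSpace ℝ (Fin (d + 1))) :=
  range fun ω : sphere (0 : EuclideanSpace ℝ (Fin d)) 1 =>
    stereoInv (c • (ψ : EuclideanSpace ℝ (Fin d)) +
      (c * Real.tanh lam) • (ω : EuclideanSpace ℝ (Fin d)))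

/-- The spherical transform: the integral of `f` over an `(n-2)`-dimensional subsphere `T` of
`S^{n-1}` with respect to surface measure (`μHE[k]` is the `k`-dimensional Hausdorff measure,
normalized to agree with Lebesgue measure on `ℝ^k`). -/
noncomputable def sphericalTransform {d : ℕ} (f : EuclideanSpace ℝ (Fin (d + 1)) → ℂ)
    (T : Set (EuclideanSpace ℝ (Fin (d + 1)))) : ℂ :=
  ∫ x in T, f x ∂μHE[d - 1]

/-- `f**(x) = f(Λ⁻¹ x) / (|x|^{n-2} (1 + |x|²)^{n-2})`. -/
noncomputable def fStarStar {d : ℕ} (f : EuclideanSpace ℝ (Fin (d + 1)) → ℂ)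
    (x : EuclideanSpace ℝ (Fin d)) : ℂ :=
  f (stereoInv x) / ((‖x‖ ^ (d - 1) * (1 + ‖x‖ ^ 2) ^ (d - 1) : ℝ) : ℂ)

/-! ### Spherical harmonics on the unit sphere of `ℝ^d` -/

/-- The Laplacian on polynomials. -/
noncomputable def polyLaplacian (d : ℕ) :
    MvPolynomial (Fin d) ℂ →ₗ[ℂ] MvPolynomial (Fin d) ℂ :=
  ∑ i : Fin d, (MvPolynomial.pderiv (R := ℂ) i).toLinearMap ∘ₗ
    (MvPolynomial.pderiv (R := ℂ) i).toLinearMap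

/-- Restriction of a polynomial to the unit sphere. -/
noncomputable def restrictToSphere (d : ℕ) :
    MvPolynomial (Fin d) ℂ →ₗ[ℂ] (sphere (0 : EuclideanSpace ℝ (Fin d)) 1 → ℂ) :=
  LinearMap.pi fun ζ => (MvPolynomial.aeval fun i : Fin d =>
    (((ζ : EuclideanSpace ℝ (Fin d)) i : ℝ) : ℂ)).toLinearMap

/-- Spherical harmonics of degree `m`: restrictions to the unit sphere of homogeneous harmonic
polynomials of degree `m`. -/
noncomputable def sphericalHarmonics (d m : ℕ) :
    Submodule ℂ (sphere (0 : EuclideanSpace ℝ (Fin d)) 1 → ℂ) :=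
  (MvPolynomial.homogeneousSubmodule (Fin d) ℂ m ⊓ LinearMap.ker (polyLaplacian d)).map
    (restrictToSphere d)

/-- The dimension `d_m` of the space of spherical harmonics of degree `m`. -/
noncomputable def harmonicDim (d m : ℕ) : ℕ := Module.finrank ℂ (sphericalHarmonics d m)

/-- `Y m 0, …, Y m (d_m - 1)` is an orthonormal basis of the spherical harmonics of degree `m`, for
every `m` (`volume.toSphere` is the surface measure of the unit sphere). -/
structure IsSphericalHarmonicBasis {d : ℕ}
    (Y : ∀ m : ℕ, Fin (harmonicDim d m) → sphere (0 : EuclideanSpace ℝ (Fin d)) 1 → ℂ) : Prop where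
  mem : ∀ m l, Y m l ∈ sphericalHarmonics d m
  norm_eq_one : ∀ m l,
    ∫ ζ, Y m l ζ * conj (Y m l ζ) ∂(volume : Measure (EuclideanSpace ℝ (Fin d))).toSphere = 1
  orthogonal : ∀ m l m' l', (⟨m, l⟩ : Σ m, Fin (harmonicDim d m)) ≠ ⟨m', l'⟩ →
    ∫ ζ, Y m l ζ * conj (Y m' l' ζ) ∂(volume : Measure (EuclideanSpace ℝ (Fin d))).toSphere = 0

/-- The coefficient at `Y` in the spherical harmonic expansion of `ζ ↦ (f ∘ Λ⁻¹)(r ζ)`. -/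
noncomputable def harmonicCoeff {d : ℕ} (f : EuclideanSpace ℝ (Fin (d + 1)) → ℂ)
    (Y : sphere (0 : EuclideanSpace ℝ (Fin d)) 1 → ℂ) (r : ℝ) : ℂ :=
  ∫ ζ, f (stereoInv (r • (ζ : EuclideanSpace ℝ (Fin d)))) * conj (Y ζ)
    ∂(volume : Measure (EuclideanSpace ℝ (Fin d))).toSphere

/-- The normalized harmonic coefficient
`K(c) = 1 / ((2 c tanh λ)^{n-2} ω_{n-3}) ∫_{S^{n-2}} (Sf)(S_{ψ,c}) conj(Y(ψ)) dψ` of the data. -/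
noncomputable def dataCoeff {d : ℕ} (lam : ℝ) (f : EuclideanSpace ℝ (Fin (d + 1)) → ℂ)
    (Y : sphere (0 : EuclideanSpace ℝ (Fin d)) 1 → ℂ) (c : ℝ) : ℂ :=
  1 / (((2 * c * Real.tanh lam) ^ (d - 1) * sphereVolume (d - 2) : ℝ) : ℂ) *
    ∫ ψ, sphericalTransform f (subsphere lam ψ c) * conj (Y ψ)
      ∂(volume : Measure (EuclideanSpace ℝ (Fin d))).toSphere

/-! ### Gegenbauer polynomials and the kernel -/

/-- The Gegenbauer polynomials of order `ν > -1/2`, normalized to have the value `1` at `1`, through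
their three-term recurrence.  (For `ν = 0` these are the Chebyshev polynomials `T_l`.) -/
noncomputable def gegenbauer (ν : ℝ) : ℕ → ℝ[X]
  | 0 => 1
  | 1 => X
  | l + 2 => C ((l + 1 + 2 * ν)⁻¹) *
      (C (2 * (l + 1 + ν)) * X * gegenbauer ν (l + 1) - C (l + 1 : ℝ) * gegenbauer ν l)

theorem gegenbauer_rec {ν : ℝ} (hν : -(1 / 2) < ν) (l : ℕ) :
    ((l : ℝ[X]) + 1 + 2 * C ν) * gegenbauer ν (l + 2) =
      2 * ((l : ℝ[X]) + 1 + C ν) * X * gegenbauer ν (l + 1) - ((l : ℝ[X]) + 1) * gegenbauer ν l := by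
  have hne : (l : ℝ) + 1 + 2 * ν ≠ 0 := by
    have : (0 : ℝ) ≤ l := l.cast_nonneg
    linarith
  have h1 : ((l : ℝ[X]) + 1 + 2 * C ν) = C ((l : ℝ) + 1 + 2 * ν) := by
    simp only [C_add, C_mul, map_natCast, map_ofNat, C_1]
  have h2 : (2 * ((l : ℝ[X]) + 1 + C ν)) = C (2 * ((l : ℝ) + 1 + ν)) := by
    simp only [C_add, C_mul, map_natCast, map_ofNat, C_1]
  have h3 : ((l : ℝ[X]) + 1) = C ((l : ℝ) + 1) := by simp
  rw [h1, h2, h3, gegenbauer, ← mul_assoc, ← C_mul, mul_inv_cancel₀ hne, C_1, one_mul]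

theorem gegenbauer_deriv {ν : ℝ} (hν : -(1 / 2) < ν) (l : ℕ) :
    (1 - X ^ 2) * derivative (gegenbauer ν l) =
        ((l : ℝ[X]) + 2 * C ν) * (X * gegenbauer ν l - gegenbauer ν (l + 1)) ∧
      (1 - X ^ 2) * derivative (gegenbauer ν (l + 1)) =
        ((l : ℝ[X]) + 1) * (gegenbauer ν l - X * gegenbauer ν (l + 1)) := by
  induction l with
  | zero => simp [gegenbauer]; ring
  | succ l ih =>
    obtain ⟨hB, hA⟩ := ih
    have hr := gegenbauer_rec hν l
    have hne : ((l : ℝ[X]) + 1 + 2 * C ν) ≠ 0 := by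
      have : ((l : ℝ[X]) + 1 + 2 * C ν) = C ((l : ℝ) + 1 + 2 * ν) := by
        simp only [C_add, C_mul, map_natCast, map_ofNat, C_1]
      rw [this, Ne, C_eq_zero]
      have : (0 : ℝ) ≤ l := l.cast_nonneg
      linarith
    have hr' := congrArg derivative hr
    simp only [derivative_mul, derivative_sub, derivative_add, derivative_natCast, derivative_one,
      derivative_C, derivative_X, derivative_ofNat, zero_mul, mul_zero, add_zero, zero_add,
      mul_one] at hr'
    constructor
    · push_cast
      linear_combination hA + hr
    · apply mul_left_cancel₀ hne
      push_cast
      linear_combination (1 - X ^ 2) * hr' + 2 * ((l : ℝ[X]) + 1 + C ν) * X * hA -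
        ((l : ℝ[X]) + 1) * hB + (l + 2) * X * hr

theorem gegenbauer_ode {ν : ℝ} (hν : -(1 / 2) < ν) (l : ℕ) :
    (1 - X ^ 2) * derivative (derivative (gegenbauer ν l)) -
        (2 * C ν + 1) * X * derivative (gegenbauer ν l) =
      -((l : ℝ[X]) * ((l : ℝ[X]) + 2 * C ν)) * gegenbauer ν l := by
  have hne : (1 - X ^ 2 : ℝ[X]) ≠ 0 := by
    intro h
    have := congrArg (eval 0) h
    simp at this
  obtain ⟨hB, hA⟩ := gegenbauer_deriv hν l
  have hB' := congrArg derivative hB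
  simp only [derivative_mul, derivative_sub, derivative_add, derivative_natCast, derivative_one,
      derivative_C, derivative_X, derivative_ofNat, derivative_X_pow, zero_mul, mul_zero, add_zero,
      zero_add, one_mul] at hB'
  push_cast at hB'
  apply mul_left_cancel₀ hne
  simp only [map_ofNat, pow_one] at hB'
  linear_combination (1 - X ^ 2) * hB' +
    (2 * X + ((l : ℝ[X]) + 2 * C ν) * X - (2 * C ν + 1) * X) * hB - ((l : ℝ[X]) + 2 * C ν) * hA

theorem gegenbauer_weight_integrable {ν : ℝ} (hν : -(1 / 2) < ν) (p : ℝ[X]) :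
    IntervalIntegrable (fun t : ℝ => p.eval t * (1 - t ^ 2) ^ (ν - 1 / 2)) volume (-1) 1 := by
  apply IntervalIntegrable.continuousOn_mul _ p.continuous.continuousOn
  have key : IntervalIntegrable (fun t : ℝ => (1 - t ^ 2) ^ (ν - 1 / 2)) volume (-1) 0 := by
    have h1 : IntervalIntegrable (fun t : ℝ => (t + 1) ^ (ν - 1 / 2)) volume (-1) 0 := by
      have := (intervalIntegral.intervalIntegrable_rpow' (a := 0) (b := 1)
        (r := ν - 1 / 2) (by linarith)).comp_add_right 1
      simpa using this
    have h2 : ContinuousOn (fun t : ℝ => (1 - t) ^ (ν - 1 / 2)) (Set.uIcc (-1) 0) := by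
      apply ContinuousOn.rpow_const (by fun_prop)
      intro t ht
      rw [Set.uIcc_of_le (by norm_num)] at ht
      left; linarith [ht.2]
    refine (h1.mul_continuousOn h2).congr ?_
    intro t ht
    rw [Set.uIoc_of_le (by norm_num)] at ht
    simp only
    rw [← Real.mul_rpow (by linarith [ht.1]) (by linarith [ht.2])]
    ring_nf
  refine key.trans ?_
  have := (IntervalIntegrable.iff_comp_neg).1 key
  simpa using this.symm

theorem gegenbauer_weight_parts {ν : ℝ} (hν : -(1 / 2) < ν) (p : ℝ[X]) :
    ∫ t in (-1 : ℝ)..1, ((1 - X ^ 2) * derivative p - (2 * C ν + 1) * X * p).eval t *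
      (1 - t ^ 2) ^ (ν - 1 / 2) = 0 := by
  have h := intervalIntegral.integral_eq_sub_of_hasDerivAt_of_le (a := -1) (b := 1)
    (f := fun t : ℝ => (1 - t ^ 2) ^ (ν + 1 / 2) * p.eval t)
    (f' := fun t : ℝ => ((1 - X ^ 2) * derivative p - (2 * C ν + 1) * X * p).eval t *
      (1 - t ^ 2) ^ (ν - 1 / 2)) (by norm_num) ?_ ?_ (gegenbauer_weight_integrable hν _)
  · rw [h]
    have : ν + 1 / 2 ≠ 0 := by linarith
    norm_num [Real.zero_rpow this]
  · apply ContinuousOn.mul _ p.continuous.continuousOn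
    apply ContinuousOn.rpow_const (by fun_prop)
    intro t ht; right; linarith
  · intro t ht
    have hpos : 0 < 1 - t ^ 2 := by nlinarith [ht.1, ht.2]
    have h0 : HasDerivAt (fun t : ℝ => 1 - t ^ 2) (-(2 * t)) t := by
      simpa using (hasDerivAt_pow 2 t).const_sub 1
    have h1 := (h0.rpow_const (p := ν + 1 / 2) (Or.inl hpos.ne')).mul (p.hasDerivAt t)
    refine h1.congr_deriv ?_
    have h2 : (1 - t ^ 2) ^ (ν + 1 / 2) = (1 - t ^ 2) ^ (ν - 1 / 2) * (1 - t ^ 2) := by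
      rw [← Real.rpow_add_one hpos.ne']; ring_nf
    rw [h2, show ν + 1 / 2 - 1 = ν - 1 / 2 by ring]
    simp
    ring

theorem gegenbauer_orthogonal {ν : ℝ} (hν : -(1 / 2) < ν) {l k : ℕ} (hlk : l ≠ k) :
    ∫ t in (-1 : ℝ)..1, (gegenbauer ν l).eval t * (gegenbauer ν k).eval t *
      (1 - t ^ 2) ^ (ν - 1 / 2) = 0 := by
  have h := gegenbauer_weight_parts hν (derivative (gegenbauer ν l) * gegenbauer ν k -
    gegenbauer ν l * derivative (gegenbauer ν k))
  have e : (1 - X ^ 2) * derivative (derivative (gegenbauer ν l) * gegenbauer ν k -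
      gegenbauer ν l * derivative (gegenbauer ν k)) - (2 * C ν + 1) * X *
      (derivative (gegenbauer ν l) * gegenbauer ν k -
      gegenbauer ν l * derivative (gegenbauer ν k)) =
      C (((k : ℝ) - l) * (k + l + 2 * ν)) * (gegenbauer ν l * gegenbauer ν k) := by
    simp only [derivative_mul, derivative_sub, C_mul, C_add, C_sub, map_natCast, map_ofNat]
    linear_combination gegenbauer ν k * gegenbauer_ode hν l - gegenbauer ν l * gegenbauer_ode hν k
  rw [e] at h
  simp only [eval_mul, eval_C, mul_assoc, intervalIntegral.integral_const_mul] at h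
  have hne : (k : ℝ) - l ≠ 0 := sub_ne_zero.2 (by exact_mod_cast hlk.symm)
  have hne' : (k : ℝ) + (l + 2 * ν) ≠ 0 := by
    have : (1 : ℝ) ≤ k + l := by
      have : 1 ≤ k + l := by omega
      exact_mod_cast this
    linarith
  simpa [hne, hne', mul_assoc, add_assoc] using h

theorem gegenbauer_weight_integral {ν : ℝ} (hν : -(1 / 2) < ν) :
    ∫ t in (-1 : ℝ)..1, (1 - t ^ 2) ^ (ν - 1 / 2) =
      2 ^ (2 * ν) * Real.Gamma (ν + 1 / 2) ^ 2 / Real.Gamma (2 * ν + 1) := by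
  have hb := ProbabilityTheory.beta_eq_betaIntegralReal (ν + 1 / 2) (ν + 1 / 2)
    (by linarith) (by linarith)
  have hb' : (Complex.betaIntegral ((ν + 1 / 2 : ℝ) : ℂ) ((ν + 1 / 2 : ℝ) : ℂ)) =
      ((∫ x in (0 : ℝ)..1, x ^ (ν - 1 / 2) * (1 - x) ^ (ν - 1 / 2) : ℝ) : ℂ) := by
    rw [Complex.betaIntegral, ← intervalIntegral.integral_ofReal]
    apply intervalIntegral.integral_congr
    intro x hx
    rw [Set.uIcc_of_le (by norm_num)] at hx
    simp only
    rw [Complex.ofReal_mul, Complex.ofReal_cpow hx.1, Complex.ofReal_cpow (by linarith [hx.2])]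
    push_cast
    ring_nf
  rw [hb', Complex.ofReal_re, ProbabilityTheory.beta] at hb
  have hs := intervalIntegral.integral_comp_mul_add (a := 0) (b := 1)
    (fun t : ℝ => (1 - t ^ 2) ^ (ν - 1 / 2)) (c := 2) two_ne_zero (-1)
  norm_num at hs
  have hs2 : ∫ x in (0 : ℝ)..1, (1 - (2 * x + -1) ^ 2) ^ (ν - 1 / 2) =
      4 ^ (ν - 1 / 2) * ∫ x in (0 : ℝ)..1, x ^ (ν - 1 / 2) * (1 - x) ^ (ν - 1 / 2) := by
    rw [← intervalIntegral.integral_const_mul]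
    apply intervalIntegral.integral_congr
    intro x hx
    rw [Set.uIcc_of_le (by norm_num)] at hx
    simp only
    rw [← Real.mul_rpow hx.1 (by linarith [hx.2]), ← Real.mul_rpow (by norm_num)
      (mul_nonneg hx.1 (by linarith [hx.2]))]
    ring_nf
  have h4 : (4 : ℝ) ^ (ν - 1 / 2) = 2 ^ (2 * ν) / 2 := by
    rw [show (4 : ℝ) = 2 ^ (2 : ℝ) by norm_num, ← Real.rpow_mul (by norm_num),
      show 2 * (ν - 1 / 2) = 2 * ν - 1 by ring, Real.rpow_sub_one (by norm_num)]
  rw [hs2, ← hb, h4] at hs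
  have e : ν + 1 / 2 + (ν + 1 / 2) = 2 * ν + 1 := by ring
  rw [e] at hs
  linear_combination (-2) * hs

theorem gegenbauer_norm_succ {ν : ℝ} (hν : -(1 / 2) < ν) (l : ℕ) :
    ∫ t in (-1 : ℝ)..1, (gegenbauer ν (l + 1)).eval t * (gegenbauer ν (l + 1)).eval t *
      (1 - t ^ 2) ^ (ν - 1 / 2) =
    2 ^ (2 * ν - 1) * Real.Gamma (ν + 1 / 2) ^ 2 * (l + 1).factorial /
      ((l + 1 + ν) * Real.Gamma (l + 1 + 2 * ν)) := by
  set I : ℝ[X] → ℝ := fun p => ∫ t in (-1 : ℝ)..1, p.eval t * (1 - t ^ 2) ^ (ν - 1 / 2) with hI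
  have hadd : ∀ p q, I (p + q) = I p + I q := by
    intro p q
    simp only [hI]
    rw [← intervalIntegral.integral_add (gegenbauer_weight_integrable hν p)
      (gegenbauer_weight_integrable hν q)]
    simp only [eval_add, add_mul]
  have hmul : ∀ (a : ℝ) p, I (C a * p) = a * I p := by
    intro a p
    simp only [hI, eval_mul, eval_C, mul_assoc, intervalIntegral.integral_const_mul]
  have horth : ∀ {l k : ℕ}, l ≠ k → I (gegenbauer ν l * gegenbauer ν k) = 0 := by
    intro l k h
    simpa only [hI, eval_mul] using gegenbauer_orthogonal hν h
  have hgoal : ∀ l, ∫ t in (-1 : ℝ)..1, (gegenbauer ν l).eval t * (gegenbauer ν l).eval t *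
      (1 - t ^ 2) ^ (ν - 1 / 2) = I (gegenbauer ν l * gegenbauer ν l) := by
    intro l
    simp only [hI, eval_mul]
  rw [hgoal]
  induction l with
  | zero =>
    have h1 : I ((1 - X ^ 2) * derivative X - (2 * C ν + 1) * X * X) = 0 :=
      gegenbauer_weight_parts hν X
    have e : ((1 - X ^ 2) * derivative X - (2 * C ν + 1) * X * X : ℝ[X]) =
        1 + C (-(2 * (ν + 1))) * (X * X) := by
      simp only [derivative_X, C_neg, C_mul, C_add, map_ofNat, C_1]
      ring
    have h0 : I 1 = 2 ^ (2 * ν) * Real.Gamma (ν + 1 / 2) ^ 2 / Real.Gamma (2 * ν + 1) := by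
      simp only [hI, eval_one, one_mul]
      exact gegenbauer_weight_integral hν
    rw [e, hadd, hmul, h0] at h1
    have hG : Real.Gamma (2 * ν + 1) ≠ 0 := (Real.Gamma_pos_of_pos (by linarith)).ne'
    have hn : ν + 1 ≠ 0 := by linarith
    have h2 : (2 : ℝ) ^ (2 * ν - 1) = 2 ^ (2 * ν) / 2 := Real.rpow_sub_one (by norm_num) _
    have e2 : ((0 : ℕ) : ℝ) + 1 + 2 * ν = 2 * ν + 1 := by push_cast; ring
    have e3 : ((0 : ℕ) : ℝ) + 1 + ν = ν + 1 := by push_cast; ring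
    rw [e2, e3, h2, eq_div_iff (mul_ne_zero hn hG)]
    simp only [zero_add, gegenbauer, Nat.factorial_one, Nat.cast_one, mul_one]
    generalize Real.Gamma (ν + 1 / 2) = g at h1 ⊢
    field_simp at h1
    linear_combination (-1 / 2) * h1
  | succ l ih =>
    have r1 := congrArg (fun p => I (p * gegenbauer ν (l + 2))) (gegenbauer_rec hν l)
    have r2 := congrArg (fun p => I (p * gegenbauer ν (l + 1))) (gegenbauer_rec hν (l + 1))
    beta_reduce at r1 r2
    have e1 : ((l : ℝ[X]) + 1 + 2 * C ν) * gegenbauer ν (l + 2) * gegenbauer ν (l + 2) =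
        C ((l : ℝ) + 1 + 2 * ν) * (gegenbauer ν (l + 2) * gegenbauer ν (l + 2)) := by
      simp only [C_add, C_mul, map_natCast, map_ofNat, C_1]; ring
    have e2 : (2 * ((l : ℝ[X]) + 1 + C ν) * X * gegenbauer ν (l + 1) -
        ((l : ℝ[X]) + 1) * gegenbauer ν l) * gegenbauer ν (l + 2) =
        C (2 * ((l : ℝ) + 1 + ν)) * (X * gegenbauer ν (l + 1) * gegenbauer ν (l + 2)) +
        C (-((l : ℝ) + 1)) * (gegenbauer ν l * gegenbauer ν (l + 2)) := by
      simp only [C_add, C_mul, C_neg, map_natCast, map_ofNat, C_1]; ring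
    have e3 : (((l + 1 : ℕ) : ℝ[X]) + 1 + 2 * C ν) * gegenbauer ν (l + 1 + 2) *
        gegenbauer ν (l + 1) =
        C ((l : ℝ) + 2 + 2 * ν) * (gegenbauer ν (l + 3) * gegenbauer ν (l + 1)) := by
      simp only [C_add, C_mul, map_natCast, map_ofNat, C_1]; push_cast; ring
    have e4 : (2 * (((l + 1 : ℕ) : ℝ[X]) + 1 + C ν) * X * gegenbauer ν (l + 1 + 1) -
        (((l + 1 : ℕ) : ℝ[X]) + 1) * gegenbauer ν (l + 1)) * gegenbauer ν (l + 1) =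
        C (2 * ((l : ℝ) + 2 + ν)) * (X * gegenbauer ν (l + 1) * gegenbauer ν (l + 2)) +
        C (-((l : ℝ) + 2)) * (gegenbauer ν (l + 1) * gegenbauer ν (l + 1)) := by
      simp only [C_add, C_mul, C_neg, map_natCast, map_ofNat, C_1]; push_cast; ring
    rw [e1, e2, hadd, hmul, hmul, hmul, horth (l := l) (k := l + 2) (by omega)] at r1
    rw [e3, e4, hadd, hmul, hmul, hmul, horth (l := l + 3) (k := l + 1) (by omega), ih] at r2
    have hl : (0 : ℝ) ≤ l := l.cast_nonneg
    have hs : (0 : ℝ) < l + 1 + 2 * ν := by linarith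
    have hG : Real.Gamma (l + 1 + 2 * ν) ≠ 0 := (Real.Gamma_pos_of_pos hs).ne'
    have n1 : (l : ℝ) + 1 + ν ≠ 0 := by linarith
    have n2 : (l : ℝ) + 2 + ν ≠ 0 := by linarith
    have hGs : Real.Gamma (((l + 1 : ℕ) : ℝ) + 1 + 2 * ν) =
        (l + 1 + 2 * ν) * Real.Gamma (l + 1 + 2 * ν) := by
      rw [← Real.Gamma_add_one hs.ne']; push_cast; ring_nf
    have e5 : ((l + 1 : ℕ) : ℝ) + 1 + ν = l + 2 + ν := by push_cast; ring
    rw [hGs, e5, Nat.factorial_succ (l + 1), eq_div_iff (by positivity)]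
    push_cast
    have e6 : l + 1 + 1 = l + 2 := rfl
    rw [e6]
    generalize Real.Gamma (ν + 1 / 2) = g at r2 ⊢
    generalize Real.Gamma (l + 1 + 2 * ν) = G at r2 hG ⊢
    generalize I (X * gegenbauer ν (l + 1) * gegenbauer ν (l + 2)) = J at r1 r2
    generalize I (gegenbauer ν (l + 2) * gegenbauer ν (l + 2)) = H at r1 ⊢
    field_simp at r2
    linear_combination ((l : ℝ) + 2 + ν) * G * r1 - r2

/-- The polynomials `gegenbauer ν` satisfy the orthogonality relations by which (together with
`deg = l` and the value `1` at `1`) they are usually characterized.  For `l = 0`, `ν = 0` the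
right-hand side has to be read as the limit `ν → 0`, which is why that case is left out here. -/
theorem gegenbauer_orthogonality {ν : ℝ} (hν : -(1 / 2) < ν) (l k : ℕ) (h0 : l = 0 → ν ≠ 0) :
    ∫ t in (-1 : ℝ)..1, (gegenbauer ν l).eval t * (gegenbauer ν k).eval t *
      (1 - t ^ 2) ^ (ν - 1 / 2) =
    if l = k then 2 ^ (2 * ν - 1) * Real.Gamma (ν + 1 / 2) ^ 2 * l.factorial /
      ((l + ν) * Real.Gamma (l + 2 * ν)) else 0 := by
  split_ifs with h
  · subst h
    rcases l with _ | l
    · have hn := h0 rfl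
      have hG := Real.Gamma_add_one (s := 2 * ν) (by simpa using hn)
      have h2 : (2 : ℝ) ^ (2 * ν - 1) = 2 ^ (2 * ν) / 2 := Real.rpow_sub_one (by norm_num) _
      have := gegenbauer_weight_integral hν
      rw [hG] at this
      simp only [gegenbauer, eval_one, one_mul, this, h2, Nat.factorial_zero, Nat.cast_zero,
        Nat.cast_one, zero_add, mul_one]
      have hp : 0 < Real.Gamma (2 * ν + 1) := Real.Gamma_pos_of_pos (by linarith)
      have : Real.Gamma (2 * ν) ≠ 0 := by
        intro h; rw [hG, h] at hp; simp at hp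
      field_simp
    · simpa using gegenbauer_norm_succ hν l
  · exact gegenbauer_orthogonal hν h

theorem gegenbauer_eval_one {ν : ℝ} (hν : -(1 / 2) < ν) (l : ℕ) :
    (gegenbauer ν l).eval 1 = 1 := by
  cases l with
  | zero => simp [gegenbauer]
  | succ l =>
    have h := congrArg (eval 1) (gegenbauer_deriv hν l).2
    have hl : (l : ℝ) + 1 ≠ 0 := by positivity
    induction l with
    | zero => simp [gegenbauer]
    | succ l ih =>
      have h' := ih (congrArg (eval 1) (gegenbauer_deriv hν l).2) (by positivity)
      simp only [eval_mul, eval_sub, eval_one, eval_pow, eval_X, one_pow, sub_self, zero_mul,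
        eval_add, eval_natCast, one_mul, h'] at h
      have := (mul_eq_zero.1 h.symm).resolve_left hl
      linarith

/-- The kernel `h_{m,λ}`; here `d - 3 = n - 4`, `d - 2 = n - 3`. -/
noncomputable def kernel (d m : ℕ) (lam x : ℝ) : ℝ :=
  if 1 - Real.tanh lam ≤ x ∧ x ≤ 1 + Real.tanh lam then
    (2 : ℝ) ^ (3 - (d : ℤ)) * Real.tanh lam ^ (2 - (d : ℤ)) * x *
      (gegenbauer (((d : ℝ) - 2) / 2) m).eval ((x ^ 2 + 1 - Real.tanh lam ^ 2) / (2 * x)) *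
      ((1 + Real.tanh lam - x) * (1 + Real.tanh lam + x) *
        (x - 1 + Real.tanh lam) * (x + 1 - Real.tanh lam)) ^ (((d : ℝ) - 3) / 2)
  else 0

/-- The truncated inversion integral `1/(2πi) ∫_{ϱ-iT}^{ϱ+iT} r^{-s} Q(s) ds`. -/
noncomputable def truncatedMellinInv (ϱ : ℝ) (Q : ℂ → ℂ) (r T : ℝ) : ℂ :=
  1 / (2 * Real.pi) * ∫ y in (-T)..T,
    (r : ℂ) ^ (-((ϱ : ℂ) + y * Complex.I)) * Q ((ϱ : ℂ) + y * Complex.I)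

/-- The quotient `M(K)(s) / M(h_{m,λ})(1 - s)` of Mellin transforms, where `K` is the harmonic
coefficient of the data of `f` at the spherical harmonic `Y` of degree `m`. -/
noncomputable def mellinQuotient {d : ℕ} (m : ℕ) (lam : ℝ)
    (f : EuclideanSpace ℝ (Fin (d + 1)) → ℂ)
    (Y : sphere (0 : EuclideanSpace ℝ (Fin d)) 1 → ℂ) (s : ℂ) : ℂ :=
  mellin (dataCoeff lam f Y) s / mellin (fun x => (kernel d m lam x : ℂ)) (1 - s)

end SpheroidTransform

open SpheroidTransform

/-! Write t = tanh λ. In stereographic coordinates the problem becomes a convolution with respect to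
dilations. A hyperplane tangent to the spheroid away from its poles cuts the unit sphere in the
image of the Euclidean sphere with centre cψ and radius ct (`tangentSubspheres_eq`). Since
`stereoInv` multiplies each distance by one factor for either end point, surface measure pulls back
with an explicit density, and the integral of f over the subsphere is (2ct)^(d-1) times the integral
over unit ω of F(cψ + ctω), where F(y) = f(Λ⁻¹y)/(1+|y|²)^(d-1) (`sphericalTransform_subsphere`).

The pairing with a spherical harmonic Y of degree m is computed by averaging over the orthogonal
group. For fixed unit vectors e, ω the Haar average of F(R⁻¹(ce + ctω)) conj Y(R⁻¹e) is handled by a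
Funk-Hecke argument: as a function of the point at which Y is evaluated, such an average is the
restriction of a homogeneous harmonic polynomial invariant under the stabilizer of an axis, hence a
multiple of the Gegenbauer polynomial of the cosine with that axis
(`integral_haarProb_mul_harmonic`). Taking x = |e + tω| as variable gives K(c) = ∫ h(x) g(cx) dx
with g(r) = f_{m,l}(r)/(1+r²)^(d-1) (`dataCoeff_eq_integral_kernel`).

Therefore MK(s) = Mh(1-s) Mg(s). The kernel h lives on [1-t, 1+t], away from 0, so Mh is entire; it
is not identically zero because h is positive near 1+t. Its zeros on a vertical line thus form a
null set, and MK(s)/Mh(1-s) equals Mg(s) almost everywhere on the line. What remains is Mellin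
inversion of the continuous function g at a point. In logarithmic coordinates this is Fourier
inversion: Dini's criterion gives convergence (`tendsto_truncatedMellinInv_of_dini`), Fejér's
theorem gives Cesàro summability (`tendsto_cesaro_truncatedMellinInv`). -/

namespace SpheroidTransform

/-! ### Pointwise inversion of the Fourier and Mellin transforms -/

/-! ### Fourier inversion at the point 0: the tests of Dini and Fejér. -/

section Fourier

open scoped FourierTransform

theorem integral_exp_symm_interval (A v : ℝ) :
    ∫ w in (-A)..A, Complex.exp (((-2 * Real.pi * v * w : ℝ) : ℂ) * Complex.I) =
      ((2 * A * Real.sinc (2 * Real.pi * A * v) : ℝ) : ℂ) := by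
  rcases eq_or_ne v 0 with rfl | hv
  · simp; ring
  rcases eq_or_ne A 0 with rfl | hA
  · simp
  have hpi := Real.pi_pos.ne'
  have h0 : (2 * Real.pi * A * v) ≠ 0 := by positivity
  have hc : ((-2 * Real.pi * v : ℝ) : ℂ) * Complex.I ≠ 0 := by
    simp [hv, hpi]
  have e : ∀ w : ℝ, Complex.exp (((-2 * Real.pi * v * w : ℝ) : ℂ) * Complex.I) =
      Complex.exp (((-2 * Real.pi * v : ℝ) : ℂ) * Complex.I * w) := by
    intro w; congr 1; push_cast; ring
  simp_rw [e]
  rw [integral_exp_mul_complex hc, Real.sinc_of_ne_zero h0, div_eq_iff hc]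
  have e1 : ((-2 * Real.pi * v : ℝ) : ℂ) * Complex.I * (A : ℂ) =
      -((2 * Real.pi * A * v : ℝ) : ℂ) * Complex.I := by push_cast; ring
  have e2 : ((-2 * Real.pi * v : ℝ) : ℂ) * Complex.I * ((-A : ℝ) : ℂ) =
      ((2 * Real.pi * A * v : ℝ) : ℂ) * Complex.I := by push_cast; ring
  rw [e1, e2]
  have hs := Complex.ofReal_sin (2 * Real.pi * A * v)
  rw [Complex.sin] at hs
  have hne : ((2 * Real.pi * A * v : ℝ) : ℂ) ≠ 0 := by exact_mod_cast h0
  rw [Complex.ofReal_mul (2 * A), Complex.ofReal_div (Real.sin _), hs]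
  field_simp
  push_cast
  linear_combination (4 * (A : ℂ) * Real.pi * v *
    (Complex.exp (-(2 * Real.pi * A * v * Complex.I)) -
    Complex.exp (2 * Real.pi * A * v * Complex.I))) * Complex.I_sq

theorem integrable_exp_smul {G : ℝ → ℂ} (hG : Integrable G) (w : ℝ) : Integrable fun v : ℝ =>
    Complex.exp (((-2 * Real.pi * v * w : ℝ) : ℂ) * Complex.I) • G v := by
  refine hG.mono ?_ (.of_forall fun v => by simp [Complex.norm_exp])
  refine AEStronglyMeasurable.fun_smul ?_ hG.1
  apply Continuous.aestronglyMeasurable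
  fun_prop

theorem isFiniteMeasure_restrict_uIoc (a b : ℝ) :
    IsFiniteMeasure (volume.restrict (uIoc a b)) := ⟨by simp [uIoc]⟩

/-- Fubini on a finite interval: the truncated inversion integral pairs `F` with the Dirichlet
kernel. Writing it with `sinc` keeps the formula valid at v = 0. -/
theorem integral_fourier_symm_interval {F : ℝ → ℂ} (hF : Integrable F) (A : ℝ) :
    ∫ w in (-A)..A, 𝓕 F w = ∫ v, ((2 * A * Real.sinc (2 * Real.pi * A * v) : ℝ) : ℂ) * F v := by
  simp_rw [Real.fourier_real_eq_integral_exp_smul]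
  rw [intervalIntegral_integral_swap]
  · congr 1
    ext v
    simp_rw [smul_eq_mul, intervalIntegral.integral_mul_const]
    rw [integral_exp_symm_interval]
  · have := isFiniteMeasure_restrict_uIoc (-A) A
    have h : Integrable (fun p : ℝ × ℝ => (1 : ℂ) * F p.2)
        ((volume.restrict (uIoc (-A) A)).prod volume) :=
      Integrable.mul_prod (f := fun _ : ℝ => (1 : ℂ)) (integrable_const _) hF
    refine h.mono ?_ ?_
    · refine AEStronglyMeasurable.fun_smul (f := fun p : ℝ × ℝ =>
        Complex.exp (((-2 * Real.pi * p.2 * p.1 : ℝ) : ℂ) * Complex.I)) ?_ ?_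
      · apply Continuous.aestronglyMeasurable
        fun_prop
      · exact hF.1.comp_snd
    · refine .of_forall fun p => ?_
      simp [Function.uncurry, Complex.norm_exp]

/-- The Dirichlet kernel is sin(2πAv)/(πv), so the pairing with H is, up to a constant, the
difference of the Fourier transforms of H(v)/v at -A and A. Both tend to 0 by the Riemann-Lebesgue
lemma. -/
theorem tendsto_integral_fourier_of_integrable_div {H : ℝ → ℂ} (hH : Integrable H)
    (hdiv : Integrable fun v : ℝ => H v / (v : ℂ)) :
    Tendsto (fun A : ℝ => ∫ w in (-A)..A, 𝓕 H w) atTop (𝓝 0) := by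
  have hR := Real.zero_at_infty_fourier (fun v : ℝ => H v / (v : ℂ))
  have h1 : Tendsto (𝓕 fun v : ℝ => H v / (v : ℂ)) atTop (𝓝 0) :=
    hR.mono_left atTop_le_cocompact
  have h2 : Tendsto (fun A : ℝ => 𝓕 (fun v : ℝ => H v / (v : ℂ)) (-A)) atTop (𝓝 0) :=
    (hR.mono_left atBot_le_cocompact).comp tendsto_neg_atTop_atBot
  have h3 := (h2.sub h1).const_mul (1 / (2 * Real.pi * Complex.I))
  rw [sub_zero, mul_zero] at h3
  refine h3.congr fun A => ?_
  rw [integral_fourier_symm_interval hH, Real.fourier_real_eq_integral_exp_smul,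
    Real.fourier_real_eq_integral_exp_smul, ← integral_sub, ← integral_const_mul]
  · apply integral_congr_ae
    have h0 : ∀ᵐ v : ℝ, v ≠ 0 := by
      simp [ae_iff]
    filter_upwards [h0] with v hv
    have hpi := Real.pi_pos.ne'
    have hv' : (v : ℂ) ≠ 0 := by exact_mod_cast hv
    have hpi' : (Real.pi : ℂ) ≠ 0 := by exact_mod_cast hpi
    rcases eq_or_ne A 0 with rfl | hA
    · simp
    have hA' : (A : ℂ) ≠ 0 := by exact_mod_cast hA
    have hne : (2 * Real.pi * A * v) ≠ 0 := by positivity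
    rw [Real.sinc_of_ne_zero hne, Complex.ofReal_mul (2 * A), Complex.ofReal_div (Real.sin _),
      Complex.ofReal_sin, Complex.sin]
    have e1 : ((-2 * Real.pi * v * -A : ℝ) : ℂ) * Complex.I =
      ((2 * Real.pi * A * v : ℝ) : ℂ) * Complex.I := by push_cast; ring
    have e2 : ((-2 * Real.pi * v * A : ℝ) : ℂ) * Complex.I =
      -((2 * Real.pi * A * v : ℝ) : ℂ) * Complex.I := by push_cast; ring
    rw [e1, e2]
    generalize Complex.exp (((2 * Real.pi * A * v : ℝ) : ℂ) * Complex.I) = a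
    generalize Complex.exp (-((2 * Real.pi * A * v : ℝ) : ℂ) * Complex.I) = b
    push_cast
    simp only [smul_eq_mul]
    have hI := Complex.I_ne_zero
    field_simp
    linear_combination H v * (a - b) * Complex.I_sq
  · exact integrable_exp_smul hdiv _
  · exact integrable_exp_smul hdiv _

/-- The integral is A times the Fejér kernel. The bound |sinc| ≤ 1 serves for |Av| ≤ 1 and the
closed form (1 - cos(2πvA))/(2π²v²) for |Av| > 1. The common majorant is chosen because, divided by
A, it is a dilate of a multiple of 1/(1+x²), which is an approximate identity. -/
theorem abs_integral_sinc_le {A : ℝ} (hA : 0 < A) (v : ℝ) :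
    |∫ a in (0 : ℝ)..A, 2 * a * Real.sinc (2 * Real.pi * a * v)| ≤
      2 * A ^ 2 / (1 + (A * v) ^ 2) := by
  have hb1 : |∫ a in (0 : ℝ)..A, 2 * a * Real.sinc (2 * Real.pi * a * v)| ≤ A ^ 2 := by
    have : ∫ a in (0 : ℝ)..A, 2 * a = A ^ 2 := by
      rw [intervalIntegral.integral_const_mul, integral_id]; ring
    rw [← this, ← Real.norm_eq_abs]
    apply intervalIntegral.norm_integral_le_of_norm_le hA.le
    · refine .of_forall fun a ha => ?_
      rw [Real.norm_eq_abs, abs_mul, abs_of_pos (by linarith [ha.1] : 0 < 2 * a)]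
      exact mul_le_of_le_one_right (by linarith [ha.1]) (Real.abs_sinc_le_one _)
    · apply Continuous.intervalIntegrable; fun_prop
  rcases le_or_gt ((A * v) ^ 2) 1 with h | h
  · refine hb1.trans ?_
    rw [le_div_iff₀ (by positivity)]
    nlinarith [sq_nonneg A]
  · have hv : v ≠ 0 := by rintro rfl; norm_num at h
    have hpi := Real.pi_pos
    have hval : ∫ a in (0 : ℝ)..A, 2 * a * Real.sinc (2 * Real.pi * a * v) =
        (1 - Real.cos (2 * Real.pi * v * A)) / (2 * Real.pi ^ 2 * v ^ 2) := by
      have : ∀ a : ℝ, 2 * a * Real.sinc (2 * Real.pi * a * v) =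
          (Real.pi * v)⁻¹ * Real.sin (2 * Real.pi * v * a) := by
        intro a
        rcases eq_or_ne a 0 with rfl | ha
        · simp
        rw [Real.sinc_of_ne_zero (by positivity)]
        rw [show 2 * Real.pi * a * v = 2 * Real.pi * v * a by ring]
        field_simp
      simp_rw [this]
      rw [intervalIntegral.integral_const_mul,
        intervalIntegral.integral_comp_mul_left (fun x => Real.sin x) (by positivity)]
      simp
      field_simp
    rw [hval, abs_of_nonneg (by
      apply div_nonneg _ (by positivity); linarith [Real.cos_le_one (2 * Real.pi * v * A)])]
    rw [div_le_div_iff₀ (by positivity) (by positivity)]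
    have h1 : 1 - Real.cos (2 * Real.pi * v * A) ≤ 2 := by
      linarith [Real.neg_one_le_cos (2 * Real.pi * v * A)]
    have h2 : (1:ℝ) ≤ Real.pi ^ 2 := by nlinarith [Real.pi_gt_three]
    have h3 : 1 + (A * v) ^ 2 ≤ 2 * (A * v) ^ 2 := by linarith
    calc _ ≤ 2 * (2 * (A * v) ^ 2) := by
          apply mul_le_mul h1 h3 (by positivity) (by norm_num)
      _ = 2 * A ^ 2 * (2 * 1 * v ^ 2) := by ring
      _ ≤ _ := by gcongr

theorem integral_integral_fourier_symm_interval {F : ℝ → ℂ} (hF : Integrable F) (A : ℝ) :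
    ∫ a in (0 : ℝ)..A, ∫ w in (-a)..a, 𝓕 F w =
      ∫ v, ((∫ a in (0 : ℝ)..A, 2 * a * Real.sinc (2 * Real.pi * a * v) : ℝ) : ℂ) * F v := by
  simp_rw [integral_fourier_symm_interval hF]
  rw [intervalIntegral_integral_swap]
  · congr 1
    ext v
    rw [intervalIntegral.integral_mul_const, ← intervalIntegral.integral_ofReal]
  · have := isFiniteMeasure_restrict_uIoc 0 A
    have h : Integrable (fun p : ℝ × ℝ => ((2 * |A| : ℝ) : ℂ) * F p.2)
        ((volume.restrict (uIoc 0 A)).prod volume) :=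
      Integrable.mul_prod (f := fun _ : ℝ => ((2 * |A| : ℝ) : ℂ)) (integrable_const _) hF
    have hmem : ∀ᵐ p : ℝ × ℝ ∂((volume.restrict (uIoc 0 A)).prod volume), |p.1| ≤ |A| := by
      have : ∀ᵐ a ∂(volume.restrict (uIoc 0 A)), |a| ≤ |A| := by
        filter_upwards [ae_restrict_mem measurableSet_uIoc] with a ha
        simpa using abs_sub_left_of_mem_uIcc (uIoc_subset_uIcc ha)
      exact Measure.quasiMeasurePreserving_fst.ae this
    refine h.mono ?_ ?_
    · refine AEStronglyMeasurable.mul ?_ ?_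
      · apply Continuous.aestronglyMeasurable
        fun_prop
      · exact hF.1.comp_snd
    · filter_upwards [hmem] with p hp
      simp only [Function.uncurry, norm_mul, Complex.norm_real, Real.norm_eq_abs, abs_abs]
      refine mul_le_mul_of_nonneg_right ?_ (norm_nonneg _)
      calc |2| * |p.1| * |Real.sinc (2 * Real.pi * p.1 * p.2)| ≤ |2| * |p.1| * 1 := by
            gcongr; exact Real.abs_sinc_le_one _
        _ ≤ |2| * |A| := by rw [mul_one]; gcongr

/-- Because H(0) = 0, an upper bound for the Fejér kernel suffices: the means are dominated by the
averages of |H| against dilates of the Cauchy density, which tend to |H(0)| = 0. -/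
theorem tendsto_cesaro_integral_fourier_of_tendsto_zero {H : ℝ → ℂ} (hH : Integrable H)
    (h0 : H 0 = 0) (hc : ContinuousAt H 0) :
    Tendsto (fun A : ℝ => (1 / (A : ℂ)) * ∫ a in (0 : ℝ)..A, ∫ w in (-a)..a, 𝓕 H w) atTop
      (𝓝 0) := by
  have hpk := tendsto_integral_comp_smul_smul_of_integrable (F := ℝ) (μ := volume)
    (φ := fun x : ℝ => Real.pi⁻¹ * (1 + x ^ 2)⁻¹) (fun x => by positivity)
    (by rw [integral_const_mul, integral_univ_inv_one_add_sq]
        exact inv_mul_cancel₀ Real.pi_pos.ne')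
    (by
      rw [Module.finrank_self]
      have h1 : Tendsto (fun x : ℝ => Real.pi⁻¹ * ‖x‖⁻¹) (Bornology.cobounded ℝ) (𝓝 0) := by
        have := (tendsto_inv_atTop_zero.comp (tendsto_norm_cobounded_atTop (E := ℝ))).const_mul
          Real.pi⁻¹
        simpa using this
      refine squeeze_zero (fun x => by positivity) (fun x => ?_) h1
      rcases eq_or_ne x 0 with rfl | hx
      · simp
      have hx' : 0 < ‖x‖ := norm_pos_iff.2 hx
      rw [pow_one, mul_left_comm]
      gcongr
      rw [← div_eq_mul_inv, inv_eq_one_div, div_le_div_iff₀ (by positivity) hx']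
      rw [← sq, Real.norm_eq_abs, sq_abs]
      linarith)
    hH.norm hc.norm
  -- The majorant 2A/(1+(Av)²) is 2π times the dilated Cauchy density.
  have hpk2 := hpk.const_mul (2 * Real.pi)
  simp only [h0, norm_zero, mul_zero] at hpk2
  refine squeeze_zero_norm' ?_ hpk2
  filter_upwards [eventually_gt_atTop 0] with A hA
  rw [integral_integral_fourier_symm_interval hH, ← integral_const_mul, ← integral_const_mul]
  refine norm_integral_le_of_norm_le ?_ ?_
  · apply Integrable.const_mul
    simp only [smul_eq_mul]
    apply hH.norm.bdd_mul (c := A * Real.pi⁻¹)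
    · apply Continuous.aestronglyMeasurable
      have : ∀ x : ℝ, 1 + (A * x) ^ 2 ≠ 0 := fun x => by positivity
      fun_prop (disch := simp [this])
    · refine .of_forall fun x => ?_
      rw [Module.finrank_self, pow_one, norm_mul, Real.norm_of_nonneg hA.le,
        Real.norm_of_nonneg (by positivity)]
      gcongr
      apply mul_le_of_le_one_right (by positivity)
      apply inv_le_one_of_one_le₀
      nlinarith [sq_nonneg (A * x)]
  · refine .of_forall fun v => ?_
    rw [norm_mul, norm_mul, Complex.norm_real, Real.norm_eq_abs, norm_div, norm_one,
      Complex.norm_real, Real.norm_of_nonneg hA.le, Module.finrank_self, pow_one, smul_eq_mul,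
      smul_eq_mul, ← mul_assoc, ← mul_assoc]
    refine mul_le_mul_of_nonneg_right ?_ (norm_nonneg _)
    calc 1 / A * _ ≤ 1 / A * (2 * A ^ 2 / (1 + (A * v) ^ 2)) := by
          gcongr; exact abs_integral_sinc_le hA v
      _ = _ := by
        have := Real.pi_pos.ne'
        field_simp

/-- The Gaussian `exp (-π v²)`, which is its own Fourier transform. -/
noncomputable def gaussianPi (v : ℝ) : ℂ := Complex.exp (-Real.pi * v ^ 2)

theorem gaussianPi_eq (v : ℝ) : gaussianPi v = ((Real.exp (-Real.pi * v ^ 2) : ℝ) : ℂ) := by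
  simp [gaussianPi]

theorem gaussianPi_zero : gaussianPi 0 = 1 := by simp [gaussianPi]

theorem continuous_gaussianPi : Continuous gaussianPi := by
  unfold gaussianPi; fun_prop

theorem integrable_gaussianPi : Integrable gaussianPi := by
  simp_rw [funext gaussianPi_eq]
  exact (integrable_exp_neg_mul_sq Real.pi_pos).ofReal

theorem integral_gaussianPi : ∫ v, gaussianPi v = 1 := by
  simp_rw [gaussianPi_eq]
  rw [integral_complex_ofReal, integral_gaussian, div_self Real.pi_pos.ne']; simp

theorem fourier_gaussianPi : 𝓕 gaussianPi = gaussianPi := by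
  have := fourier_gaussian_pi (b := 1) (by simp)
  simp only [mul_one, Complex.one_cpow, div_one, one_mul] at this
  exact this

/-- The Gaussian is the comparison function: subtracting F(0) times it makes F vanish at 0, while
for the Gaussian itself inversion at 0 only says that its total mass is 1. -/
theorem tendsto_integral_fourier_gaussianPi :
    Tendsto (fun A : ℝ => ∫ w in (-A)..A, 𝓕 gaussianPi w) atTop (𝓝 1) := by
  rw [fourier_gaussianPi, ← integral_gaussianPi]
  exact intervalIntegral_tendsto_integral integrable_gaussianPi tendsto_neg_atTop_atBot tendsto_id

/-- The substitution a = Au turns the mean into ∫₀¹ φ(Au) du, to which dominated convergence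
applies. -/
theorem tendsto_cesaro_of_tendsto {φ : ℝ → ℂ} (hφ : Continuous φ) {C : ℝ} (hb : ∀ a, ‖φ a‖ ≤ C)
    {L : ℂ} (h : Tendsto φ atTop (𝓝 L)) :
    Tendsto (fun A : ℝ => (1 / (A : ℂ)) * ∫ a in (0 : ℝ)..A, φ a) atTop (𝓝 L) := by
  have key : Tendsto (fun A : ℝ => ∫ u in (0 : ℝ)..1, φ (A * u)) atTop
      (𝓝 (∫ u in (0 : ℝ)..1, L)) := by
    apply intervalIntegral.tendsto_integral_filter_of_dominated_convergence (fun _ => C)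
    · exact .of_forall fun A => (by fun_prop : Continuous fun u => φ (A * u)).aestronglyMeasurable
    · exact .of_forall fun A => .of_forall fun u _ => hb _
    · simp
    · refine .of_forall fun u hu => ?_
      rw [uIoc_of_le zero_le_one] at hu
      exact h.comp (tendsto_id.atTop_mul_const hu.1)
  simp only [intervalIntegral.integral_const, sub_zero, one_smul] at key
  refine key.congr' ?_
  filter_upwards [eventually_gt_atTop 0] with A hA
  rw [intervalIntegral.integral_comp_mul_left _ hA.ne']
  simp

theorem tendsto_cesaro_fourier_gaussianPi :
    Tendsto (fun A : ℝ => (1 / (A : ℂ)) * ∫ a in (0 : ℝ)..A, ∫ w in (-a)..a, 𝓕 gaussianPi w) atTop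
      (𝓝 1) := by
  refine tendsto_cesaro_of_tendsto (C := ∫ v, ‖gaussianPi v‖) ?_ ?_
    tendsto_integral_fourier_gaussianPi
  · rw [fourier_gaussianPi]
    have : (fun a : ℝ => ∫ w in (-a)..a, gaussianPi w) =
        fun a => (∫ w in (0:ℝ)..a, gaussianPi w) - ∫ w in (0:ℝ)..(-a), gaussianPi w := by
      ext a
      rw [intervalIntegral.integral_interval_sub_left] <;>
      exact continuous_gaussianPi.intervalIntegrable _ _
    rw [this]
    have hc := intervalIntegral.continuous_primitive
      (fun a b => continuous_gaussianPi.intervalIntegrable (μ := volume) a b) 0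
    exact hc.sub (hc.comp continuous_neg)
  · intro a
    rw [fourier_gaussianPi]
    refine intervalIntegral.norm_integral_le_integral_norm_uIoc.trans ?_
    exact setIntegral_le_integral integrable_gaussianPi.norm (.of_forall fun _ => norm_nonneg _)

theorem fourier_sub_mul_gaussianPi {F : ℝ → ℂ} (hF : Integrable F) (c : ℂ) (w : ℝ) :
    𝓕 F w = 𝓕 (fun v => F v - c * gaussianPi v) w + c * 𝓕 gaussianPi w := by
  simp_rw [Real.fourier_real_eq_integral_exp_smul]
  have hH : Integrable fun v => F v - c * gaussianPi v :=
    hF.sub (integrable_gaussianPi.const_mul _)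
  rw [← integral_const_mul, ← integral_add (integrable_exp_smul hH w)
    ((integrable_exp_smul integrable_gaussianPi w).const_mul c)]
  congr 1
  ext v
  simp only [smul_eq_mul]
  ring

theorem continuous_fourier {F : ℝ → ℂ} (hF : Integrable F) : Continuous (𝓕 F) := by
  refine VectorFourier.fourierIntegral_continuous Real.continuous_fourierChar ?_ hF
  simp only [innerₗ_apply_apply, RCLike.inner_apply, conj_trivial]
  fun_prop

theorem integral_fourier_sub_mul_gaussianPi {F : ℝ → ℂ} (hF : Integrable F) (c : ℂ) (A : ℝ) :
    ∫ w in (-A)..A, 𝓕 F w = (∫ w in (-A)..A, 𝓕 (fun v => F v - c * gaussianPi v) w) +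
      c * ∫ w in (-A)..A, 𝓕 gaussianPi w := by
  rw [← intervalIntegral.integral_const_mul, ← intervalIntegral.integral_add]
  · simp_rw [← fourier_sub_mul_gaussianPi hF c]
  · exact (continuous_fourier (hF.sub (integrable_gaussianPi.const_mul c))).intervalIntegrable _ _
  · exact ((continuous_fourier integrable_gaussianPi).const_mul c).intervalIntegrable _ _

theorem continuous_integral_symm_interval {φ : ℝ → ℂ} (hφ : Continuous φ) :
    Continuous fun a : ℝ => ∫ w in (-a)..a, φ w := by
  have : (fun a : ℝ => ∫ w in (-a)..a, φ w) =
      fun a => (∫ w in (0:ℝ)..a, φ w) - ∫ w in (0:ℝ)..(-a), φ w := by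
    ext a
    rw [intervalIntegral.integral_interval_sub_left] <;> exact hφ.intervalIntegrable _ _
  rw [this]
  have hc := intervalIntegral.continuous_primitive
    (fun a b => hφ.intervalIntegrable (μ := volume) a b) 0
  exact hc.sub (hc.comp continuous_neg)

/-- The theorem of Fejér for the Fourier integral. -/
theorem tendsto_cesaro_integral_fourier {F : ℝ → ℂ} (hF : Integrable F) (hc : ContinuousAt F 0) :
    Tendsto (fun A : ℝ => (1 / (A : ℂ)) * ∫ a in (0 : ℝ)..A, ∫ w in (-a)..a, 𝓕 F w) atTop
      (𝓝 (F 0)) := by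
  have hH : Integrable fun v => F v - F 0 * gaussianPi v :=
    hF.sub (integrable_gaussianPi.const_mul _)
  have h1 := tendsto_cesaro_integral_fourier_of_tendsto_zero hH (by simp [gaussianPi_zero])
    (hc.sub (continuous_gaussianPi.continuousAt.const_mul _))
  have h2 := h1.add (tendsto_cesaro_fourier_gaussianPi.const_mul (F 0))
  rw [zero_add, mul_one] at h2
  refine h2.congr fun A => ?_
  simp_rw [integral_fourier_sub_mul_gaussianPi hF (F 0)]
  rw [intervalIntegral.integral_add, intervalIntegral.integral_const_mul]
  · ring
  · exact (continuous_integral_symm_interval (continuous_fourier hH)).intervalIntegrable _ _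
  · exact ((continuous_integral_symm_interval
      (continuous_fourier integrable_gaussianPi)).const_mul _).intervalIntegrable _ _

/-- Outside a ball of radius δ around 0, division by v costs at most the factor δ⁻¹. -/
theorem integrable_div_of_integrableAt {H : ℝ → ℂ} (hH : Integrable H)
    (h : IntegrableAtFilter (fun v : ℝ => H v / (v : ℂ)) (𝓝 0)) :
    Integrable fun v : ℝ => H v / (v : ℂ) := by
  obtain ⟨s, hs, hi⟩ := h
  obtain ⟨δ, hδ, hsub⟩ := Metric.mem_nhds_iff.1 hs
  rw [← integrableOn_univ, ← union_compl_self (Metric.ball (0 : ℝ) δ)]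
  refine (hi.mono_set hsub).union ?_
  have hmul : IntegrableOn (fun v : ℝ => ((δ⁻¹ : ℝ) : ℂ) * H v) (Metric.ball (0 : ℝ) δ)ᶜ :=
    (hH.const_mul _).integrableOn
  refine Integrable.mono hmul ?_ ?_
  · simp_rw [div_eq_mul_inv]
    exact hH.1.restrict.fun_mul Complex.measurable_ofReal.inv.aestronglyMeasurable
  · filter_upwards [ae_restrict_mem Metric.isOpen_ball.measurableSet.compl] with v hv
    have : δ ≤ |v| := by simpa using hv
    rw [norm_div, norm_mul, Complex.norm_real, Complex.norm_real, Real.norm_eq_abs,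
      Real.norm_of_nonneg (by positivity), div_eq_mul_inv, mul_comm]
    gcongr

/-- Off 0 the quotient coincides with `dslope φ 0`, which is continuous and therefore locally
bounded. -/
theorem integrableAtFilter_div_of_differentiableAt {φ : ℝ → ℂ} (hφ : Continuous φ)
    (hd : DifferentiableAt ℝ φ 0) :
    IntegrableAtFilter (fun v : ℝ => (φ v - φ 0) / (v : ℂ)) (𝓝 0) := by
  have hc : ContinuousAt (dslope φ 0) 0 := continuousAt_dslope_same.2 hd
  have hcont : Continuous (dslope φ 0) := by
    rw [continuous_iff_continuousAt]
    intro x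
    rcases eq_or_ne x 0 with rfl | hx
    · exact hc
    · exact (continuousAt_dslope_of_ne hx).2 hφ.continuousAt
  refine ⟨Metric.ball 0 1, Metric.ball_mem_nhds _ one_pos, ?_⟩
  have hi : IntegrableOn (dslope φ 0) (Metric.ball 0 1) :=
    (hcont.continuousOn.integrableOn_compact (isCompact_closedBall 0 1)).mono_set
      ball_subset_closedBall
  refine hi.congr (ae_restrict_of_ae ?_)
  have h0 : ∀ᵐ v : ℝ, v ≠ 0 := by simp [ae_iff]
  filter_upwards [h0] with v hv
  rw [dslope_of_ne _ hv, slope_def_module, sub_zero, div_eq_inv_mul, Complex.real_smul,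
    Complex.ofReal_inv]

/-- The criterion of Dini for the Fourier integral. -/
theorem tendsto_integral_fourier_of_dini {F : ℝ → ℂ} (hF : Integrable F)
    (h : IntegrableAtFilter (fun v : ℝ => (F v - F 0) / (v : ℂ)) (𝓝 0)) :
    Tendsto (fun A : ℝ => ∫ w in (-A)..A, 𝓕 F w) atTop (𝓝 (F 0)) := by
  have hH : Integrable fun v => F v - F 0 * gaussianPi v :=
    hF.sub (integrable_gaussianPi.const_mul _)
  have hg : IntegrableAtFilter (fun v : ℝ => (gaussianPi v - gaussianPi 0) / (v : ℂ)) (𝓝 0) := by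
    apply integrableAtFilter_div_of_differentiableAt continuous_gaussianPi
    unfold gaussianPi
    have : DifferentiableAt ℝ (fun v : ℝ => (v : ℂ)) 0 :=
      Complex.ofRealCLM.differentiableAt
    fun_prop
  have h1 := tendsto_integral_fourier_of_integrable_div hH (integrable_div_of_integrableAt hH (by
    have := h.sub (hg.smul (F 0))
    convert this using 2 with v
    simp [gaussianPi_zero]
    ring))
  have h2 := h1.add (tendsto_integral_fourier_gaussianPi.const_mul (F 0))
  rw [zero_add, mul_one] at h2
  exact h2.congr fun A => (integral_fourier_sub_mul_gaussianPi hF (F 0) A).symm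

end Fourier

/-! ### Mellin inversion as Fourier inversion in logarithmic coordinates. -/

section Mellin

open scoped FourierTransform

/-- Substitution x = e^(-u) after a dilation by r. The dilation moves the point r at which the
Mellin transform is to be inverted to u = 0. -/
theorem integrable_exp_mul_comp_exp {g : ℝ → ℂ} {ϱ r : ℝ} (hr : 0 < r)
    (hg : MellinConvergent g ϱ) :
    Integrable fun u : ℝ => (Real.exp (-ϱ * u) : ℂ) * g (r * Real.exp (-u)) := by
  have hg' : MellinConvergent (fun u => g (r * u)) ϱ := (MellinConvergent.comp_mul_left hr).2 hg
  have himg : (fun u : ℝ => Real.exp (-u)) '' univ = Ioi 0 := by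
    rw [image_univ]
    ext x
    constructor
    · rintro ⟨u, rfl⟩; exact Real.exp_pos _
    · intro hx; exact ⟨-Real.log x, by simp [Real.exp_log hx]⟩
  have hder : ∀ u ∈ univ,
      HasDerivWithinAt (fun u : ℝ => Real.exp (-u)) (-Real.exp (-u)) univ u := by
    intro u _
    have := ((Real.hasDerivAt_exp (-u)).comp u (hasDerivAt_neg u)).hasDerivWithinAt (s := univ)
    simpa [Function.comp_def] using this
  rw [MellinConvergent, ← himg, integrableOn_image_iff_integrableOn_abs_deriv_smul
    MeasurableSet.univ hder (by intro a _ b _ h; simpa using h), integrableOn_univ] at hg'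
  refine hg'.congr (.of_forall fun u => ?_)
  simp only
  rw [abs_neg, abs_of_pos (Real.exp_pos _), smul_eq_mul, Complex.real_smul, ← mul_assoc]
  congr 1
  rw [show ((ϱ : ℂ) - 1) = ((ϱ - 1 : ℝ) : ℂ) by simp, ← Complex.ofReal_cpow (Real.exp_pos _).le,
    ← Complex.ofReal_mul, ← Real.exp_mul, ← Real.exp_add]
  congr 2
  ring

theorem cpow_neg_mul_mellin_eq_fourier (g : ℝ → ℂ) {ϱ r : ℝ} (hr : 0 < r) (y : ℝ) :
    (r : ℂ) ^ (-((ϱ : ℂ) + y * Complex.I)) * mellin g ((ϱ : ℂ) + y * Complex.I) =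
      𝓕 (fun u : ℝ => (Real.exp (-ϱ * u) : ℂ) * g (r * Real.exp (-u))) (y / (2 * Real.pi)) := by
  have h := mellin_comp_mul_left g ((ϱ : ℂ) + y * Complex.I) hr
  rw [smul_eq_mul] at h
  rw [← h, mellin_eq_fourier]
  simp

/-- Only integrals along the line enter, so it is enough that Q agrees with the Mellin transform
almost everywhere. This is what allows the denominator of `mellinQuotient` to have zeros on the
line. The rescaling y = 2πw absorbs the prefactor 1/(2π). -/
theorem truncatedMellinInv_eq {g : ℝ → ℂ} {Q : ℂ → ℂ} {ϱ r : ℝ} (hr : 0 < r)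
    (hQ : ∀ᵐ y : ℝ, Q ((ϱ : ℂ) + y * Complex.I) = mellin g ((ϱ : ℂ) + y * Complex.I)) (T : ℝ) :
    truncatedMellinInv ϱ Q r T = ∫ w in (-(T / (2 * Real.pi)))..(T / (2 * Real.pi)),
      𝓕 (fun u : ℝ => (Real.exp (-ϱ * u) : ℂ) * g (r * Real.exp (-u))) w := by
  rw [truncatedMellinInv]
  have h : ∫ y in (-T)..T, (r : ℂ) ^ (-((ϱ : ℂ) + y * Complex.I)) * Q ((ϱ : ℂ) + y * Complex.I) =
      ∫ y in (-T)..T, 𝓕 (fun u : ℝ => (Real.exp (-ϱ * u) : ℂ) * g (r * Real.exp (-u)))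
        (y / (2 * Real.pi)) := by
    apply intervalIntegral.integral_congr_ae
    filter_upwards [hQ] with y hy _
    rw [hy, cpow_neg_mul_mellin_eq_fourier g hr]
  rw [h, intervalIntegral.integral_comp_div _ (by positivity), Complex.real_smul, neg_div]
  have : (Real.pi : ℂ) ≠ 0 := by exact_mod_cast Real.pi_pos.ne'
  push_cast
  field_simp

/-- Cesàro summability of the Mellin inversion integral. -/
theorem tendsto_cesaro_truncatedMellinInv {g : ℝ → ℂ} {Q : ℂ → ℂ} {ϱ r : ℝ} (hr : 0 < r)
    (hQ : ∀ᵐ y : ℝ, Q ((ϱ : ℂ) + y * Complex.I) = mellin g ((ϱ : ℂ) + y * Complex.I))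
    (hg : MellinConvergent g ϱ) (hc : ContinuousAt g r) :
    Tendsto (fun T : ℝ => (1 / (T : ℂ)) * ∫ τ in (0 : ℝ)..T, truncatedMellinInv ϱ Q r τ) atTop
      (𝓝 (g r)) := by
  have hF := integrable_exp_mul_comp_exp hr hg
  have hcF : ContinuousAt (fun u : ℝ => (Real.exp (-ϱ * u) : ℂ) * g (r * Real.exp (-u))) 0 := by
    refine ContinuousAt.fun_mul (by fun_prop) (ContinuousAt.comp ?_ (by fun_prop))
    simpa using hc
  have h := tendsto_cesaro_integral_fourier hF hcF
  simp only [mul_zero, Real.exp_zero, Complex.ofReal_one, neg_zero, mul_one, one_mul] at h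
  have h2 := h.comp (tendsto_id.atTop_div_const (by positivity : 0 < 2 * Real.pi))
  refine h2.congr fun T => ?_
  simp_rw [truncatedMellinInv_eq hr hQ]
  rw [intervalIntegral.integral_comp_div (fun a => ∫ w in (-a)..a,
    𝓕 (fun u : ℝ => (Real.exp (-ϱ * u) : ℂ) * g (r * Real.exp (-u))) w)
    (by positivity : 2 * Real.pi ≠ 0), zero_div, Complex.real_smul]
  simp only [Function.comp, id]
  push_cast
  rw [← mul_assoc, one_div_div]
  congr 1
  ring

/-- Split b(u)φ(u) - b(r)φ(r) = b(u)(φ(u) - φ(r)) + φ(r)(b(u) - b(r)): the first term has a locally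
bounded factor b, the second has a locally bounded difference quotient. -/
theorem integrableAtFilter_dini_mul {φ b : ℝ → ℂ} {r : ℝ} (hb : Continuous b)
    (hbd : DifferentiableAt ℝ b r)
    (h : IntegrableAtFilter (fun u : ℝ => (φ u - φ r) / ((u - r : ℝ) : ℂ)) (𝓝 r)) :
    IntegrableAtFilter (fun u : ℝ => (b u * φ u - b r * φ r) / ((u - r : ℝ) : ℂ)) (𝓝 r) := by
  obtain ⟨s, hs, hi⟩ := h
  obtain ⟨δ, hδ, hsub⟩ := Metric.mem_nhds_iff.1 hs
  refine ⟨ball r δ, ball_mem_nhds _ hδ, ?_⟩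
  have h1 : IntegrableOn (fun u : ℝ => b u * ((φ u - φ r) / ((u - r : ℝ) : ℂ))) (ball r δ) :=
    IntegrableOn.continuousOn_mul_of_subset hb.continuousOn (hi.mono_set hsub)
      (isCompact_closedBall r δ) measurableSet_ball ball_subset_closedBall
  have hcont : Continuous (dslope b r) := by
    rw [continuous_iff_continuousAt]
    intro x
    rcases eq_or_ne x r with rfl | hx
    · exact continuousAt_dslope_same.2 hbd
    · exact (continuousAt_dslope_of_ne hx).2 hb.continuousAt
  have h2 : IntegrableOn (fun u => φ r * dslope b r u) (ball r δ) :=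
    ((hcont.const_mul _).continuousOn.integrableOn_compact (isCompact_closedBall r δ)).mono_set
      ball_subset_closedBall
  refine (h1.add h2).congr (ae_restrict_of_ae ?_)
  have h0 : ∀ᵐ v : ℝ, v ≠ r := by simp [ae_iff]
  filter_upwards [h0] with v hv
  have hv' : ((v : ℂ) - r) ≠ 0 := by
    rw [← Complex.ofReal_sub]; exact_mod_cast sub_ne_zero.2 hv
  rw [Pi.add_apply, dslope_of_ne _ hv, slope_def_module, Complex.real_smul]
  push_cast
  field_simp
  ring

theorem integrableAtFilter_dini_comp_exp {φ : ℝ → ℂ} {r : ℝ} (hr : 0 < r)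
    (h : IntegrableAtFilter (fun u : ℝ => (φ u - φ r) / ((u - r : ℝ) : ℂ)) (𝓝 r)) :
    IntegrableAtFilter (fun v : ℝ => (φ (r * Real.exp (-v)) - φ r) / (v : ℂ)) (𝓝 0) := by
  obtain ⟨s, hs, hi⟩ := h
  obtain ⟨s', hs', hso, hsr⟩ := _root_.mem_nhds_iff.1 hs
  set θ : ℝ → ℝ := fun v => r * Real.exp (-v) with hθ
  have hθc : Continuous θ := by fun_prop
  have hθ0 : θ 0 = r := by simp [hθ]
  have hder : ∀ v, HasDerivAt θ (-(r * Real.exp (-v))) v := by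
    intro v
    have := ((Real.hasDerivAt_exp (-v)).comp v (hasDerivAt_neg v)).const_mul r
    simpa [Function.comp_def] using this
  set U : Set ℝ := θ ⁻¹' s' ∩ ball 0 1 with hU
  have hUo : IsOpen U := (hso.preimage hθc).inter isOpen_ball
  refine ⟨U, hUo.mem_nhds ⟨by simpa [hθ0] using hsr, by simp⟩, ?_⟩
  have hi2 : IntegrableOn (fun u : ℝ => (φ u - φ r) / ((u - r : ℝ) : ℂ)) (θ '' U) := by
    refine hi.mono_set ?_
    rintro _ ⟨v, hv, rfl⟩
    exact hs' hv.1
  rw [integrableOn_image_iff_integrableOn_abs_deriv_smul hUo.measurableSet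
    (fun v _ => (hder v).hasDerivWithinAt)
    (by intro a _ b _ hab; simpa [hθ, hr.ne'] using hab)] at hi2
  have hcont : Continuous (dslope θ 0) := by
    rw [continuous_iff_continuousAt]
    intro x
    rcases eq_or_ne x 0 with rfl | hx
    · exact continuousAt_dslope_same.2 (hder 0).differentiableAt
    · exact (continuousAt_dslope_of_ne hx).2 hθc.continuousAt
  -- Passing from (u - r)⁻¹ to v⁻¹ and removing the Jacobian r e^(-v) multiplies the integrand by
  -- this function, extended continuously to v = 0 by `dslope`.
  have hk : Continuous fun v : ℝ => ((dslope θ 0 v / (r * Real.exp (-v)) : ℝ) : ℂ) := by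
    have : ∀ v : ℝ, r * Real.exp (-v) ≠ 0 := fun v => by positivity
    exact Complex.continuous_ofReal.comp (hcont.div (by fun_prop) this)
  have h3 := IntegrableOn.continuousOn_mul_of_subset hk.continuousOn hi2
      (isCompact_closedBall 0 1) hUo.measurableSet (inter_subset_right.trans ball_subset_closedBall)
  refine h3.congr (ae_restrict_of_ae ?_)
  have h0 : ∀ᵐ v : ℝ, v ≠ 0 := by simp [ae_iff]
  filter_upwards [h0] with v hv
  have hne : θ v - r ≠ 0 := by
    have : Real.exp (-v) ≠ 1 := by simpa using hv
    intro h
    apply this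
    have : r * (Real.exp (-v) - 1) = 0 := by rw [← h]; simp only [hθ]; ring
    have := (mul_eq_zero.1 this).resolve_left hr.ne'
    linarith
  have hne' : ((θ v : ℂ) - r) ≠ 0 := by rw [← Complex.ofReal_sub]; exact_mod_cast hne
  have hv' : (v : ℂ) ≠ 0 := by exact_mod_cast hv
  have hp : 0 < r * Real.exp (-v) := by positivity
  have hp' : ((r * Real.exp (-v) : ℝ) : ℂ) ≠ 0 := by exact_mod_cast hp.ne'
  rw [dslope_of_ne _ hv, slope_def_field, hθ0, sub_zero, abs_neg, abs_of_pos hp, Complex.real_smul,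
    Complex.ofReal_div, Complex.ofReal_div, Complex.ofReal_sub]
  field_simp
  rfl

/-- The criterion of Dini for the Mellin inversion integral. -/
theorem tendsto_truncatedMellinInv_of_dini {g : ℝ → ℂ} {Q : ℂ → ℂ} {ϱ r : ℝ} (hr : 0 < r)
    (hQ : ∀ᵐ y : ℝ, Q ((ϱ : ℂ) + y * Complex.I) = mellin g ((ϱ : ℂ) + y * Complex.I))
    (hg : MellinConvergent g ϱ)
    (h : IntegrableAtFilter (fun u : ℝ => (g u - g r) / ((u - r : ℝ) : ℂ)) (𝓝 r)) :
    Tendsto (fun T : ℝ => truncatedMellinInv ϱ Q r T) atTop (𝓝 (g r)) := by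
  have hF := integrable_exp_mul_comp_exp hr hg
  have hb : DifferentiableAt ℝ (fun u : ℝ => (Real.exp (-ϱ * u) : ℂ)) 0 := by
    have h1 : DifferentiableAt ℝ (fun u : ℝ => Real.exp (-ϱ * u)) 0 := by fun_prop
    exact Complex.ofRealCLM.differentiableAt.comp 0 h1
  have hD := integrableAtFilter_dini_mul (φ := fun u => g (r * Real.exp (-u))) (r := 0)
    (b := fun u : ℝ => (Real.exp (-ϱ * u) : ℂ)) (by fun_prop) hb
    (by simpa using integrableAtFilter_dini_comp_exp hr h)
  have h := tendsto_integral_fourier_of_dini hF (by simpa using hD)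
  simp only [mul_zero, Real.exp_zero, Complex.ofReal_one, neg_zero, mul_one, one_mul] at h
  have h2 := h.comp (tendsto_id.atTop_div_const (by positivity : 0 < 2 * Real.pi))
  exact h2.congr fun T => (truncatedMellinInv_eq hr hQ T).symm

end Mellin

/-! ### Mellin convolution -/

section Convolution

/-- The powers of x on the right multiply to 1. The isolated factor x will cancel the Jacobian of u
= cx. -/
theorem norm_cpow_smul_mul_comp {h g : ℝ → ℂ} {s : ℂ} {c x : ℝ} (hc : 0 < c) (hx : 0 < x) :
    ‖(c : ℂ) ^ (s - 1) * (h x * g (c * x))‖ =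
      x * ‖(x : ℂ) ^ ((1 - s) - 1) • h x‖ * ‖((c * x : ℝ) : ℂ) ^ (s - 1) • g (c * x)‖ := by
  rw [norm_mul, norm_mul, norm_smul, norm_smul, Complex.norm_cpow_eq_rpow_re_of_pos hc,
    Complex.norm_cpow_eq_rpow_re_of_pos hx, Complex.norm_cpow_eq_rpow_re_of_pos (mul_pos hc hx),
    Real.mul_rpow hc.le hx.le]
  have : x * x ^ (1 - s - 1).re * x ^ (s - 1).re = 1 := by
    nth_rewrite 1 [← Real.rpow_one x]
    rw [← Real.rpow_add hx, ← Real.rpow_add hx]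
    convert Real.rpow_zero x using 2
    simp only [Complex.sub_re, Complex.one_re]
    ring
  linear_combination (-(c ^ (s - 1).re * ‖h x‖ * ‖g (c * x)‖)) * this

theorem integrable_mellin_convolution {h g : ℝ → ℂ} (hm : Measurable h) (gm : Measurable g) {s : ℂ}
    (hh : MellinConvergent h (1 - s)) (hg : MellinConvergent g s) :
    Integrable (fun p : ℝ × ℝ => (p.1 : ℂ) ^ (s - 1) * (h p.2 * g (p.1 * p.2)))
      ((volume.restrict (Ioi 0)).prod (volume.restrict (Ioi 0))) := by
  have hmeas : Measurable fun p : ℝ × ℝ => (p.1 : ℂ) ^ (s - 1) * (h p.2 * g (p.1 * p.2)) := by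
    fun_prop
  rw [integrable_prod_iff' hmeas.aestronglyMeasurable]
  constructor
  · filter_upwards [ae_restrict_mem measurableSet_Ioi] with x hx
    have := (MellinConvergent.comp_mul_left (f := g) (s := s) hx).2 hg
    refine (Integrable.const_mul this (h x)).congr (.of_forall fun c => ?_)
    simp only [smul_eq_mul]
    rw [mul_comm x c]
    ring
  · refine (hh.norm.mul_const (∫ u in Ioi (0 : ℝ), ‖(u : ℂ) ^ (s - 1) • g u‖)).congr ?_
    filter_upwards [ae_restrict_mem measurableSet_Ioi] with x hx
    have hx' : 0 < x := hx
    rw [setIntegral_congr_fun measurableSet_Ioi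
      (fun c hc => norm_cpow_smul_mul_comp (h := h) (g := g) (s := s) hc hx), integral_const_mul,
      integral_comp_mul_right_Ioi (fun u : ℝ => ‖(u : ℂ) ^ (s - 1) • g u‖) 0 hx,
      zero_mul, smul_eq_mul (a := x⁻¹)]
    field_simp

/-- Fubini and the substitution u = cx in the inner integral over c, which produces x^(-s) Mg(s).
Since -s = (1 - s) - 1, the transform of h is taken at 1 - s. -/
theorem hasMellin_convolution {h g K : ℝ → ℂ} (hm : Measurable h) (gm : Measurable g) {s : ℂ}
    (hh : MellinConvergent h (1 - s)) (hg : MellinConvergent g s)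
    (hK : ∀ c, 0 < c → K c = ∫ x in Ioi (0 : ℝ), h x * g (c * x)) :
    MellinConvergent K s ∧ mellin K s = mellin h (1 - s) * mellin g s := by
  have hinteg := integrable_mellin_convolution hm gm hh hg
  constructor
  · refine IntegrableOn.congr_fun hinteg.integral_prod_left (fun c hc => ?_) measurableSet_Ioi
    simp only [smul_eq_mul]
    rw [hK c hc, integral_const_mul]
  · calc mellin K s = ∫ c in Ioi (0 : ℝ), ∫ x in Ioi (0 : ℝ),
          (c : ℂ) ^ (s - 1) * (h x * g (c * x)) := by
          refine setIntegral_congr_fun measurableSet_Ioi fun c hc => ?_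
          simp only [smul_eq_mul]
          rw [hK c hc, integral_const_mul]
      _ = ∫ x in Ioi (0 : ℝ), ∫ c in Ioi (0 : ℝ),
          (c : ℂ) ^ (s - 1) * (h x * g (c * x)) := integral_integral_swap hinteg
      _ = ∫ x in Ioi (0 : ℝ), ((x : ℂ) ^ ((1 - s) - 1) • h x) * mellin g s := by
          refine setIntegral_congr_fun measurableSet_Ioi fun x hx => ?_
          have h1 := mellin_comp_mul_right g s (a := x) hx
          simp only [smul_eq_mul] at h1 ⊢
          rw [show 1 - s - 1 = -s by ring, mul_comm _ (h x), mul_assoc, ← h1, mellin,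
            ← integral_const_mul]
          refine integral_congr_ae (.of_forall fun c => ?_)
          simp only [smul_eq_mul]
          ring
      _ = _ := integral_mul_const _ _

/-! ### Zeros of Mellin transforms of compactly supported functions. -/

/-- By the identity theorem the zeros of F are isolated, so the set of real non-zeros is codiscrete,
and codiscrete sets have null complement. -/
theorem ae_ne_zero_of_differentiable {F : ℂ → ℂ} (hF : Differentiable ℂ F) (hne : ∃ z, F z ≠ 0) :
    ∀ᵐ y : ℝ, F y ≠ 0 := by
  have hA : AnalyticOnNhd ℂ F univ := fun z _ => hF.analyticAt z
  have hcod : {y : ℝ | F y ≠ 0} ∈ codiscreteWithin (univ : Set ℝ) := by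
    rw [mem_codiscreteWithin]
    intro x _
    rw [disjoint_principal_right, compl_sdiff, compl_univ, union_empty]
    rcases (hF.analyticAt (x : ℂ)).eventually_eq_zero_or_eventually_ne_zero with h | h
    · exfalso
      obtain ⟨z, hz⟩ := hne
      exact hz (hA.eqOn_zero_of_preconnected_of_eventuallyEq_zero isPreconnected_univ
        (mem_univ (x : ℂ)) h (mem_univ z))
    · have ht : Tendsto (fun y : ℝ => (y : ℂ)) (𝓝[≠] x) (𝓝[≠] (x : ℂ)) := by
        apply tendsto_nhdsWithin_of_tendsto_nhds_of_eventually_within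
        · exact Complex.continuous_ofReal.continuousAt.tendsto.mono_left nhdsWithin_le_nhds
        · filter_upwards [self_mem_nhdsWithin] with y hy
          simpa using hy
      exact ht.eventually h
  have := ae_restrict_le_codiscreteWithin (μ := (volume : Measure ℝ)) MeasurableSet.univ hcod
  rwa [Measure.restrict_univ] at this

theorem isBigO_atTop_of_support {h : ℝ → ℂ} {b : ℝ} (hb : ∀ x, b < x → h x = 0) (φ : ℝ → ℝ) :
    h =O[atTop] φ := by
  apply Asymptotics.IsBigO.of_bound 0
  filter_upwards [eventually_gt_atTop b] with x hx
  simp [hb x hx]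

theorem isBigO_nhdsGT_of_support {h : ℝ → ℂ} {a : ℝ} (ha : 0 < a) (h0 : ∀ x, x < a → h x = 0)
    (φ : ℝ → ℝ) : h =O[𝓝[>] 0] φ := by
  apply Asymptotics.IsBigO.of_bound 0
  filter_upwards [nhdsWithin_le_nhds (eventually_lt_nhds ha)] with x hx
  simp [h0 x hx]

/-- Vanishing near 0 and near infinity gives decay of every order at both ends, hence convergence at
every s. -/
theorem mellinConvergent_of_support {h : ℝ → ℂ} {a b : ℝ} (hi : Integrable h) (ha : 0 < a)
    (h0 : ∀ x, x < a → h x = 0) (hb : ∀ x, b < x → h x = 0) (s : ℂ) : MellinConvergent h s :=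
  mellinConvergent_of_isBigO_rpow (a := s.re + 1) (b := s.re - 1)
    (hi.locallyIntegrable.locallyIntegrableOn _) (isBigO_atTop_of_support hb _) (by linarith)
    (isBigO_nhdsGT_of_support ha h0 _) (by linarith)

theorem differentiable_mellin_of_support {h : ℝ → ℂ} {a b : ℝ} (hi : Integrable h) (ha : 0 < a)
    (h0 : ∀ x, x < a → h x = 0) (hb : ∀ x, b < x → h x = 0) : Differentiable ℂ (mellin h) :=
  fun s => mellin_differentiableAt_of_isBigO_rpow (a := s.re + 1) (b := s.re - 1)
    (hi.locallyIntegrable.locallyIntegrableOn _) (isBigO_atTop_of_support hb _) (by linarith)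
    (isBigO_nhdsGT_of_support ha h0 _) (by linarith)

/-- An integrable function on a bounded interval that is positive near the right end point has a
nonzero moment. -/
theorem exists_moment_ne_zero {h : ℝ → ℝ} {a b : ℝ} (hi : Integrable h) (ha : 0 < a) (hab : a < b)
    (hb : ∀ x, b < x → h x = 0) (hpos : ∀ x, a < x → x < b → 0 < h x) :
    ∃ k : ℕ, ∫ x in Ioi (0 : ℝ), x ^ k * h x ≠ 0 := by
  by_contra! hcon
  -- The mass δ on (a', b) contributes at least a'^k δ to the k-th moment, whereas (0, a]
  -- contributes at most a^k C in absolute value. If all moments vanished, then δ ≤ (a/a')^k C for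
  -- every k, which is absurd since a < a'.
  set a' := (a + b) / 2 with ha'
  have haa' : a < a' := by rw [ha']; linarith
  have ha'b : a' < b := by rw [ha']; linarith
  have hmi : ∀ k : ℕ, Integrable (fun x => x ^ k * h x) (volume.restrict (Ioi 0)) := by
    intro k
    refine (hi.integrableOn (s := Ioi 0)).norm.const_mul (b ^ k) |>.mono
      ((by fun_prop : Continuous fun x : ℝ => x ^ k).aestronglyMeasurable.mul hi.1.restrict) ?_
    filter_upwards [ae_restrict_mem measurableSet_Ioi] with x hx
    have hx' : 0 < x := hx
    rcases le_or_gt x b with hxb | hxb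
    · rw [norm_mul, norm_mul, norm_norm, norm_pow, norm_pow, Real.norm_of_nonneg hx'.le,
        Real.norm_of_nonneg (by linarith : 0 ≤ b)]
      gcongr
    · simp [hb x hxb]
  set δ := ∫ x in Ioo a' b, h x with hδ
  have hδpos : 0 < δ := by
    rw [hδ, setIntegral_pos_iff_support_of_nonneg_ae]
    · have : Ioo a' b ⊆ Function.support h ∩ Ioo a' b := fun x hx =>
        ⟨(hpos x (haa'.trans hx.1) hx.2).ne', hx⟩
      refine lt_of_lt_of_le ?_ (measure_mono this)
      simp [ha'b]
    · filter_upwards [ae_restrict_mem measurableSet_Ioo] with x hx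
      exact (hpos x (haa'.trans hx.1) hx.2).le
    · exact hi.integrableOn
  set C := ∫ x in Ioc 0 a, ‖h x‖ with hC
  have hbound : ∀ k : ℕ, a' ^ k * δ ≤ a ^ k * C := by
    intro k
    have hsplit : (Ioi (0 : ℝ)) = Ioc 0 a ∪ Ioi a := (Ioc_union_Ioi_eq_Ioi ha.le).symm
    have hk := hcon k
    rw [hsplit, setIntegral_union (Ioc_disjoint_Ioi le_rfl) measurableSet_Ioi
      (IntegrableOn.mono_set (hmi k) Ioc_subset_Ioi_self)
      (IntegrableOn.mono_set (hmi k) (Ioi_subset_Ioi ha.le))] at hk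
    have h1 : a' ^ k * δ ≤ ∫ x in Ioi a, x ^ k * h x := by
      calc a' ^ k * δ = ∫ x in Ioo a' b, a' ^ k * h x := by rw [integral_const_mul]
        _ ≤ ∫ x in Ioo a' b, x ^ k * h x := by
          apply setIntegral_mono_on (hi.integrableOn.const_mul _)
            (IntegrableOn.mono_set (hmi k) fun x hx => by
              have := hx.1; exact lt_trans (ha.trans haa') this) measurableSet_Ioo
          intro x hx
          have h1 := hx.1
          have h2 := (hpos x (haa'.trans hx.1) hx.2).le
          have : 0 ≤ a' := by linarith
          gcongr
        _ ≤ ∫ x in Ioi a, x ^ k * h x := by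
          apply setIntegral_mono_set (IntegrableOn.mono_set (hmi k) (Ioi_subset_Ioi ha.le))
          · have hb' : ∀ᵐ x : ℝ ∂volume.restrict (Ioi a), x ≠ b :=
              ae_restrict_of_ae (by simp [ae_iff])
            filter_upwards [ae_restrict_mem measurableSet_Ioi, hb'] with x hx hxb
            have hx' : a < x := hx
            rcases lt_or_gt_of_ne hxb with h | h
            · exact mul_nonneg (pow_nonneg (by linarith) _) (hpos x hx h).le
            · simp [hb x h]
          · exact LE.le.eventuallyLE fun x hx => haa'.trans hx.1
    have h2 : ‖∫ x in Ioc 0 a, x ^ k * h x‖ ≤ a ^ k * C := by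
      rw [hC, ← integral_const_mul]
      apply norm_integral_le_of_norm_le (hi.integrableOn.norm.const_mul _)
      filter_upwards [ae_restrict_mem measurableSet_Ioc] with x hx
      rw [norm_mul, norm_pow, Real.norm_of_nonneg hx.1.le]
      have := hx.1.le
      have := hx.2
      gcongr
    rw [Real.norm_eq_abs] at h2
    linarith [abs_le.1 h2]
  have ha'pos : 0 < a' := ha.trans haa'
  have hlim : Tendsto (fun k : ℕ => (a / a') ^ k * C) atTop (𝓝 0) := by
    have := (tendsto_pow_atTop_nhds_zero_of_lt_one (r := a / a') (by positivity)
      ((div_lt_one (by linarith)).2 haa')).mul_const C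
    simpa using this
  have : δ ≤ 0 := ge_of_tendsto' hlim fun k => by
    have hp : 0 < a' ^ k := by positivity
    rw [div_pow, div_mul_eq_mul_div, le_div_iff₀ hp, mul_comm]
    exact hbound k
  linarith

end Convolution

/-! ### The kernel -/

section Kernel

theorem tanh_pos {lam : ℝ} (hlam : 0 < lam) : 0 < Real.tanh lam := by
  rw [Real.tanh_eq_sinh_div_cosh]
  exact div_pos (Real.sinh_pos_iff.2 hlam) (Real.cosh_pos _)

/-- For unit vectors e, ω with inner product τ, the norm x = |e + tω| satisfies x² = 1 + t² + 2tτ.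
This is the change of variables between latitude and dilation; 1 - t and 1 + t are the extreme
values of x. -/
theorem image_latitude {t : ℝ} (ht : 0 < t) (ht1 : t < 1) :
    (fun x : ℝ => (x ^ 2 - 1 - t ^ 2) / (2 * t)) '' Ioo (1 - t) (1 + t) = Ioo (-1) 1 := by
  ext τ
  constructor
  · rintro ⟨x, ⟨h1, h2⟩, rfl⟩
    constructor
    · rw [lt_div_iff₀ (by positivity)]; nlinarith
    · rw [div_lt_iff₀ (by positivity)]; nlinarith
  · rintro ⟨h1, h2⟩
    have hp : 0 ≤ 1 + t ^ 2 + 2 * t * τ := by nlinarith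
    refine ⟨√(1 + t ^ 2 + 2 * t * τ), ⟨?_, ?_⟩, ?_⟩
    · apply Real.lt_sqrt_of_sq_lt; nlinarith
    · rw [Real.sqrt_lt' (by linarith)]; nlinarith
    · simp only [Real.sq_sqrt hp]; field_simp; ring

theorem hasDerivAt_latitude (t x : ℝ) :
    HasDerivAt (fun x : ℝ => (x ^ 2 - 1 - t ^ 2) / (2 * t)) (x / t) x := by
  have := ((((hasDerivAt_id x).pow 2).sub_const 1).sub_const (t ^ 2)).div_const (2 * t)
  refine this.congr_deriv ?_
  simp only [id, Nat.cast_ofNat]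
  rcases eq_or_ne t 0 with rfl | ht
  · simp
  · field_simp
    simp

theorem injOn_latitude {t : ℝ} (ht : 0 < t) (ht1 : t < 1) :
    InjOn (fun x : ℝ => (x ^ 2 - 1 - t ^ 2) / (2 * t)) (Ioo (1 - t) (1 + t)) := by
  intro x hx y hy h
  have hx0 : 0 < x := by linarith [hx.1]
  have hy0 : 0 < y := by linarith [hy.1]
  simp only at h
  rw [div_left_inj' (by positivity)] at h
  have : x ^ 2 = y ^ 2 := by linarith
  exact (sq_eq_sq₀ hx0.le hy0.le).1 this

theorem integral_latitude {t : ℝ} (ht : 0 < t) (ht1 : t < 1) (Φ : ℝ → ℂ) :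
    ∫ τ in Ioo (-1 : ℝ) 1, Φ τ =
      ∫ x in Ioo (1 - t) (1 + t), ((x / t : ℝ) : ℂ) * Φ ((x ^ 2 - 1 - t ^ 2) / (2 * t)) := by
  rw [← image_latitude ht ht1, integral_image_eq_integral_abs_deriv_smul measurableSet_Ioo
    (fun x _ => (hasDerivAt_latitude t x).hasDerivWithinAt) (injOn_latitude ht ht1)]
  refine setIntegral_congr_fun measurableSet_Ioo fun x hx => ?_
  have : 0 < x := by linarith [hx.1]
  rw [abs_of_pos (by positivity), Complex.real_smul]

/-- The product of the four linear factors is (2t)²(1 - τ²) for τ = (x² - 1 - t²)/(2t), as in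
Heron's formula. So the kernel is the Jacobian dτ/dx = x/t times the latitude weight on the sphere
times the Gegenbauer factor, whose argument (1 + tτ)/x is the cosine of the angle between e and e +
tω. -/
theorem kernel_eq {d : ℕ} (m : ℕ) {lam x : ℝ} (hlam : 0 < lam)
    (hx : x ∈ Ioo (1 - Real.tanh lam) (1 + Real.tanh lam)) :
    kernel d m lam x = x / Real.tanh lam *
      (1 - ((x ^ 2 - 1 - Real.tanh lam ^ 2) / (2 * Real.tanh lam)) ^ 2) ^ (((d : ℝ) - 3) / 2) *
      (gegenbauer (((d : ℝ) - 2) / 2) m).eval ((x ^ 2 + 1 - Real.tanh lam ^ 2) / (2 * x)) := by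
  have ht := tanh_pos hlam
  rw [kernel, if_pos ⟨hx.1.le, hx.2.le⟩]
  set t := Real.tanh lam
  have hmem : (x ^ 2 - 1 - t ^ 2) / (2 * t) ∈ Ioo (-1 : ℝ) 1 := by
    rw [← image_latitude ht (Real.tanh_lt_one lam)]; exact ⟨x, hx, rfl⟩
  have hpos : 0 < 1 - ((x ^ 2 - 1 - t ^ 2) / (2 * t)) ^ 2 := by nlinarith [hmem.1, hmem.2]
  have e : (1 + t - x) * (1 + t + x) * (x - 1 + t) * (x + 1 - t) =
      (2 * t) ^ (2 : ℝ) * (1 - ((x ^ 2 - 1 - t ^ 2) / (2 * t)) ^ 2) := by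
    rw [Real.rpow_two]
    field_simp
    ring
  rw [e, Real.mul_rpow (by positivity) hpos.le, ← Real.rpow_mul (by positivity)]
  have e2 : (2 * t) ^ (2 * (((d : ℝ) - 3) / 2)) = (2 * t) ^ ((d : ℤ) - 3) := by
    rw [← Real.rpow_intCast]; congr 1; push_cast; ring
  have e3 : (2 : ℝ) ^ (3 - (d : ℤ)) * t ^ (2 - (d : ℤ)) * (2 * t) ^ ((d : ℤ) - 3) = t⁻¹ := by
    rw [mul_zpow, show (2 : ℝ) ^ (3 - (d : ℤ)) * t ^ (2 - (d : ℤ)) *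
      (2 ^ ((d : ℤ) - 3) * t ^ ((d : ℤ) - 3)) = (2 ^ (3 - (d : ℤ)) * 2 ^ ((d : ℤ) - 3)) *
      (t ^ (2 - (d : ℤ)) * t ^ ((d : ℤ) - 3)) by ring, ← zpow_add₀ two_ne_zero,
      ← zpow_add₀ ht.ne']
    ring_nf
    simp
  rw [e2]
  generalize (1 - ((x ^ 2 - 1 - t ^ 2) / (2 * t)) ^ 2) ^ (((d : ℝ) - 3) / 2) = a
  rw [div_eq_mul_inv x t, ← e3]
  ring

theorem kernel_eq_zero {d m : ℕ} {lam x : ℝ}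
    (hx : x ∉ Icc (1 - Real.tanh lam) (1 + Real.tanh lam)) : kernel d m lam x = 0 := by
  rw [kernel, if_neg (fun h => hx ⟨h.1, h.2⟩)]

theorem measurable_kernel (d m : ℕ) (lam : ℝ) : Measurable (kernel d m lam) := by
  unfold kernel
  refine Measurable.ite (measurableSet_Icc (a := 1 - Real.tanh lam) (b := 1 + Real.tanh lam)) ?_
    measurable_const
  have := (gegenbauer (((d : ℝ) - 2) / 2) m).continuous.measurable
  fun_prop

/-- For d = 2 the exponent is -1/2 and the kernel is unbounded at the ends of its support. In the
variable τ only integrability of the Gegenbauer weight is needed; the polynomial factor is bounded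
because x stays away from 0. -/
theorem integrable_kernel {d : ℕ} (hd : 2 ≤ d) (m : ℕ) {lam : ℝ} (hlam : 0 < lam) :
    Integrable (kernel d m lam) := by
  have ht := tanh_pos hlam
  have ht1 := Real.tanh_lt_one lam
  have hν : -(1 / 2) < ((d : ℝ) - 2) / 2 := by
    have : (2 : ℝ) ≤ d := by exact_mod_cast hd
    linarith
  have hw := gegenbauer_weight_integrable hν 1
  rw [intervalIntegrable_iff_integrableOn_Ioo_of_le (by norm_num)] at hw
  rw [← image_latitude ht ht1, integrableOn_image_iff_integrableOn_abs_deriv_smul measurableSet_Ioo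
    (fun x _ => (hasDerivAt_latitude _ x).hasDerivWithinAt) (injOn_latitude ht ht1)] at hw
  have hc : ContinuousOn (fun x => (gegenbauer (((d : ℝ) - 2) / 2) m).eval
      ((x ^ 2 + 1 - Real.tanh lam ^ 2) / (2 * x)))
      (Icc (1 - Real.tanh lam) (1 + Real.tanh lam)) := by
    refine (gegenbauer (((d : ℝ) - 2) / 2) m).continuous.comp_continuousOn ?_
    refine ContinuousOn.div (by fun_prop) (by fun_prop) fun x hx => ?_
    have : 0 < x := by linarith [hx.1]
    positivity
  have h2 := IntegrableOn.mul_continuousOn_of_subset hw hc measurableSet_Ioo isCompact_Icc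
    Ioo_subset_Icc_self
  have h3 : IntegrableOn (kernel d m lam) (Ioo (1 - Real.tanh lam) (1 + Real.tanh lam)) := by
    refine h2.congr_fun (fun x hx => ?_) measurableSet_Ioo
    have : 0 < x := by linarith [hx.1]
    simp only [eval_one, one_mul]
    rw [kernel_eq m hlam hx, abs_of_pos (by positivity), smul_eq_mul,
      show ((d : ℝ) - 2) / 2 - 1 / 2 = ((d : ℝ) - 3) / 2 by ring]
  rw [← integrableOn_Icc_iff_integrableOn_Ioo] at h3
  rwa [integrableOn_iff_integrable_of_support_subset] at h3
  intro x hx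
  by_contra hcon
  exact hx (kernel_eq_zero hcon)

theorem integral_kernel_mul {d : ℕ} (m : ℕ) {lam : ℝ} (hlam : 0 < lam) (g : ℝ → ℂ) :
    ∫ x in Ioi (0 : ℝ), (kernel d m lam x : ℂ) * g x =
      ∫ τ in Ioo (-1 : ℝ) 1, (((1 - τ ^ 2) ^ (((d : ℝ) - 3) / 2) : ℝ) : ℂ) *
        ((((gegenbauer (((d : ℝ) - 2) / 2) m).eval
          ((1 + Real.tanh lam * τ) / √(1 + Real.tanh lam ^ 2 + 2 * Real.tanh lam * τ)) : ℝ) : ℂ) *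
          g (√(1 + Real.tanh lam ^ 2 + 2 * Real.tanh lam * τ))) := by
  have ht := tanh_pos hlam
  have ht1 := Real.tanh_lt_one lam
  rw [integral_latitude ht ht1]
  have h1 : ∫ x in Ioi (0 : ℝ), (kernel d m lam x : ℂ) * g x =
      ∫ x in Icc (1 - Real.tanh lam) (1 + Real.tanh lam), (kernel d m lam x : ℂ) * g x := by
    refine (setIntegral_eq_of_subset_of_forall_sdiff_eq_zero measurableSet_Ioi ?_ ?_)
    · intro x hx
      have : 0 < x := by linarith [hx.1]
      exact this
    · intro x hx
      simp [kernel_eq_zero hx.2]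
  rw [h1, integral_Icc_eq_integral_Ioo]
  refine setIntegral_congr_fun measurableSet_Ioo fun x hx => ?_
  have hx0 : 0 < x := by linarith [hx.1]
  have e1 : 1 + Real.tanh lam ^ 2 + 2 * Real.tanh lam *
      ((x ^ 2 - 1 - Real.tanh lam ^ 2) / (2 * Real.tanh lam)) = x ^ 2 := by
    field_simp; ring
  have e2 : (1 + Real.tanh lam * ((x ^ 2 - 1 - Real.tanh lam ^ 2) / (2 * Real.tanh lam))) / x =
      (x ^ 2 + 1 - Real.tanh lam ^ 2) / (2 * x) := by
    field_simp; ring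
  rw [e1, Real.sqrt_sq hx0.le, e2, kernel_eq m hlam hx]
  push_cast
  ring

/-- At x = 1 + t the Gegenbauer argument is 1, where the polynomial takes the value 1; positivity
persists slightly to the left by continuity. -/
theorem exists_kernel_pos {d : ℕ} (hd : 2 ≤ d) (m : ℕ) {lam : ℝ} (hlam : 0 < lam) :
    ∃ a, 0 < a ∧ a < 1 + Real.tanh lam ∧
      ∀ x, a < x → x < 1 + Real.tanh lam → 0 < kernel d m lam x := by
  have ht := tanh_pos hlam
  have ht1 := Real.tanh_lt_one lam
  have hν : -(1 / 2) < ((d : ℝ) - 2) / 2 := by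
    have : (2 : ℝ) ≤ d := by exact_mod_cast hd
    linarith
  have hc : ContinuousAt (fun x => (gegenbauer (((d : ℝ) - 2) / 2) m).eval
      ((x ^ 2 + 1 - Real.tanh lam ^ 2) / (2 * x))) (1 + Real.tanh lam) := by
    refine (gegenbauer (((d : ℝ) - 2) / 2) m).continuous.continuousAt.comp ?_
    exact ContinuousAt.div (by fun_prop) (by fun_prop) (by positivity)
  have h1 : ((1 + Real.tanh lam) ^ 2 + 1 - Real.tanh lam ^ 2) / (2 * (1 + Real.tanh lam)) = 1 := by
    rw [div_eq_one_iff_eq (by positivity)]; ring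
  have hev : ∀ᶠ x in 𝓝 (1 + Real.tanh lam), 0 < (gegenbauer (((d : ℝ) - 2) / 2) m).eval
      ((x ^ 2 + 1 - Real.tanh lam ^ 2) / (2 * x)) := by
    apply hc.eventually (lt_mem_nhds _)
    beta_reduce
    rw [h1, gegenbauer_eval_one hν]
    exact one_pos
  obtain ⟨δ, hδ, hball⟩ := Metric.eventually_nhds_iff.1 hev
  refine ⟨max (1 + Real.tanh lam - δ) (1 - Real.tanh lam), lt_max_of_lt_right (by linarith),
    max_lt (by linarith) (by linarith), fun x hx hx2 => ?_⟩
  obtain ⟨hx1, hx3⟩ := max_lt_iff.1 hx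
  have hx0 : 0 < x := by linarith
  have hmem : (x ^ 2 - 1 - Real.tanh lam ^ 2) / (2 * Real.tanh lam) ∈ Ioo (-1 : ℝ) 1 := by
    rw [← image_latitude ht ht1]; exact ⟨x, ⟨hx3, hx2⟩, rfl⟩
  rw [kernel_eq m hlam ⟨hx3, hx2⟩]
  refine mul_pos (mul_pos (by positivity) (Real.rpow_pos_of_pos ?_ _)) (hball ?_)
  · nlinarith [hmem.1, hmem.2]
  · rw [Real.dist_eq, abs_lt]; constructor <;> linarith

theorem mellinConvergent_kernel {d : ℕ} (hd : 2 ≤ d) (m : ℕ) {lam : ℝ} (hlam : 0 < lam) (s : ℂ) :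
    MellinConvergent (fun x => (kernel d m lam x : ℂ)) s := by
  refine mellinConvergent_of_support (h := fun x => (kernel d m lam x : ℂ))
    (a := 1 - Real.tanh lam) (b := 1 + Real.tanh lam)
    (integrable_kernel hd m hlam).ofReal (by linarith [Real.tanh_lt_one lam]) ?_ ?_ s
  · intro x hx
    rw [kernel_eq_zero (fun h => by linarith [h.1]), Complex.ofReal_zero]
  · intro x hx
    rw [kernel_eq_zero (fun h => by linarith [h.2]), Complex.ofReal_zero]

theorem ae_mellin_kernel_ne_zero {d : ℕ} (hd : 2 ≤ d) (m : ℕ) {lam : ℝ} (hlam : 0 < lam) (ϱ : ℝ) :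
    ∀ᵐ y : ℝ, mellin (fun x => (kernel d m lam x : ℂ)) (1 - ((ϱ : ℂ) + y * Complex.I)) ≠ 0 := by
  have hdiff : Differentiable ℂ (mellin fun x => (kernel d m lam x : ℂ)) := by
    refine differentiable_mellin_of_support (a := 1 - Real.tanh lam) (b := 1 + Real.tanh lam)
      (integrable_kernel hd m hlam).ofReal (by linarith [Real.tanh_lt_one lam]) ?_ ?_
    · intro x hx
      rw [kernel_eq_zero (fun h => by linarith [h.1]), Complex.ofReal_zero]
    · intro x hx
      rw [kernel_eq_zero (fun h => by linarith [h.2]), Complex.ofReal_zero]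
  refine ae_ne_zero_of_differentiable
    (F := fun z => mellin (fun x => (kernel d m lam x : ℂ)) (1 - ((ϱ : ℂ) + z * Complex.I)))
    (hdiff.comp (by fun_prop)) ?_
  obtain ⟨a, ha, hab, hpos⟩ := exists_kernel_pos hd m hlam
  obtain ⟨k, hk⟩ := exists_moment_ne_zero (integrable_kernel hd m hlam) ha hab
    (fun x hx => kernel_eq_zero fun h => by linarith [h.2]) hpos
  -- This z lies off the line and is chosen so that 1 - (ϱ + iz) = k + 1, where the Mellin transform
  -- is the k-th moment.
  refine ⟨((k : ℂ) + ϱ) * Complex.I, ?_⟩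
  have e : 1 - ((ϱ : ℂ) + ((k : ℂ) + ϱ) * Complex.I * Complex.I) = (k : ℂ) + 1 := by
    rw [mul_assoc, Complex.I_mul_I]; ring
  rw [e, mellin]
  have : ∫ x in Ioi (0 : ℝ), (x : ℂ) ^ ((k : ℂ) + 1 - 1) • (kernel d m lam x : ℂ) =
      ((∫ x in Ioi (0 : ℝ), x ^ k * kernel d m lam x : ℝ) : ℂ) := by
    rw [← integral_complex_ofReal]
    refine setIntegral_congr_fun measurableSet_Ioi fun x _ => ?_
    simp
  rw [this]
  exact_mod_cast hk

end Kernel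

/-! ### Hausdorff measure under maps with `dist (Φ x) (Φ y) = g x * g y * dist x y` -/

section Conformal

open scoped NNReal ENNReal

theorem measure_le_of_partition {X : Type*} [MeasurableSpace X] {μ ν : Measure X}
    {S : ℤ → Set X} (hS : ∀ j, MeasurableSet (S j))
    (hdisj : Pairwise (Function.onFun Disjoint S)) (hcov : ⋃ j, S j = univ)
    (h : ∀ j A, MeasurableSet A → A ⊆ S j → μ A ≤ ν A) : μ ≤ ν := by
  refine Measure.le_iff.2 fun A hA => ?_
  have hAeq : A = ⋃ j, A ∩ S j := by rw [← inter_iUnion, hcov, inter_univ]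
  rw [hAeq]
  have hd : Pairwise (Function.onFun Disjoint fun j => A ∩ S j) := fun i j hij =>
    (hdisj hij).mono inter_subset_right inter_subset_right
  rw [measure_iUnion hd fun j => hA.inter (hS j), measure_iUnion hd fun j => hA.inter (hS j)]
  exact ENNReal.tsum_le_tsum fun j => h j _ (hA.inter (hS j)) inter_subset_right

theorem le_of_forall_one_lt_pow_smul {X : Type*} [MeasurableSpace X] {μ ν : Measure X} (k : ℕ)
    (h : ∀ q : ℝ≥0, 1 < q → μ ≤ ((q : ℝ≥0∞) ^ k) • ν) : μ ≤ ν := by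
  intro A
  have ht : Tendsto (fun q : ℝ≥0 => ((q : ℝ≥0∞) ^ k) * ν A) (𝓝[>] 1) (𝓝 (1 * ν A)) := by
    refine ENNReal.Tendsto.mul_const ?_ (Or.inl one_ne_zero)
    have : Tendsto (fun q : ℝ≥0 => ((q : ℝ≥0∞) ^ k)) (𝓝 1) (𝓝 (((1 : ℝ≥0) : ℝ≥0∞) ^ k)) := by
      apply Continuous.tendsto
      fun_prop
    simpa using this.mono_left nhdsWithin_le_nhds
  rw [one_mul] at ht
  refine ge_of_tendsto ht ?_
  filter_upwards [self_mem_nhdsWithin] with q hq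
  simpa using h q hq A

variable {X Y : Type*} [MetricSpace X] [MeasurableSpace X] [BorelSpace X]
  [MetricSpace Y] [MeasurableSpace Y] [BorelSpace Y]

theorem hausdorffMeasure_image_le_of_edist {Φ : X → Y} {g : X → ℝ≥0}
    (hΦ : ∀ x y, edist (Φ x) (Φ y) = g x * g y * edist x y) (k : ℕ) {B : Set X} {a : ℝ≥0}
    (hB : ∀ x ∈ B, g x ≤ a) :
    μH[(k : ℝ)] (Φ '' B) ≤ (a : ℝ≥0∞) ^ (2 * k) * μH[(k : ℝ)] B := by
  have hL : LipschitzOnWith (a ^ 2) Φ B := by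
    intro x hx y hy
    rw [hΦ]
    gcongr
    rw [← ENNReal.coe_mul, ENNReal.coe_le_coe, sq]
    exact mul_le_mul' (hB x hx) (hB y hy)
  have := hL.hausdorffMeasure_image_le (d := k) (by positivity)
  rwa [ENNReal.coe_pow, ENNReal.rpow_natCast, ← pow_mul] at this

/-- On the image of B the inverse of Φ is Lipschitz with constant a⁻². -/
theorem le_hausdorffMeasure_image_of_edist {Φ : X → Y} {g : X → ℝ≥0}
    (hΦ : ∀ x y, edist (Φ x) (Φ y) = g x * g y * edist x y) (hinj : Function.Injective Φ) (k : ℕ)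
    {B : Set X} {a : ℝ≥0} (ha : 0 < a) (hB : ∀ x ∈ B, a ≤ g x) :
    (a : ℝ≥0∞) ^ (2 * k) * μH[(k : ℝ)] B ≤ μH[(k : ℝ)] (Φ '' B) := by
  rcases B.eq_empty_or_nonempty with rfl | ⟨x₀, hx₀⟩
  · simp
  have : Nonempty X := ⟨x₀⟩
  have hl : Function.LeftInverse (Function.invFun Φ) Φ := Function.leftInverse_invFun hinj
  have hL : LipschitzOnWith ((a ^ 2)⁻¹) (Function.invFun Φ) (Φ '' B) := by
    rintro _ ⟨x, hx, rfl⟩ _ ⟨y, hy, rfl⟩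
    rw [hl, hl, hΦ, ENNReal.coe_inv (by positivity), ENNReal.coe_pow, ← mul_assoc]
    calc edist x y = (((a : ℝ≥0∞) ^ 2)⁻¹ * a ^ 2) * edist x y := by
          rw [ENNReal.inv_mul_cancel, one_mul]
          · simpa using ha.ne'
          · simp
      _ ≤ _ := by
        gcongr
        rw [← ENNReal.coe_mul, ← ENNReal.coe_pow, ENNReal.coe_le_coe, sq]
        exact mul_le_mul' (hB x hx) (hB y hy)
  have h := hL.hausdorffMeasure_image_le (d := k) (by positivity)
  rw [image_image, ENNReal.coe_inv (by positivity), ENNReal.coe_pow, ENNReal.rpow_natCast,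
    ← ENNReal.inv_pow, ← pow_mul] at h
  simp only [hl _, image_id'] at h
  calc (a : ℝ≥0∞) ^ (2 * k) * μH[(k : ℝ)] B
      ≤ (a : ℝ≥0∞) ^ (2 * k) * (((a : ℝ≥0∞) ^ (2 * k))⁻¹ * μH[(k : ℝ)] (Φ '' B)) := by gcongr
    _ = _ := by
      rw [← mul_assoc, ENNReal.mul_inv_cancel, one_mul]
      · simpa using fun h => absurd h ha.ne'
      · simp

/-- On a shell q^j ≤ g < q^(j+1) the map Φ scales distances by q^(2j) up to a factor in [1, q²], so
the two measures agree there up to a factor q^(2k). Summing over j and letting q tend to 1 proves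
equality. The density is g^(2k) because a short distance carries the factor g at both end points. No
differentiability of Φ is involved. -/
theorem comap_hausdorffMeasure_of_edist {Φ : X → Y} {g : X → ℝ≥0} (hemb : MeasurableEmbedding Φ)
    (hg : Measurable g) (hpos : ∀ x, 0 < g x)
    (hΦ : ∀ x y, edist (Φ x) (Φ y) = g x * g y * edist x y) (k : ℕ) :
    (μH[(k : ℝ)] : Measure Y).comap Φ =
      (μH[(k : ℝ)] : Measure X).withDensity fun x => ((g x ^ (2 * k) : ℝ≥0) : ℝ≥0∞) := by
  have hpart : ∀ q : ℝ≥0, 1 < q → (∀ j : ℤ, MeasurableSet (g ⁻¹' Ico (q ^ j) (q ^ (j + 1)))) ∧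
      Pairwise (Function.onFun Disjoint fun j : ℤ => g ⁻¹' Ico (q ^ j) (q ^ (j + 1))) ∧
      ⋃ j : ℤ, g ⁻¹' Ico (q ^ j) (q ^ (j + 1)) = univ := by
    intro q hq
    refine ⟨fun j => hg measurableSet_Ico, fun i j hij => ?_, ?_⟩
    · refine Disjoint.preimage _ ?_
      exact (zpow_right_mono₀ hq.le).pairwise_disjoint_on_Ico_succ hij
    · rw [eq_univ_iff_forall]
      intro x
      obtain ⟨j, hj⟩ := exists_mem_Ico_zpow (hpos x) hq
      exact mem_iUnion.2 ⟨j, hj⟩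
  apply le_antisymm
  · refine le_of_forall_one_lt_pow_smul (2 * k) fun q hq => ?_
    obtain ⟨hS, hd, hc⟩ := hpart q hq
    refine measure_le_of_partition hS hd hc fun j A hA hAS => ?_
    rw [hemb.comap_apply, Measure.smul_apply, withDensity_apply _ hA, smul_eq_mul]
    have hq0 : 0 < q := zero_lt_one.trans hq
    calc μH[(k : ℝ)] (Φ '' A) ≤ ((q ^ (j + 1) : ℝ≥0) : ℝ≥0∞) ^ (2 * k) * μH[(k : ℝ)] A :=
          hausdorffMeasure_image_le_of_edist hΦ k fun x hx => (hAS hx).2.le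
      _ = (q : ℝ≥0∞) ^ (2 * k) * ((((q ^ j) ^ (2 * k) : ℝ≥0) : ℝ≥0∞) * μH[(k : ℝ)] A) := by
          rw [zpow_add_one₀ hq0.ne', ENNReal.coe_mul, mul_pow, ENNReal.coe_pow]
          ring
      _ ≤ _ := by
          gcongr
          rw [← setLIntegral_const]
          refine setLIntegral_mono' hA fun x hx => ?_
          rw [ENNReal.coe_le_coe]
          exact pow_le_pow_left₀ (zero_le) (hAS hx).1 _
  · refine le_of_forall_one_lt_pow_smul (2 * k) fun q hq => ?_
    obtain ⟨hS, hd, hc⟩ := hpart q hq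
    refine measure_le_of_partition hS hd hc fun j A hA hAS => ?_
    rw [Measure.smul_apply, hemb.comap_apply, withDensity_apply _ hA, smul_eq_mul]
    have hq0 : 0 < q := zero_lt_one.trans hq
    calc ∫⁻ x in A, ((g x ^ (2 * k) : ℝ≥0) : ℝ≥0∞) ∂μH[(k : ℝ)]
        ≤ ∫⁻ x in A, (((q ^ (j + 1)) ^ (2 * k) : ℝ≥0) : ℝ≥0∞) ∂μH[(k : ℝ)] := by
          refine setLIntegral_mono' hA fun x hx => ?_
          rw [ENNReal.coe_le_coe]
          exact pow_le_pow_left₀ (zero_le) (hAS hx).2.le _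
      _ = (q : ℝ≥0∞) ^ (2 * k) * (((q ^ j : ℝ≥0) : ℝ≥0∞) ^ (2 * k) * μH[(k : ℝ)] A) := by
          rw [setLIntegral_const, zpow_add_one₀ hq0.ne', mul_pow, ENNReal.coe_mul, ENNReal.coe_pow,
            ENNReal.coe_pow]
          ring
      _ ≤ _ := by
          gcongr
          exact le_hausdorffMeasure_image_of_edist hΦ hemb.injective k (zpow_pos hq0 j)
            fun x hx => (hAS hx).1

theorem comap_euclideanHausdorffMeasure_of_edist {Φ : X → Y} {g : X → ℝ≥0}
    (hemb : MeasurableEmbedding Φ) (hg : Measurable g) (hpos : ∀ x, 0 < g x)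
    (hΦ : ∀ x y, edist (Φ x) (Φ y) = g x * g y * edist x y) (k : ℕ) :
    (μHE[k] : Measure Y).comap Φ =
      (μHE[k] : Measure X).withDensity fun x => ((g x ^ (2 * k) : ℝ≥0) : ℝ≥0∞) := by
  ext A hA
  rw [hemb.comap_apply, Measure.euclideanHausdorffMeasure_def,
    Measure.euclideanHausdorffMeasure_def, withDensity_apply _ hA, Measure.restrict_smul,
    lintegral_smul_measure, Measure.smul_apply, ← withDensity_apply _ hA,
    ← comap_hausdorffMeasure_of_edist hemb hg hpos hΦ, hemb.comap_apply]

theorem setIntegral_range_euclideanHausdorffMeasure {Φ : X → Y} {g : X → ℝ≥0}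
    (hemb : MeasurableEmbedding Φ) (hg : Measurable g) (hpos : ∀ x, 0 < g x)
    (hΦ : ∀ x y, edist (Φ x) (Φ y) = g x * g y * edist x y) (k : ℕ) (f : Y → ℂ) :
    ∫ y in range Φ, f y ∂μHE[k] = ∫ x, (((g x : ℝ) ^ (2 * k) : ℝ) : ℂ) * f (Φ x) ∂μHE[k] := by
  rw [← hemb.map_comap, hemb.integral_map, comap_euclideanHausdorffMeasure_of_edist hemb hg hpos hΦ,
    integral_withDensity_eq_integral_smul (hg.pow_const _)]
  refine integral_congr_ae (.of_forall fun x => ?_)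
  simp [NNReal.smul_def]

end Conformal

/-! ### Stereographic projection and the subspheres -/

section Stereographic

variable {d : ℕ}

theorem stereoInv_last (y : EuclideanSpace ℝ (Fin d)) :
    stereoInv y (Fin.last d) = (-1 + ‖y‖ ^ 2) / (1 + ‖y‖ ^ 2) := by
  simp [stereoInv]

theorem stereoInv_castSucc (y : EuclideanSpace ℝ (Fin d)) (i : Fin d) :
    stereoInv y i.castSucc = 2 * y i / (1 + ‖y‖ ^ 2) := by
  simp [stereoInv]

theorem continuous_stereoInv : Continuous (stereoInv (d := d)) := by
  refine (PiLp.continuous_toLp 2 _).comp (continuous_pi (f := fun y i => stereoInv (d := d) y i)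
    fun i => ?_)
  have hne : ∀ y : EuclideanSpace ℝ (Fin d), 1 + ‖y‖ ^ 2 ≠ 0 := fun y => by positivity
  refine Fin.lastCases ?_ (fun i => ?_) i
  · simp_rw [stereoInv_last]
    exact Continuous.div (by fun_prop) (by fun_prop) hne
  · simp_rw [stereoInv_castSucc]
    exact Continuous.div (by fun_prop) (by fun_prop) hne

theorem inner_eq_sum {n : ℕ} (x y : EuclideanSpace ℝ (Fin n)) : inner ℝ x y = ∑ i, x i * y i := by
  simp [PiLp.inner_apply, mul_comm]

theorem inner_stereoInv (x y : EuclideanSpace ℝ (Fin d)) :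
    inner ℝ (stereoInv x) (stereoInv y) =
      (4 * inner ℝ x y + (-1 + ‖x‖ ^ 2) * (-1 + ‖y‖ ^ 2)) / ((1 + ‖x‖ ^ 2) * (1 + ‖y‖ ^ 2)) := by
  have hx : 1 + ‖x‖ ^ 2 ≠ 0 := by positivity
  have hy : 1 + ‖y‖ ^ 2 ≠ 0 := by positivity
  rw [inner_eq_sum, inner_eq_sum, Fin.sum_univ_castSucc]
  simp only [stereoInv_last, stereoInv_castSucc]
  have : ∑ i : Fin d, 2 * x i / (1 + ‖x‖ ^ 2) * (2 * y i / (1 + ‖y‖ ^ 2)) =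
      4 * (∑ i, x i * y i) / ((1 + ‖x‖ ^ 2) * (1 + ‖y‖ ^ 2)) := by
    rw [Finset.mul_sum, Finset.sum_div]
    refine Finset.sum_congr rfl fun i _ => ?_
    field_simp
    ring
  rw [this]
  field_simp

theorem norm_stereoInv (x : EuclideanSpace ℝ (Fin d)) : ‖stereoInv x‖ = 1 := by
  have hx : 1 + ‖x‖ ^ 2 ≠ 0 := by positivity
  have h := inner_stereoInv x x
  rw [real_inner_self_eq_norm_sq, real_inner_self_eq_norm_sq] at h
  have : ‖stereoInv x‖ ^ 2 = 1 := by
    rw [h, div_eq_one_iff_eq (by positivity)]; ring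
  exact (pow_eq_one_iff_of_nonneg (norm_nonneg _) two_ne_zero).1 this

theorem norm_stereoInv_sub_sq (x y : EuclideanSpace ℝ (Fin d)) :
    ‖stereoInv x - stereoInv y‖ ^ 2 =
      4 * ‖x - y‖ ^ 2 / ((1 + ‖x‖ ^ 2) * (1 + ‖y‖ ^ 2)) := by
  have hx : 1 + ‖x‖ ^ 2 ≠ 0 := by positivity
  have hy : 1 + ‖y‖ ^ 2 ≠ 0 := by positivity
  rw [norm_sub_sq_real, norm_sub_sq_real, inner_stereoInv, norm_stereoInv, norm_stereoInv]
  field_simp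
  ring

/-- The square root of the conformal factor at each of the two points: the two-point form to which
the preceding results on Hausdorff measure apply. -/
theorem dist_stereoInv (x y : EuclideanSpace ℝ (Fin d)) :
    dist (stereoInv x) (stereoInv y) = √(2 / (1 + ‖x‖ ^ 2)) * √(2 / (1 + ‖y‖ ^ 2)) * dist x y := by
  rw [dist_eq_norm, dist_eq_norm, ← sq_eq_sq₀ (norm_nonneg _) (by positivity), mul_pow, mul_pow,
    Real.sq_sqrt (by positivity), Real.sq_sqrt (by positivity), norm_stereoInv_sub_sq]
  field_simp
  ring

theorem injective_stereoInv : Function.Injective (stereoInv (d := d)) := by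
  intro x y h
  have := dist_stereoInv x y
  rw [h, dist_self] at this
  have h1 : 0 < √(2 / (1 + ‖x‖ ^ 2)) * √(2 / (1 + ‖y‖ ^ 2)) := by positivity
  exact dist_eq_zero.1 ((mul_eq_zero.1 this.symm).resolve_left h1.ne')

theorem exists_stereoInv_eq {x : EuclideanSpace ℝ (Fin (d + 1))} (hx : ‖x‖ = 1)
    (hl : x (Fin.last d) ≠ 1) : ∃ y, stereoInv y = x := by
  have hs : ∑ i : Fin d, x i.castSucc ^ 2 = 1 - x (Fin.last d) ^ 2 := by
    have h1 : ‖x‖ ^ 2 = 1 := by rw [hx]; norm_num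
    rw [EuclideanSpace.real_norm_sq_eq, Fin.sum_univ_castSucc] at h1
    linarith
  have hne : 1 - x (Fin.last d) ≠ 0 := sub_ne_zero.2 hl.symm
  refine ⟨WithLp.toLp 2 fun i => x i.castSucc / (1 - x (Fin.last d)), ?_⟩
  have hn : ‖(WithLp.toLp 2 fun i : Fin d => x i.castSucc / (1 - x (Fin.last d)) :
      EuclideanSpace ℝ (Fin d))‖ ^ 2 = (1 + x (Fin.last d)) / (1 - x (Fin.last d)) := by
    rw [EuclideanSpace.real_norm_sq_eq]
    simp only [div_pow]
    rw [← Finset.sum_div, hs]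
    field_simp
    ring
  have h2 : 1 + (1 + x (Fin.last d)) / (1 - x (Fin.last d)) = 2 / (1 - x (Fin.last d)) := by
    field_simp; ring
  ext i
  refine Fin.lastCases ?_ (fun i => ?_) i
  · rw [stereoInv_last, hn, h2]; field_simp; ring
  · rw [stereoInv_castSucc, hn, h2]
    simp only
    field_simp

/-! ### Tangent hyperplanes of the spheroid and the subspheres they cut out. -/

theorem tanh_sq_mul_cosh_sq (lam : ℝ) :
    Real.tanh lam ^ 2 * Real.cosh lam ^ 2 = Real.cosh lam ^ 2 - 1 := by
  have hc := Real.cosh_pos lam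
  rw [Real.tanh_eq_sinh_div_cosh, div_pow, div_mul_cancel₀ _ (by positivity), Real.sinh_sq]

/-- The point of the spheroid at which the tangent hyperplane cuts out `subsphere lam ψ c`. -/
noncomputable def tangentPoint (lam : ℝ) (ψ : sphere (0 : EuclideanSpace ℝ (Fin d)) 1) (c : ℝ) :
    EuclideanSpace ℝ (Fin (d + 1)) :=
  WithLp.toLp 2 (Fin.snoc (α := fun _ => ℝ)
    (fun i => 2 * c / (c ^ 2 + Real.cosh lam ^ 2) * (ψ : EuclideanSpace ℝ (Fin d)) i)
    ((c ^ 2 - Real.cosh lam ^ 2) / (c ^ 2 + Real.cosh lam ^ 2)))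

theorem tangentPoint_last (lam : ℝ) (ψ : sphere (0 : EuclideanSpace ℝ (Fin d)) 1) (c : ℝ) :
    tangentPoint lam ψ c (Fin.last d) =
      (c ^ 2 - Real.cosh lam ^ 2) / (c ^ 2 + Real.cosh lam ^ 2) := by
  simp [tangentPoint]

theorem tangentPoint_castSucc (lam : ℝ) (ψ : sphere (0 : EuclideanSpace ℝ (Fin d)) 1) (c : ℝ)
    (i : Fin d) : tangentPoint lam ψ c i.castSucc =
      2 * c / (c ^ 2 + Real.cosh lam ^ 2) * (ψ : EuclideanSpace ℝ (Fin d)) i := by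
  simp [tangentPoint]

theorem sum_sphere_sq (ψ : sphere (0 : EuclideanSpace ℝ (Fin d)) 1) :
    ∑ i, (ψ : EuclideanSpace ℝ (Fin d)) i ^ 2 = 1 := by
  rw [← EuclideanSpace.real_norm_sq_eq, norm_eq_of_mem_sphere]; norm_num

theorem tangentPoint_mem_spheroid (lam : ℝ) (ψ : sphere (0 : EuclideanSpace ℝ (Fin d)) 1) (c : ℝ) :
    tangentPoint lam ψ c ∈ spheroid d lam := by
  have hC := Real.cosh_pos lam
  simp only [spheroid, mem_ofPred_eq, tangentPoint_last, tangentPoint_castSucc, mul_pow]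
  rw [← Finset.mul_sum, sum_sphere_sq]
  have : c ^ 2 + Real.cosh lam ^ 2 ≠ 0 := by positivity
  field_simp
  ring

theorem mem_tangentHyperplane_iff {lam : ℝ} {p : EuclideanSpace ℝ (Fin (d + 1))}
    (hp : p ∈ spheroid d lam) (x : EuclideanSpace ℝ (Fin (d + 1))) :
    x ∈ tangentHyperplane lam p ↔ p (Fin.last d) * x (Fin.last d) +
      Real.cosh lam ^ 2 * ∑ i : Fin d, p i.castSucc * x i.castSucc = 1 := by
  simp only [spheroid, mem_ofPred_eq] at hp
  simp only [tangentHyperplane, mem_ofPred_eq, mul_sub, Finset.sum_sub_distrib, ← sq]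
  constructor <;> intro h <;> linarith

theorem sphere_inter_tangentHyperplane {lam : ℝ} (hlam : 0 < lam)
    (ψ : sphere (0 : EuclideanSpace ℝ (Fin d)) 1) {c : ℝ} (hc : 0 < c) :
    sphere 0 1 ∩ tangentHyperplane lam (tangentPoint lam ψ c) = subsphere lam ψ c := by
  have hC := Real.cosh_pos lam
  have ht := tanh_pos hlam
  have hD : c ^ 2 + Real.cosh lam ^ 2 ≠ 0 := by positivity
  -- Clearing denominators, the tangent equation at Λ⁻¹y becomes |y|² - 2c⟨y,ψ⟩ + c²/cosh²λ = 0, and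
  -- c² - c²/cosh²λ = c² tanh²λ.
  have key : ∀ y : EuclideanSpace ℝ (Fin d),
      stereoInv y ∈ tangentHyperplane lam (tangentPoint lam ψ c) ↔
        ‖y - c • (ψ : EuclideanSpace ℝ (Fin d))‖ = c * Real.tanh lam := by
    intro y
    have hY : 1 + ‖y‖ ^ 2 ≠ 0 := by positivity
    rw [mem_tangentHyperplane_iff (tangentPoint_mem_spheroid lam ψ c)]
    simp only [tangentPoint_last, tangentPoint_castSucc, stereoInv_last, stereoInv_castSucc]
    have hsum : ∑ i : Fin d, 2 * c / (c ^ 2 + Real.cosh lam ^ 2) *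
        (ψ : EuclideanSpace ℝ (Fin d)) i * (2 * y i / (1 + ‖y‖ ^ 2)) =
        4 * c * inner ℝ y (ψ : EuclideanSpace ℝ (Fin d)) /
          ((c ^ 2 + Real.cosh lam ^ 2) * (1 + ‖y‖ ^ 2)) := by
      rw [inner_eq_sum, Finset.mul_sum, Finset.sum_div]
      refine Finset.sum_congr rfl fun i _ => ?_
      field_simp
      ring
    rw [hsum, ← sq_eq_sq₀ (norm_nonneg _) (by positivity), norm_sub_sq_real, real_inner_smul_right,
      norm_smul, norm_eq_of_mem_sphere, mul_one, Real.norm_of_nonneg hc.le]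
    have htc := tanh_sq_mul_cosh_sq lam
    generalize inner ℝ y (ψ : EuclideanSpace ℝ (Fin d)) = s
    rw [show (c ^ 2 - Real.cosh lam ^ 2) / (c ^ 2 + Real.cosh lam ^ 2) *
      ((-1 + ‖y‖ ^ 2) / (1 + ‖y‖ ^ 2)) + Real.cosh lam ^ 2 *
      (4 * c * s / ((c ^ 2 + Real.cosh lam ^ 2) * (1 + ‖y‖ ^ 2))) =
      ((c ^ 2 - Real.cosh lam ^ 2) * (-1 + ‖y‖ ^ 2) + 4 * Real.cosh lam ^ 2 * c * s) /
        ((c ^ 2 + Real.cosh lam ^ 2) * (1 + ‖y‖ ^ 2)) by field_simp,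
      div_eq_one_iff_eq (by positivity)]
    constructor
    · intro h
      have hC2 : (2 * Real.cosh lam ^ 2) ≠ 0 := by positivity
      apply mul_left_cancel₀ hC2
      linear_combination -h - 2 * c ^ 2 * htc
    · intro h
      linear_combination (-2 * Real.cosh lam ^ 2) * h - 2 * c ^ 2 * htc
  ext x
  constructor
  · rintro ⟨hx, hx2⟩
    rw [mem_sphere_zero_iff_norm] at hx
    -- The north pole, the one point missed by `stereoInv`, is not on the hyperplane: that would
    -- need c² - cosh²λ = c² + cosh²λ.
    have hl : x (Fin.last d) ≠ 1 := by
      intro hl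
      have h1 : ‖x‖ ^ 2 = 1 := by rw [hx]; norm_num
      rw [EuclideanSpace.real_norm_sq_eq, Fin.sum_univ_castSucc, hl] at h1
      have h2 : ∑ i : Fin d, x i.castSucc ^ 2 = 0 := by linarith
      rw [Finset.sum_eq_zero_iff_of_nonneg fun i _ => sq_nonneg _] at h2
      rw [mem_tangentHyperplane_iff (tangentPoint_mem_spheroid lam ψ c), hl,
        Finset.sum_eq_zero fun i hi => by
          rw [pow_eq_zero_iff two_ne_zero |>.1 (h2 i hi), mul_zero], tangentPoint_last, mul_one,
        mul_zero, add_zero, div_eq_one_iff_eq hD] at hx2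
      nlinarith
    obtain ⟨y, rfl⟩ := exists_stereoInv_eq hx hl
    rw [key] at hx2
    have hct : c * Real.tanh lam ≠ 0 := by positivity
    refine ⟨⟨(c * Real.tanh lam)⁻¹ • (y - c • (ψ : EuclideanSpace ℝ (Fin d))), ?_⟩, ?_⟩
    · rw [mem_sphere_zero_iff_norm, norm_smul, hx2, norm_inv,
        Real.norm_of_nonneg (by positivity), inv_mul_cancel₀ hct]
    · simp only
      rw [smul_inv_smul₀ hct, add_sub_cancel]
  · rintro ⟨ω, rfl⟩
    refine ⟨by simp [norm_stereoInv], ?_⟩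
    rw [key, add_sub_cancel_left, norm_smul, norm_eq_of_mem_sphere, mul_one,
      Real.norm_of_nonneg (by positivity)]

theorem exists_tangentPoint_eq {lam : ℝ} {p : EuclideanSpace ℝ (Fin (d + 1))}
    (hp : p ∈ spheroid d lam) (hne : ∃ i : Fin d, p i.castSucc ≠ 0) :
    ∃ (ψ : sphere (0 : EuclideanSpace ℝ (Fin d)) 1) (c : ℝ), 0 < c ∧ p = tangentPoint lam ψ c := by
  have hC := Real.cosh_pos lam
  set v : EuclideanSpace ℝ (Fin d) := WithLp.toLp 2 fun i => p i.castSucc with hv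
  have hv0 : v ≠ 0 := by
    obtain ⟨i, hi⟩ := hne
    intro h
    exact hi (by simpa [hv] using congrArg (fun w : EuclideanSpace ℝ (Fin d) => w i) h)
  have hn : 0 < ‖v‖ := norm_pos_iff.2 hv0
  have hsp : p (Fin.last d) ^ 2 + ‖v‖ ^ 2 * Real.cosh lam ^ 2 = 1 := by
    rw [EuclideanSpace.real_norm_sq_eq]; exact hp
  have hlt : p (Fin.last d) < 1 := by
    have : 0 < ‖v‖ ^ 2 * Real.cosh lam ^ 2 := by positivity
    nlinarith
  have hq : 0 < 1 - p (Fin.last d) := by linarith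
  -- Stretching the first d coordinates by cosh λ carries the spheroid to the unit sphere, and c /
  -- cosh λ is the norm of the stereographic projection of the image of p; ψ is its direction.
  refine ⟨⟨‖v‖⁻¹ • v, by simp [norm_smul, hn.ne']⟩, Real.cosh lam ^ 2 * ‖v‖ / (1 - p (Fin.last d)),
    by positivity, ?_⟩
  set c := Real.cosh lam ^ 2 * ‖v‖ / (1 - p (Fin.last d)) with hcdef
  have hc2 : c ^ 2 + Real.cosh lam ^ 2 = 2 * Real.cosh lam ^ 2 / (1 - p (Fin.last d)) := by
    rw [hcdef]
    field_simp
    linear_combination hsp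
  have hc3 : c ^ 2 - Real.cosh lam ^ 2 =
      2 * Real.cosh lam ^ 2 * p (Fin.last d) / (1 - p (Fin.last d)) := by
    rw [hcdef]
    field_simp
    linear_combination hsp
  ext i
  refine Fin.lastCases ?_ (fun i => ?_) i
  · rw [tangentPoint_last, hc2, hc3]
    field_simp
  · rw [tangentPoint_castSucc, hc2]
    simp only [hcdef, PiLp.smul_apply, smul_eq_mul]
    rw [show v i = p i.castSucc from rfl]
    field_simp

theorem tangentSubspheres_eq {lam : ℝ} (hlam : 0 < lam) :
    tangentSubspheres d lam = {T | ∃ (ψ : sphere (0 : EuclideanSpace ℝ (Fin d)) 1) (c : ℝ),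
      0 < c ∧ T = subsphere lam ψ c} := by
  have ht := tanh_pos hlam
  ext T
  constructor
  · rintro ⟨p, hp, rfl, hnt⟩
    -- Otherwise p is a pole, and its tangent hyperplane meets the unit sphere in p alone.
    have hne : ∃ i : Fin d, p i.castSucc ≠ 0 := by
      by_contra! h0
      have hl : p (Fin.last d) ^ 2 = 1 := by
        have := hp
        simp only [spheroid, mem_ofPred_eq, h0] at this
        simpa using this
      have huniq : ∀ x ∈ sphere 0 1 ∩ tangentHyperplane lam p, x = p := by
        rintro x ⟨hx, hx2⟩
        rw [mem_sphere_zero_iff_norm] at hx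
        rw [mem_tangentHyperplane_iff hp] at hx2
        simp only [h0, zero_mul, Finset.sum_const_zero, mul_zero, add_zero] at hx2
        have hxl : x (Fin.last d) = p (Fin.last d) := by
          linear_combination p (Fin.last d) * hx2 - x (Fin.last d) * hl
        have h1 : ‖x‖ ^ 2 = 1 := by rw [hx]; norm_num
        rw [EuclideanSpace.real_norm_sq_eq, Fin.sum_univ_castSucc, hxl, hl] at h1
        have h2 : ∑ i : Fin d, x i.castSucc ^ 2 = 0 := by linarith
        rw [Finset.sum_eq_zero_iff_of_nonneg fun i _ => sq_nonneg _] at h2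
        ext i
        refine Fin.lastCases hxl (fun i => ?_) i
        rw [h0, pow_eq_zero_iff two_ne_zero |>.1 (h2 i (Finset.mem_univ i))]
      obtain ⟨x, hx, y, hy, hxy⟩ := hnt
      exact hxy ((huniq x hx).trans (huniq y hy).symm)
    obtain ⟨ψ, c, hc, rfl⟩ := exists_tangentPoint_eq hp hne
    exact ⟨ψ, c, hc, sphere_inter_tangentHyperplane hlam ψ hc⟩
  · rintro ⟨ψ, c, hc, rfl⟩
    refine ⟨tangentPoint lam ψ c, tangentPoint_mem_spheroid lam ψ c,
      (sphere_inter_tangentHyperplane hlam ψ hc).symm, ?_⟩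
    -- The parameters ω = ψ and ω = -ψ give two distinct points.
    refine ⟨_, ⟨ψ, rfl⟩, _, ⟨-ψ, rfl⟩, fun h => ?_⟩
    have := injective_stereoInv h
    rw [add_right_inj] at this
    exact ne_neg_of_mem_unit_sphere ℝ ψ
      (Subtype.ext (smul_right_injective _ (by positivity : c * Real.tanh lam ≠ 0) this))

end Stereographic

/-! ### The orthogonal group and rotation-invariant measures on the sphere -/

section Rotations

instance continuousStar_clm (E : Type*) [NormedAddCommGroup E] [InnerProductSpace ℝ E]
    [CompleteSpace E] : ContinuousStar (E →L[ℝ] E) :=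
  ⟨(ContinuousLinearMap.adjoint (𝕜 := ℝ) (E := E) (F := E)).continuous⟩

/-- The orthogonal group of `ℝ^d`. -/
abbrev OrthGroup (d : ℕ) : Type :=
  unitary (EuclideanSpace ℝ (Fin d) →L[ℝ] EuclideanSpace ℝ (Fin d))

instance compactSpace_orthGroup (d : ℕ) : CompactSpace (OrthGroup d) := by
  refine (isCompact_iff_compactSpace (s := (unitary (EuclideanSpace ℝ (Fin d) →L[ℝ]
    EuclideanSpace ℝ (Fin d)) :
    Set (EuclideanSpace ℝ (Fin d) →L[ℝ] EuclideanSpace ℝ (Fin d))))).1 ?_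
  refine Metric.isCompact_of_isClosed_isBounded isClosed_unitary ?_
  refine (Metric.isBounded_closedBall (x := (0 : EuclideanSpace ℝ (Fin d) →L[ℝ] _))
    (r := 1)).subset fun u hu => ?_
  rw [mem_closedBall_zero_iff]
  refine ContinuousLinearMap.opNorm_le_bound _ zero_le_one fun x => ?_
  rw [one_mul]
  exact (Unitary.norm_map ⟨u, hu⟩ x).le

/-- The normalized Haar measure of the orthogonal group. -/
noncomputable def haarProb (d : ℕ) : Measure (OrthGroup d) := Measure.haarMeasure ⊤

instance isProbabilityMeasure_haarProb (d : ℕ) : IsProbabilityMeasure (haarProb d) :=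
  ⟨by
    have := Measure.haarMeasure_self (K₀ := (⊤ : TopologicalSpace.PositiveCompacts (OrthGroup d)))
    simpa [haarProb] using this⟩

instance isMulLeftInvariant_haarProb (d : ℕ) : (haarProb d).IsMulLeftInvariant :=
  Measure.isMulLeftInvariant_haarMeasure _

variable {d : ℕ}

/-- The action of the orthogonal group on the unit sphere. -/
noncomputable def rotate (R : OrthGroup d) (x : sphere (0 : EuclideanSpace ℝ (Fin d)) 1) :
    sphere (0 : EuclideanSpace ℝ (Fin d)) 1 :=
  ⟨(R : EuclideanSpace ℝ (Fin d) →L[ℝ] _) x, by simp [Unitary.norm_map]⟩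

theorem coe_rotate (R : OrthGroup d) (x : sphere (0 : EuclideanSpace ℝ (Fin d)) 1) :
    (rotate R x : EuclideanSpace ℝ (Fin d)) = (R : EuclideanSpace ℝ (Fin d) →L[ℝ] _) x := rfl

theorem rotate_mul (R T : OrthGroup d) (x : sphere (0 : EuclideanSpace ℝ (Fin d)) 1) :
    rotate (R * T) x = rotate R (rotate T x) := rfl

theorem rotate_one (x : sphere (0 : EuclideanSpace ℝ (Fin d)) 1) : rotate 1 x = x := rfl

theorem rotate_inv_rotate (R : OrthGroup d) (x : sphere (0 : EuclideanSpace ℝ (Fin d)) 1) :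
    rotate R⁻¹ (rotate R x) = x := by
  rw [← rotate_mul, inv_mul_cancel, rotate_one]

theorem rotate_rotate_inv (R : OrthGroup d) (x : sphere (0 : EuclideanSpace ℝ (Fin d)) 1) :
    rotate R (rotate R⁻¹ x) = x := by
  rw [← rotate_mul, mul_inv_cancel, rotate_one]

theorem continuous_rotate : Continuous fun p : OrthGroup d ×
    sphere (0 : EuclideanSpace ℝ (Fin d)) 1 => rotate p.1 p.2 := by
  refine Continuous.subtype_mk ?_ _
  exact (continuous_subtype_val.comp continuous_fst).clm_apply
    (continuous_subtype_val.comp continuous_snd)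

theorem continuous_rotate_inv : Continuous fun p : OrthGroup d ×
    sphere (0 : EuclideanSpace ℝ (Fin d)) 1 => rotate p.1⁻¹ p.2 :=
  continuous_rotate.comp (continuous_fst.inv.prodMk continuous_snd)

/-- The reflection in the hyperplane orthogonal to x - y. It also fixes every vector that has equal
inner products with x and y; this provides the elements of axis stabilizers needed for zonal
polynomials. -/
theorem exists_orthGroup_map_eq {x y : EuclideanSpace ℝ (Fin d)} (h : ‖x‖ = ‖y‖) :
    ∃ R : OrthGroup d, (R : EuclideanSpace ℝ (Fin d) →L[ℝ] _) x = y ∧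
      ∀ z, inner ℝ (x - y) z = 0 → (R : EuclideanSpace ℝ (Fin d) →L[ℝ] _) z = z := by
  refine ⟨Unitary.linearIsometryEquiv.symm ((ℝ ∙ (x - y))ᗮ.reflection), ?_, fun z hz => ?_⟩
  · exact Submodule.reflection_sub h
  · exact Submodule.reflection_mem_subspace_eq_self
      (Submodule.mem_orthogonal_singleton_iff_inner_right.2 hz)

theorem exists_rotate_eq (x y : sphere (0 : EuclideanSpace ℝ (Fin d)) 1) :
    ∃ R : OrthGroup d, rotate R x = y := by
  obtain ⟨R, hR, -⟩ := exists_orthGroup_map_eq (x := (x : EuclideanSpace ℝ (Fin d))) (y := y)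
    (by rw [norm_eq_of_mem_sphere, norm_eq_of_mem_sphere])
  exact ⟨R, Subtype.ext hR⟩

/-- A measure on the sphere is rotation invariant. -/
def IsRotationInvariant (ν : Measure (sphere (0 : EuclideanSpace ℝ (Fin d)) 1)) : Prop :=
  ∀ R : OrthGroup d, MeasurePreserving (rotate R) ν ν

theorem measurableEmbedding_rotate (R : OrthGroup d) : MeasurableEmbedding (rotate R) := by
  refine Continuous.measurableEmbedding (continuous_rotate.comp (Continuous.prodMk_right R)) ?_
  intro x y h
  rw [← rotate_inv_rotate R x, ← rotate_inv_rotate R y]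
  exact congrArg _ h

/-- `toSphere` measures a set through the volume of the cone over it; a linear isometry carries
cones to cones and preserves volume. -/
theorem isRotationInvariant_toSphere : IsRotationInvariant
    (volume : Measure (EuclideanSpace ℝ (Fin d))).toSphere := by
  intro R
  refine ⟨(measurableEmbedding_rotate R).measurable, ?_⟩
  ext s hs
  rw [Measure.map_apply (measurableEmbedding_rotate R).measurable hs,
    Measure.toSphere_apply' _ hs,
    Measure.toSphere_apply' _ ((measurableEmbedding_rotate R).measurable hs)]
  congr 1
  set L := Unitary.linearIsometryEquiv R with hL
  have hL' : ∀ x, L x = (R : EuclideanSpace ℝ (Fin d) →L[ℝ] _) x := fun x => rfl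
  refine Eq.trans ?_ (L.measurePreserving.measure_preimage_equiv (f := L.toMeasurableEquiv) _)
  congr 1
  ext x
  constructor
  · rintro ⟨a, ha, _, ⟨y, hy, rfl⟩, rfl⟩
    refine ⟨a, ha, _, ⟨rotate R y, hy, rfl⟩, ?_⟩
    change a • (R : EuclideanSpace ℝ (Fin d) →L[ℝ] _) y = L (a • (y : EuclideanSpace ℝ (Fin d)))
    rw [hL', map_smul]
  · rintro ⟨a, ha, _, ⟨y, hy, rfl⟩, hx⟩
    refine ⟨a, ha, _, ⟨rotate R⁻¹ y, ?_, rfl⟩, ?_⟩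
    · rwa [mem_preimage, rotate_rotate_inv]
    · change a • (y : EuclideanSpace ℝ (Fin d)) = L x at hx
      apply L.injective
      change L (a • (rotate R⁻¹ y : EuclideanSpace ℝ (Fin d))) = L x
      rw [← hx, map_smul, hL', ← coe_rotate, rotate_rotate_inv]

theorem isRotationInvariant_euclideanHausdorffMeasure (k : ℕ) : IsRotationInvariant
    (μHE[k] : Measure (sphere (0 : EuclideanSpace ℝ (Fin d)) 1)) := by
  intro R
  have hiso : Isometry (rotate R) := by
    refine Isometry.of_dist_eq fun x y => ?_
    rw [Subtype.dist_eq, Subtype.dist_eq, coe_rotate, coe_rotate, dist_eq_norm, dist_eq_norm,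
      ← map_sub, Unitary.norm_map]
  exact (IsometryEquiv.mk' (rotate R) (rotate R⁻¹) (rotate_rotate_inv R)
    hiso).measurePreserving_euclideanHausdorffMeasure k

/-- Some T carries x to y, and left translation by T does not change the Haar integral. -/
theorem integral_haarProb_rotate_inv {G : Type*} [NormedAddCommGroup G] [NormedSpace ℝ G]
    (F : sphere (0 : EuclideanSpace ℝ (Fin d)) 1 → G)
    (x y : sphere (0 : EuclideanSpace ℝ (Fin d)) 1) :
    ∫ R, F (rotate R⁻¹ x) ∂haarProb d = ∫ R, F (rotate R⁻¹ y) ∂haarProb d := by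
  obtain ⟨T, hT⟩ := exists_rotate_eq x y
  rw [← integral_mul_left_eq_self (fun R => F (rotate R⁻¹ y)) T]
  simp_rw [mul_inv_rev, rotate_mul, ← hT, rotate_inv_rotate]

/-- Integrate F(R⁻¹x) over both R and x. Invariance of ν makes the x-integral independent of R, and
transitivity makes the R-integral independent of x. In particular a finite invariant measure is
determined by its total mass. -/
theorem integral_eq_haar_average {G : Type*} [NormedAddCommGroup G] [NormedSpace ℝ G]
    [CompleteSpace G] {ν : Measure (sphere (0 : EuclideanSpace ℝ (Fin d)) 1)} [IsFiniteMeasure ν]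
    (hν : IsRotationInvariant ν) {F : sphere (0 : EuclideanSpace ℝ (Fin d)) 1 → G}
    (hF : Continuous F) (e : sphere (0 : EuclideanSpace ℝ (Fin d)) 1) :
    ∫ x, F x ∂ν = ν.real univ • ∫ R, F (rotate R⁻¹ e) ∂haarProb d := by
  have hc : Continuous fun p : OrthGroup d × sphere (0 : EuclideanSpace ℝ (Fin d)) 1 =>
      F (rotate p.1⁻¹ p.2) := hF.comp continuous_rotate_inv
  have hinteg : Integrable (Function.uncurry fun (R : OrthGroup d)
      (x : sphere (0 : EuclideanSpace ℝ (Fin d)) 1) => F (rotate R⁻¹ x)) ((haarProb d).prod ν) :=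
    hc.integrable_of_hasCompactSupport (HasCompactSupport.of_compactSpace _)
  calc ∫ x, F x ∂ν = ∫ _R : OrthGroup d, ∫ x, F x ∂ν ∂haarProb d := by simp
    _ = ∫ R : OrthGroup d, ∫ x, F (rotate R⁻¹ x) ∂ν ∂haarProb d := by
      congr 1
      ext R
      rw [(hν R⁻¹).integral_comp (measurableEmbedding_rotate R⁻¹)]
    _ = ∫ x, ∫ R : OrthGroup d, F (rotate R⁻¹ x) ∂haarProb d ∂ν := integral_integral_swap hinteg
    _ = ∫ _x, ∫ R : OrthGroup d, F (rotate R⁻¹ e) ∂haarProb d ∂ν := by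
      congr 1
      ext x
      exact integral_haarProb_rotate_inv F x e
    _ = _ := by rw [integral_const]

theorem eq_of_isRotationInvariant {μ ν : Measure (sphere (0 : EuclideanSpace ℝ (Fin d)) 1)}
    [IsFiniteMeasure μ] [IsFiniteMeasure ν] (hμ : IsRotationInvariant μ)
    (hν : IsRotationInvariant ν) (h : μ.real univ = ν.real univ) : μ = ν := by
  rcases isEmpty_or_nonempty (sphere (0 : EuclideanSpace ℝ (Fin d)) 1) with he | ⟨⟨e⟩⟩
  · exact Measure.eq_zero_of_isEmpty μ |>.trans (Measure.eq_zero_of_isEmpty ν).symm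
  refine ext_of_forall_integral_eq_of_IsFiniteMeasure fun F => ?_
  rw [integral_eq_haar_average hμ F.continuous e, integral_eq_haar_average hν F.continuous e, h]

end Rotations

/-! ### The surface measure of the sphere -/

section SphereMeasure

open scoped NNReal ENNReal

theorem edist_eq_of_dist_eq {X Y : Type*} [PseudoMetricSpace X] [PseudoMetricSpace Y] {a b : Y}
    {x y : X} {g h : ℝ≥0} (hd : dist a b = g * h * dist x y) :
    edist a b = g * h * edist x y := by
  rw [edist_nndist, edist_nndist, ← ENNReal.coe_mul, ← ENNReal.coe_mul, ENNReal.coe_inj]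
  exact NNReal.eq (by push_cast; exact hd)

variable {n : ℕ}

/-- The inverse stereographic projection with values in the unit sphere. -/
noncomputable def stereoSphere (y : EuclideanSpace ℝ (Fin n)) :
    sphere (0 : EuclideanSpace ℝ (Fin (n + 1))) 1 :=
  ⟨stereoInv y, by simp [norm_stereoInv]⟩

/-- The square root of the conformal factor of the inverse stereographic projection. -/
noncomputable def stereoFactor (y : EuclideanSpace ℝ (Fin n)) : ℝ≥0 :=
  ⟨√(2 / (1 + ‖y‖ ^ 2)), Real.sqrt_nonneg _⟩

theorem stereoFactor_pow (y : EuclideanSpace ℝ (Fin n)) (k : ℕ) :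
    (stereoFactor y : ℝ) ^ (2 * k) = (2 / (1 + ‖y‖ ^ 2)) ^ k := by
  rw [pow_mul]
  congr 1
  exact Real.sq_sqrt (by positivity)

theorem stereoFactor_pos (y : EuclideanSpace ℝ (Fin n)) : 0 < stereoFactor y :=
  Real.sqrt_pos.2 (by positivity)

theorem continuous_stereoFactor : Continuous (stereoFactor (n := n)) := by
  refine Continuous.subtype_mk ?_ _
  refine Real.continuous_sqrt.comp (Continuous.div (by fun_prop) (by fun_prop) fun y => ?_)
  positivity

theorem measurableEmbedding_stereoSphere : MeasurableEmbedding (stereoSphere (n := n)) :=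
  Continuous.measurableEmbedding (continuous_stereoInv.subtype_mk _) fun _ _ h =>
    injective_stereoInv (congrArg Subtype.val h)

theorem edist_stereoSphere (x y : EuclideanSpace ℝ (Fin n)) :
    edist (stereoSphere x) (stereoSphere y) = stereoFactor x * stereoFactor y * edist x y :=
  edist_eq_of_dist_eq (dist_stereoInv x y)

/-- Only the north pole is missed, and points are null in positive dimension. -/
theorem euclideanHausdorffMeasure_compl_range_stereoSphere (hn : 1 ≤ n) :
    (μHE[n] : Measure (sphere (0 : EuclideanSpace ℝ (Fin (n + 1))) 1))
      (range (stereoSphere (n := n)))ᶜ = 0 := by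
  have hsub : ((range (stereoSphere (n := n)))ᶜ).Subsingleton := by
    have hlast : ∀ x ∈ (range (stereoSphere (n := n)))ᶜ,
        (x : EuclideanSpace ℝ (Fin (n + 1))) (Fin.last n) = 1 := by
      intro x hx
      by_contra h
      obtain ⟨y, hy⟩ := exists_stereoInv_eq (norm_eq_of_mem_sphere x) h
      exact hx ⟨y, Subtype.ext hy⟩
    have hcast : ∀ x ∈ (range (stereoSphere (n := n)))ᶜ, ∀ i : Fin n,
        (x : EuclideanSpace ℝ (Fin (n + 1))) i.castSucc = 0 := by
      intro x hx i
      have h1 := sum_sphere_sq x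
      rw [Fin.sum_univ_castSucc, hlast x hx] at h1
      have h2 : ∑ i : Fin n, (x : EuclideanSpace ℝ (Fin (n + 1))) i.castSucc ^ 2 = 0 := by linarith
      rw [Finset.sum_eq_zero_iff_of_nonneg fun i _ => sq_nonneg _] at h2
      exact pow_eq_zero_iff two_ne_zero |>.1 (h2 i (Finset.mem_univ i))
    intro x hx y hy
    ext i
    refine Fin.lastCases ?_ (fun i => ?_) i
    · rw [hlast x hx, hlast y hy]
    · rw [hcast x hx, hcast y hy]
  have := Measure.nullSingletonClass_hausdorff (sphere (0 : EuclideanSpace ℝ (Fin (n + 1))) 1)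
    (d := n) (by exact_mod_cast hn)
  rw [Measure.euclideanHausdorffMeasure_def, Measure.smul_apply, hsub.measure_zero, smul_zero]

theorem integral_euclideanHausdorffMeasure_sphere (hn : 1 ≤ n)
    (F : sphere (0 : EuclideanSpace ℝ (Fin (n + 1))) 1 → ℂ) :
    ∫ x, F x ∂μHE[n] = ∫ y : EuclideanSpace ℝ (Fin n),
      (((2 / (1 + ‖y‖ ^ 2)) ^ n : ℝ) : ℂ) * F (stereoSphere y) := by
  have hae : ∀ᵐ x ∂(μHE[n] : Measure (sphere (0 : EuclideanSpace ℝ (Fin (n + 1))) 1)),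
      x ∈ range (stereoSphere (n := n)) :=
    euclideanHausdorffMeasure_compl_range_stereoSphere hn
  rw [← Measure.restrict_eq_self_of_ae_mem hae, setIntegral_range_euclideanHausdorffMeasure
    measurableEmbedding_stereoSphere continuous_stereoFactor.measurable stereoFactor_pos
    edist_stereoSphere, EuclideanSpace.euclideanHausdorffMeasure_eq_volume]
  simp_rw [stereoFactor_pow]

/-! ### Integrals of functions of the latitude, and the total mass of the sphere. -/

theorem image_stereoLatitude :
    (fun r : ℝ => (-1 + r ^ 2) / (1 + r ^ 2)) '' Ioi 0 = Ioo (-1) 1 := by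
  ext τ
  constructor
  · rintro ⟨r, hr, rfl⟩
    have : 0 < r := hr
    constructor
    · rw [lt_div_iff₀ (by positivity)]; nlinarith
    · rw [div_lt_iff₀ (by positivity)]; nlinarith
  · rintro ⟨h1, h2⟩
    have h3 : 0 < (1 + τ) / (1 - τ) := div_pos (by linarith) (by linarith)
    refine ⟨√((1 + τ) / (1 - τ)), Real.sqrt_pos.2 h3, ?_⟩
    have : 1 - τ ≠ 0 := by linarith
    simp only [Real.sq_sqrt h3.le]
    rw [div_eq_iff (by positivity)]
    field_simp
    ring

theorem hasDerivAt_stereoLatitude (r : ℝ) :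
    HasDerivAt (fun r : ℝ => (-1 + r ^ 2) / (1 + r ^ 2)) (4 * r / (1 + r ^ 2) ^ 2) r := by
  have hne : 1 + r ^ 2 ≠ 0 := by positivity
  have hp : HasDerivAt (fun r : ℝ => r ^ 2) (2 * r) r := by simpa using hasDerivAt_pow 2 r
  refine ((hp.const_add (-1)).div (hp.const_add 1) hne).congr_deriv ?_
  field_simp
  ring

theorem injOn_stereoLatitude : InjOn (fun r : ℝ => (-1 + r ^ 2) / (1 + r ^ 2)) (Ioi 0) := by
  intro x hx y hy h
  have hx' : 0 < x := hx
  have hy' : 0 < y := hy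
  simp only at h
  rw [div_eq_div_iff (by positivity) (by positivity)] at h
  have : x ^ 2 = y ^ 2 := by linarith
  exact (sq_eq_sq₀ hx'.le hy'.le).1 this

/-- With A = 2r/(1+r²) and τ the latitude, 1 - τ² = A² and dτ = A² dr/r. So the left side is A^n/r,
which is the polar Jacobian r^(n-1) times the stereographic density. -/
theorem stereoLatitude_weight (hn : 1 ≤ n) {r : ℝ} (hr : 0 < r) :
    |4 * r / (1 + r ^ 2) ^ 2| * (1 - ((-1 + r ^ 2) / (1 + r ^ 2)) ^ 2) ^ (((n : ℝ) - 2) / 2) =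
      r ^ (n - 1) * (2 / (1 + r ^ 2)) ^ n := by
  have hne : 1 + r ^ 2 ≠ 0 := by positivity
  set A := 2 * r / (1 + r ^ 2) with hA
  have hA0 : 0 < A := by positivity
  have e1 : 1 - ((-1 + r ^ 2) / (1 + r ^ 2)) ^ 2 = A ^ (2 : ℝ) := by
    rw [Real.rpow_two, hA]; field_simp; ring
  have e2 : |4 * r / (1 + r ^ 2) ^ 2| = A ^ (2 : ℝ) * r⁻¹ := by
    rw [abs_of_pos (by positivity), Real.rpow_two, hA]; field_simp; ring
  rw [e1, e2, ← Real.rpow_mul hA0.le, mul_right_comm, ← Real.rpow_add hA0,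
    show (2 : ℝ) + 2 * (((n : ℝ) - 2) / 2) = n by ring, Real.rpow_natCast, hA,
    show 2 * r / (1 + r ^ 2) = 2 / (1 + r ^ 2) * r by ring, mul_pow, mul_assoc]
  have : r ^ n * r⁻¹ = r ^ (n - 1) := by
    obtain ⟨k, rfl⟩ := Nat.exists_eq_add_of_le' hn
    rw [pow_succ, Nat.add_sub_cancel]
    field_simp
  rw [this, mul_comm]

theorem natCast_mul_volume_ball (hn : 1 ≤ n) :
    (n : ℝ) * (volume : Measure (EuclideanSpace ℝ (Fin n))).real (ball 0 1) =
      sphereVolume (n - 1) := by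
  have : Nonempty (Fin n) := ⟨⟨0, hn⟩⟩
  have hn' : (0 : ℝ) < n := by exact_mod_cast hn
  have hG : 0 < Real.Gamma ((n : ℝ) / 2) := Real.Gamma_pos_of_pos (by positivity)
  rw [Measure.real, EuclideanSpace.volume_ball, sphereVolume, Nat.cast_sub hn]
  simp only [Fintype.card_fin, ENNReal.ofReal_one, one_pow, one_mul, Nat.cast_one, sub_add_cancel]
  rw [Real.Gamma_add_one (by positivity), ENNReal.toReal_ofReal (by positivity),
    Real.sqrt_eq_rpow, ← Real.rpow_natCast, ← Real.rpow_mul Real.pi_pos.le]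
  rw [show (1 / 2 : ℝ) * n = n / 2 by ring]
  field_simp

theorem neg_half_lt (hn : 1 ≤ n) : -(1 / 2) < ((n : ℝ) - 1) / 2 := by
  have : (1 : ℝ) ≤ n := by exact_mod_cast hn
  linarith

theorem integrableOn_weight (hn : 1 ≤ n) :
    IntegrableOn (fun τ : ℝ => (1 - τ ^ 2) ^ (((n : ℝ) - 2) / 2)) (Ioo (-1) 1) := by
  have hw := gegenbauer_weight_integrable (neg_half_lt hn) 1
  rw [intervalIntegrable_iff_integrableOn_Ioo_of_le (by norm_num)] at hw
  refine hw.congr_fun (fun τ _ => ?_) measurableSet_Ioo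
  simp only [eval_one, one_mul]
  rw [show ((n : ℝ) - 1) / 2 - 1 / 2 = ((n : ℝ) - 2) / 2 by ring]

theorem integrable_stereoFactor (hn : 1 ≤ n) :
    Integrable fun y : EuclideanSpace ℝ (Fin n) => (2 / (1 + ‖y‖ ^ 2)) ^ n := by
  have : Nonempty (Fin n) := ⟨⟨0, hn⟩⟩
  rw [integrable_fun_norm_addHaar (volume : Measure (EuclideanSpace ℝ (Fin n)))
    (f := fun r : ℝ => (2 / (1 + r ^ 2)) ^ n), finrank_euclideanSpace_fin]
  have hw := integrableOn_weight hn
  rw [← image_stereoLatitude, integrableOn_image_iff_integrableOn_abs_deriv_smul measurableSet_Ioi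
    (fun r _ => (hasDerivAt_stereoLatitude r).hasDerivWithinAt) injOn_stereoLatitude] at hw
  refine hw.congr_fun (fun r hr => ?_) measurableSet_Ioi
  simp only [smul_eq_mul]
  exact stereoLatitude_weight hn hr

theorem integral_latitude_euclideanHausdorffMeasure (hn : 1 ≤ n) (φ : ℝ → ℂ) :
    ∫ x : sphere (0 : EuclideanSpace ℝ (Fin (n + 1))) 1,
      φ ((x : EuclideanSpace ℝ (Fin (n + 1))) (Fin.last n)) ∂μHE[n] =
    (sphereVolume (n - 1) : ℂ) * ∫ τ in Ioo (-1 : ℝ) 1,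
      (((1 - τ ^ 2) ^ (((n : ℝ) - 2) / 2) : ℝ) : ℂ) * φ τ := by
  have : Nonempty (Fin n) := ⟨⟨0, hn⟩⟩
  rw [integral_euclideanHausdorffMeasure_sphere hn]
  have h1 : ∀ y : EuclideanSpace ℝ (Fin n),
      (((2 / (1 + ‖y‖ ^ 2)) ^ n : ℝ) : ℂ) * φ ((stereoSphere y : EuclideanSpace ℝ (Fin (n + 1)))
        (Fin.last n)) = (fun r : ℝ => (((2 / (1 + r ^ 2)) ^ n : ℝ) : ℂ) *
        φ ((-1 + r ^ 2) / (1 + r ^ 2))) ‖y‖ := by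
    intro y
    simp only [stereoSphere, stereoInv_last]
  rw [integral_congr_ae (.of_forall h1), integral_fun_norm_addHaar volume
    (fun r : ℝ => (((2 / (1 + r ^ 2)) ^ n : ℝ) : ℂ) * φ ((-1 + r ^ 2) / (1 + r ^ 2))),
    finrank_euclideanSpace_fin, ← image_stereoLatitude,
    integral_image_eq_integral_abs_deriv_smul measurableSet_Ioi
    (fun r _ => (hasDerivAt_stereoLatitude r).hasDerivWithinAt) injOn_stereoLatitude,
    ← natCast_mul_volume_ball hn, nsmul_eq_mul, Complex.real_smul, Complex.ofReal_mul,
    Complex.ofReal_natCast, mul_assoc]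
  congr 2
  refine setIntegral_congr_fun measurableSet_Ioi fun r hr => ?_
  rw [Complex.real_smul, Complex.real_smul, ← mul_assoc, ← mul_assoc, ← Complex.ofReal_mul,
    ← Complex.ofReal_mul, stereoLatitude_weight hn hr]

/-- The weight integral is 2^(n-1) Γ(n/2)²/Γ(n); Legendre's duplication formula at n/2 then gives
the claim. -/
theorem sphereVolume_mul_integral_weight (hn : 1 ≤ n) :
    sphereVolume (n - 1) * ∫ τ in Ioo (-1 : ℝ) 1, (1 - τ ^ 2) ^ (((n : ℝ) - 2) / 2) =
      sphereVolume n := by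
  have hn' : (0 : ℝ) < n := by exact_mod_cast hn
  have h := gegenbauer_weight_integral (neg_half_lt hn)
  rw [intervalIntegral.integral_of_le (by norm_num), integral_Ioc_eq_integral_Ioo] at h
  rw [show ((n : ℝ) - 2) / 2 = ((n : ℝ) - 1) / 2 - 1 / 2 by ring, h,
    show 2 * (((n : ℝ) - 1) / 2) = n - 1 by ring, show ((n : ℝ) - 1) / 2 + 1 / 2 = n / 2 by ring,
    sub_add_cancel, sphereVolume, sphereVolume, Nat.cast_sub hn, Nat.cast_one, sub_add_cancel]
  have hdup := Real.Gamma_mul_Gamma_add_half ((n : ℝ) / 2)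
  rw [show 2 * ((n : ℝ) / 2) = n by ring, show (n : ℝ) / 2 + 1 / 2 = (n + 1) / 2 by ring] at hdup
  have g1 : 0 < Real.Gamma ((n : ℝ) / 2) := Real.Gamma_pos_of_pos (by positivity)
  have g2 : 0 < Real.Gamma (n : ℝ) := Real.Gamma_pos_of_pos hn'
  have g3 : 0 < Real.Gamma (((n : ℝ) + 1) / 2) := Real.Gamma_pos_of_pos (by positivity)
  have e1 : Real.pi ^ (((n : ℝ) + 1) / 2) = Real.pi ^ ((n : ℝ) / 2) * √Real.pi := by
    rw [Real.sqrt_eq_rpow, ← Real.rpow_add Real.pi_pos]; congr 1; ring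
  have e2 : (2 : ℝ) ^ ((n : ℝ) - 1) * 2 ^ (1 - (n : ℝ)) = 1 := by
    rw [← Real.rpow_add two_pos]; simp
  rw [e1]
  field_simp
  linear_combination (2 : ℝ) ^ ((n : ℝ) - 1) * hdup +
    Real.Gamma n * √Real.pi * e2

theorem isFiniteMeasure_euclideanHausdorffMeasure_sphere (hn : 1 ≤ n) :
    IsFiniteMeasure (μHE[n] : Measure (sphere (0 : EuclideanSpace ℝ (Fin (n + 1))) 1)) := by
  refine ⟨?_⟩
  have h0 := euclideanHausdorffMeasure_compl_range_stereoSphere hn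
  have h1 : (μHE[n] : Measure (sphere (0 : EuclideanSpace ℝ (Fin (n + 1))) 1)) univ =
      μHE[n] (range (stereoSphere (n := n))) :=
    measure_congr (ae_eq_univ.2 h0).symm
  rw [h1, ← image_univ, ← measurableEmbedding_stereoSphere.comap_apply,
    comap_euclideanHausdorffMeasure_of_edist measurableEmbedding_stereoSphere
      continuous_stereoFactor.measurable stereoFactor_pos edist_stereoSphere,
    withDensity_apply _ MeasurableSet.univ, Measure.restrict_univ,
    EuclideanSpace.euclideanHausdorffMeasure_eq_volume]
  have hi := (integrable_stereoFactor hn).lintegral_lt_top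
  refine lt_of_le_of_lt (lintegral_mono fun y => ?_) hi
  rw [← stereoFactor_pow, ← NNReal.coe_pow, ENNReal.ofReal_coe_nnreal]

/-- The Hausdorff measure of the unit sphere is its surface measure. -/
theorem euclideanHausdorffMeasure_sphere (hn : 1 ≤ n) :
    (μHE[n] : Measure (sphere (0 : EuclideanSpace ℝ (Fin (n + 1))) 1)) =
      (volume : Measure (EuclideanSpace ℝ (Fin (n + 1)))).toSphere := by
  have := isFiniteMeasure_euclideanHausdorffMeasure_sphere hn
  -- Both measures are finite and rotation invariant, so it is enough to compare total masses; the
  -- latitude formula with the constant function 1 yields that of the Hausdorff measure.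
  refine eq_of_isRotationInvariant (isRotationInvariant_euclideanHausdorffMeasure n)
    isRotationInvariant_toSphere ?_
  rw [Measure.toSphere_real_apply_univ, finrank_euclideanSpace_fin,
    natCast_mul_volume_ball (by omega),
    Nat.add_sub_cancel, ← sphereVolume_mul_integral_weight hn]
  have h := integral_latitude_euclideanHausdorffMeasure hn (fun _ => 1)
  simp only [integral_const, mul_one, Complex.real_smul] at h
  rw [integral_complex_ofReal, ← Complex.ofReal_mul] at h
  exact_mod_cast h

theorem integral_latitude_toSphere (hn : 1 ≤ n) (φ : ℝ → ℂ) :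
    ∫ x : sphere (0 : EuclideanSpace ℝ (Fin (n + 1))) 1,
      φ ((x : EuclideanSpace ℝ (Fin (n + 1))) (Fin.last n))
        ∂(volume : Measure (EuclideanSpace ℝ (Fin (n + 1)))).toSphere =
    (sphereVolume (n - 1) : ℂ) * ∫ τ in Ioo (-1 : ℝ) 1,
      (((1 - τ ^ 2) ^ (((n : ℝ) - 2) / 2) : ℝ) : ℂ) * φ τ := by
  rw [← euclideanHausdorffMeasure_sphere hn, integral_latitude_euclideanHausdorffMeasure hn]

end SphereMeasure

/-! ### Linear substitutions in polynomials -/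

section Substitution

variable {d : ℕ}

/-- The value of a polynomial at a point of `ℝ^d`, as a linear functional. -/
noncomputable def evalAt (x : EuclideanSpace ℝ (Fin d)) : MvPolynomial (Fin d) ℂ →ₐ[ℂ] ℂ :=
  MvPolynomial.aeval fun i => ((x i : ℝ) : ℂ)

theorem evalAt_X (x : EuclideanSpace ℝ (Fin d)) (i : Fin d) :
    evalAt x (MvPolynomial.X i) = ((x i : ℝ) : ℂ) := by
  simp [evalAt]

theorem continuous_evalAt (P : MvPolynomial (Fin d) ℂ) : Continuous fun x => evalAt x P := by
  have : (fun x : EuclideanSpace ℝ (Fin d) => evalAt x P) = fun x =>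
      MvPolynomial.eval (fun i => ((x i : ℝ) : ℂ)) P := by
    ext x
    simp [evalAt, MvPolynomial.aeval_eq_eval]
  rw [this]
  exact (MvPolynomial.continuous_eval P).comp (by fun_prop)

theorem evalAt_smul {P : MvPolynomial (Fin d) ℂ} {m : ℕ} (hP : P.IsHomogeneous m) (c : ℝ)
    (x : EuclideanSpace ℝ (Fin d)) : evalAt (c • x) P = (c : ℂ) ^ m * evalAt x P := by
  simp only [evalAt, MvPolynomial.aeval_def, MvPolynomial.eval₂_eq', Finset.mul_sum]
  refine Finset.sum_congr rfl fun α hα => ?_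
  have hdeg : ∑ i, α i = m := by
    have := hP (MvPolynomial.mem_support_iff.1 hα)
    rw [Finsupp.weight_apply, Finsupp.sum_fintype _ _ (by simp)] at this
    simpa using this
  simp only [PiLp.smul_apply, smul_eq_mul, Complex.ofReal_mul, mul_pow, Finset.prod_mul_distrib,
    Finset.prod_pow_eq_pow_sum, hdeg]
  ring

theorem eq_zero_of_forall_evalAt_eq_zero {P : MvPolynomial (Fin d) ℂ}
    (h : ∀ x, evalAt x P = 0) : P = 0 := by
  refine MvPolynomial.funext_set (fun _ => range ((↑) : ℝ → ℂ))
    (fun _ => infinite_range_of_injective Complex.ofReal_injective) fun x hx => ?_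
  choose y hy using fun i => hx i (mem_univ i)
  have := h (WithLp.toLp 2 y)
  simp only [evalAt, MvPolynomial.aeval_eq_eval, hy] at this
  simpa using this

/-- The substitution of the linear forms given by the rows of `A` for the variables. -/
noncomputable def linSubst (A : EuclideanSpace ℝ (Fin d) →L[ℝ] EuclideanSpace ℝ (Fin d)) :
    MvPolynomial (Fin d) ℂ →ₐ[ℂ] MvPolynomial (Fin d) ℂ :=
  MvPolynomial.aeval fun i => ∑ j,
    MvPolynomial.C ((A (EuclideanSpace.single j 1) i : ℝ) : ℂ) * MvPolynomial.X j

theorem linSubst_X (A : EuclideanSpace ℝ (Fin d) →L[ℝ] EuclideanSpace ℝ (Fin d)) (i : Fin d) :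
    linSubst A (MvPolynomial.X i) = ∑ j,
      MvPolynomial.C ((A (EuclideanSpace.single j 1) i : ℝ) : ℂ) * MvPolynomial.X j := by
  simp [linSubst]

theorem map_apply_eq_sum (A : EuclideanSpace ℝ (Fin d) →L[ℝ] EuclideanSpace ℝ (Fin d))
    (x : EuclideanSpace ℝ (Fin d)) (i : Fin d) :
    A x i = ∑ j, A (EuclideanSpace.single j 1) i * x j := by
  have hx : x = ∑ j, x j • EuclideanSpace.single j (1 : ℝ) := by
    ext k
    simp [Finset.sum_apply, Pi.single_apply]
  conv_lhs => rw [hx]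
  simp [mul_comm]

theorem evalAt_linSubst (A : EuclideanSpace ℝ (Fin d) →L[ℝ] EuclideanSpace ℝ (Fin d))
    (x : EuclideanSpace ℝ (Fin d)) (P : MvPolynomial (Fin d) ℂ) :
    evalAt x (linSubst A P) = evalAt (A x) P := by
  have : (evalAt x).comp (linSubst A) = evalAt (A x) := by
    refine MvPolynomial.algHom_ext fun i => ?_
    rw [AlgHom.comp_apply, linSubst_X, evalAt_X, map_apply_eq_sum]
    simp [evalAt]
  exact DFunLike.congr_fun this P

theorem isHomogeneous_linSubst (A : EuclideanSpace ℝ (Fin d) →L[ℝ] EuclideanSpace ℝ (Fin d))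
    {P : MvPolynomial (Fin d) ℂ} {m : ℕ} (hP : P.IsHomogeneous m) :
    (linSubst A P).IsHomogeneous m := by
  have := hP.aeval (fun i => ∑ j,
    MvPolynomial.C ((A (EuclideanSpace.single j 1) i : ℝ) : ℂ) * MvPolynomial.X j) (n := 1)
    fun i => MvPolynomial.IsHomogeneous.sum _ _ _ fun j _ => MvPolynomial.isHomogeneous_C_mul_X _ _
  rwa [one_mul] at this

theorem pderiv_linSubst (A : EuclideanSpace ℝ (Fin d) →L[ℝ] EuclideanSpace ℝ (Fin d))
    (k : Fin d) (P : MvPolynomial (Fin d) ℂ) :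
    MvPolynomial.pderiv k (linSubst A P) = ∑ i,
      MvPolynomial.C ((A (EuclideanSpace.single k 1) i : ℝ) : ℂ) *
        linSubst A (MvPolynomial.pderiv i P) := by
  induction P using MvPolynomial.induction_on with
  | C a => simp [linSubst]
  | add p q hp hq => simp only [map_add, hp, hq, mul_add, Finset.sum_add_distrib]
  | mul_X p i hp =>
    rw [map_mul, Derivation.leibniz, hp, linSubst_X]
    simp only [Derivation.leibniz, map_add, smul_eq_mul, map_mul, mul_add, map_sum,
      MvPolynomial.pderiv_C, MvPolynomial.pderiv_X, mul_zero, add_zero, linSubst_X,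
      Finset.sum_add_distrib]
    congr 1
    · simp [Pi.single_apply, mul_comm]
    · rw [Finset.mul_sum]
      exact Finset.sum_congr rfl fun j _ => by ring

theorem polyLaplacian_apply (P : MvPolynomial (Fin d) ℂ) :
    polyLaplacian d P = ∑ i, MvPolynomial.pderiv i (MvPolynomial.pderiv i P) := by
  simp [polyLaplacian, LinearMap.sum_apply]

/-- Read off from R R* = 1: the rows of an orthogonal matrix are orthonormal. This is what makes the
Laplacian commute with rotations. -/
theorem sum_map_single_mul (R : OrthGroup d) (i j : Fin d) :
    ∑ k, R.1 (EuclideanSpace.single k 1) i *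
      R.1 (EuclideanSpace.single k 1) j =
      if i = j then 1 else 0 := by
  have hadj : ∀ k i : Fin d, R.1 (EuclideanSpace.single k 1) i =
      (star (R : EuclideanSpace ℝ (Fin d) →L[ℝ] EuclideanSpace ℝ (Fin d)))
        (EuclideanSpace.single i 1) k := by
    intro k i
    have := ContinuousLinearMap.adjoint_inner_right
      (R : EuclideanSpace ℝ (Fin d) →L[ℝ] EuclideanSpace ℝ (Fin d))
      (EuclideanSpace.single k 1) (EuclideanSpace.single i 1)
    rw [EuclideanSpace.inner_single_left, EuclideanSpace.inner_single_right] at this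
    simpa [ContinuousLinearMap.star_eq_adjoint] using this.symm
  have h1 : (R : EuclideanSpace ℝ (Fin d) →L[ℝ] EuclideanSpace ℝ (Fin d))
      ((star (R : EuclideanSpace ℝ (Fin d) →L[ℝ] EuclideanSpace ℝ (Fin d)))
        (EuclideanSpace.single j 1)) = EuclideanSpace.single j 1 := by
    have := DFunLike.congr_fun (Unitary.mul_star_self_of_mem R.2) (EuclideanSpace.single j (1 : ℝ))
    exact this
  have h2 := map_apply_eq_sum (R : EuclideanSpace ℝ (Fin d) →L[ℝ] EuclideanSpace ℝ (Fin d))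
    ((star (R : EuclideanSpace ℝ (Fin d) →L[ℝ] EuclideanSpace ℝ (Fin d)))
        (EuclideanSpace.single j 1)) i
  rw [h1] at h2
  simp_rw [hadj _ j]
  rw [← h2]
  simp

theorem polyLaplacian_linSubst (R : OrthGroup d) (P : MvPolynomial (Fin d) ℂ) :
    polyLaplacian d (linSubst R P) = linSubst R (polyLaplacian d P) := by
  simp only [polyLaplacian_apply, pderiv_linSubst, map_sum, Derivation.leibniz, smul_eq_mul,
    MvPolynomial.pderiv_C, mul_zero, add_zero]
  have h : ∀ i j, ∑ k, MvPolynomial.C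
        ((R.1 (EuclideanSpace.single k 1) i : ℝ) : ℂ) *
        (MvPolynomial.C
        ((R.1 (EuclideanSpace.single k 1) j : ℝ) : ℂ) *
        linSubst R (MvPolynomial.pderiv j (MvPolynomial.pderiv i P))) =
      if i = j then linSubst R (MvPolynomial.pderiv j (MvPolynomial.pderiv i P)) else 0 := by
    intro i j
    simp_rw [← mul_assoc, ← Finset.sum_mul, ← map_mul, ← map_sum, ← Complex.ofReal_mul,
      ← Complex.ofReal_sum, sum_map_single_mul]
    split_ifs <;> simp
  simp_rw [Finset.mul_sum]
  rw [Finset.sum_comm]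
  refine Finset.sum_congr rfl fun i _ => ?_
  rw [Finset.sum_comm]
  simp_rw [h]
  simp

theorem continuous_coeff_linSubst {K : Type*} [TopologicalSpace K]
    {A : K → EuclideanSpace ℝ (Fin d) →L[ℝ] EuclideanSpace ℝ (Fin d)} (hA : Continuous A)
    (P : MvPolynomial (Fin d) ℂ) (α : Fin d →₀ ℕ) :
    Continuous fun R => (linSubst (A R) P).coeff α := by
  induction P using MvPolynomial.induction_on generalizing α with
  | C a => simpa [linSubst] using continuous_const
  | add p q hp hq => simpa using! (hp α).add (hq α)
  | mul_X p i hp =>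
    simp only [map_mul, linSubst_X]
    simp_rw [MvPolynomial.coeff_mul (linSubst (A _) p), MvPolynomial.coeff_sum,
      MvPolynomial.coeff_C_mul]
    refine continuous_finsetSum _ fun β _ => (hp β.1).mul ?_
    refine continuous_finsetSum _ fun j _ => Continuous.mul ?_ continuous_const
    have : Continuous fun R => A R (EuclideanSpace.single j 1) :=
      hA.clm_apply continuous_const
    fun_prop

end Substitution

/-! ### Averages of polynomials -/

section Average

variable {d : ℕ} {K : Type*} [TopologicalSpace K] [CompactSpace K] [MeasurableSpace K]
  [BorelSpace K]

theorem linearMap_eq_sum_coeff {P : MvPolynomial (Fin d) ℂ} {m : ℕ} (hP : P.IsHomogeneous m)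
    (L : MvPolynomial (Fin d) ℂ →ₗ[ℂ] ℂ) :
    L P = ∑ α ∈ Finset.univ.finsuppAntidiag m, P.coeff α * L (MvPolynomial.monomial α 1) := by
  conv_lhs => rw [P.as_sum, map_sum]
  refine (Finset.sum_congr rfl fun α _ => ?_).trans (Finset.sum_subset (fun α hα => ?_)
    fun α _ hα => ?_)
  · rw [← smul_eq_mul, ← map_smul, MvPolynomial.smul_monomial, smul_eq_mul, mul_one]
  · have := hP (MvPolynomial.mem_support_iff.1 hα)
    rw [Finsupp.weight_apply, Finsupp.sum_fintype _ _ (by simp)] at this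
    simpa using this
  · rw [MvPolynomial.notMem_support_iff.1 hα, zero_mul]

/-- Averaging the coefficients gives a polynomial again, and every linear functional passes under
the integral because only the finitely many monomials of degree m occur. Applied with evaluations
and with coefficients of the Laplacian. -/
theorem exists_isHomogeneous_average (μ : Measure K) [IsFiniteMeasure μ] {m : ℕ}
    {Q : K → MvPolynomial (Fin d) ℂ}
    (hQ : ∀ R, (Q R).IsHomogeneous m) (hc : ∀ α, Continuous fun R => (Q R).coeff α)
    {G : K → ℂ} (hG : Continuous G) :
    ∃ W : MvPolynomial (Fin d) ℂ, W.IsHomogeneous m ∧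
      ∀ L : MvPolynomial (Fin d) ℂ →ₗ[ℂ] ℂ, L W = ∫ R, G R * L (Q R) ∂μ := by
  classical
  refine ⟨∑ α ∈ Finset.univ.finsuppAntidiag m,
    MvPolynomial.monomial α (∫ R, G R * (Q R).coeff α ∂μ), ?_, fun L => ?_⟩
  · refine MvPolynomial.IsHomogeneous.sum _ _ _ fun α hα =>
      MvPolynomial.isHomogeneous_monomial _ ?_
    rw [Finset.mem_finsuppAntidiag] at hα
    rw [Finsupp.degree_eq_sum]
    exact hα.1
  · rw [map_sum]
    simp_rw [fun R => linearMap_eq_sum_coeff (hQ R) L, Finset.mul_sum]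
    rw [integral_finsetSum]
    · refine Finset.sum_congr rfl fun α _ => ?_
      simp_rw [← mul_assoc]
      rw [integral_mul_const, ← smul_eq_mul, ← map_smul, MvPolynomial.smul_monomial, smul_eq_mul,
        mul_one]
    · intro α _
      exact ((hG.mul ((hc α).mul continuous_const)).integrable_of_hasCompactSupport
        (HasCompactSupport.of_compactSpace _))

end Average

/-! ### Uniqueness for the Gegenbauer equation -/

section Uniqueness

/-- The point 1 is a regular singular point. If u = (X-1)^(n+1) w with w(1) ≠ 0, the lowest-order
coefficient of the equation at 1 is -(n+1)(2n+a) w(1), which is nonzero as Re a > 0. Hence a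
polynomial solution is determined by its value at 1. -/
theorem eq_zero_of_gegenbauer_ode {a b : ℂ} (ha : 0 < a.re) {u : ℂ[X]}
    (hode : (1 - X ^ 2) * derivative (derivative u) - C a * X * derivative u + C b * u = 0)
    (h1 : u.eval 1 = 0) : u = 0 := by
  by_contra hu
  obtain ⟨w, hw, hnd⟩ := exists_eq_pow_rootMultiplicity_mul_and_not_dvd u hu 1
  obtain ⟨n, hn⟩ : ∃ n, u.rootMultiplicity 1 = n + 1 :=
    Nat.exists_eq_succ_of_ne_zero ((rootMultiplicity_pos hu).2 h1).ne'
  rw [hn] at hw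
  have hw1 : w.eval 1 ≠ 0 := fun h => hnd (dvd_iff_isRoot.2 h)
  have hXn : (X - C (1 : ℂ)) ^ n ≠ 0 := pow_ne_zero _ (X_sub_C_ne_zero 1)
  have key : (X - C (1 : ℂ)) ^ n *
      (-(X + 1) * (((n : ℂ[X]) + 1) * (n : ℂ[X]) * w + 2 * ((n : ℂ[X]) + 1) * (X - C 1) *
      derivative w + (X - C 1) ^ 2 * derivative (derivative w)) - C a * X * (((n : ℂ[X]) + 1) * w +
      (X - C 1) * derivative w) + C b * (X - C 1) * w) = 0 := by
    rw [← hode, hw]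
    rcases n with _ | n
    · simp
      ring
    · simp only [derivative_mul, derivative_pow, derivative_sub, derivative_X, derivative_add,
        derivative_natCast, Nat.add_sub_cancel, C_1, derivative_one, sub_zero,
        mul_one, Nat.cast_add, Nat.cast_one, C_add, map_natCast]
      ring
  have h0 := congrArg (eval 1) ((mul_eq_zero.1 key).resolve_left hXn)
  simp at h0
  have hfac : (n + 1 : ℂ) * (2 * n + a) * w.eval 1 = 0 := by linear_combination -h0
  rcases mul_eq_zero.1 hfac with h | h
  · rcases mul_eq_zero.1 h with h | h
    · exact n.cast_add_one_ne_zero h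
    · have := congrArg Complex.re h
      have hn0 : (0 : ℝ) ≤ n := n.cast_nonneg
      simp at this
      linarith
  · exact hw1 h

theorem eq_gegenbauer_of_ode {ν : ℝ} (hν : -(1 / 2) < ν) (m : ℕ) {v : ℂ[X]}
    (hode : (1 - X ^ 2) * derivative (derivative v) - C ((2 * ν + 1 : ℝ) : ℂ) * X * derivative v +
      C ((m * (m + 2 * ν) : ℝ) : ℂ) * v = 0) :
    v = C (v.eval 1) * (gegenbauer ν m).map (algebraMap ℝ ℂ) := by
  rw [← sub_eq_zero]
  refine eq_zero_of_gegenbauer_ode (a := ((2 * ν + 1 : ℝ) : ℂ))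
    (b := ((m * (m + 2 * ν) : ℝ) : ℂ)) (by rw [Complex.ofReal_re]; linarith) ?_ ?_
  · have h := congrArg (Polynomial.map (algebraMap ℝ ℂ)) (gegenbauer_ode hν m)
    simp only [Polynomial.map_mul, Polynomial.map_sub, Polynomial.map_add, Polynomial.map_neg,
      Polynomial.map_one, Polynomial.map_pow, map_X, map_C, Polynomial.map_natCast,
      Polynomial.map_ofNat, ← derivative_map, Complex.coe_algebraMap] at h
    simp only [derivative_sub, derivative_mul, derivative_C, zero_mul, zero_add]
    push_cast at hode ⊢
    simp only [C_add, C_mul, map_natCast, map_ofNat, C_1] at hode h ⊢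
    linear_combination hode - C (v.eval 1) * h
  · rw [eval_sub, eval_mul, eval_C, eval_map_algebraMap, ← map_one (algebraMap ℝ ℂ),
      aeval_algebraMap_apply, Polynomial.coe_aeval_eq_eval, gegenbauer_eval_one hν]
    simp

end Uniqueness

/-! ### Zonal harmonic polynomials -/

section Zonal

variable {n : ℕ}

/-- The squared distance to the first coordinate axis. -/
noncomputable def axisDistSq (n : ℕ) : MvPolynomial (Fin (n + 2)) ℂ :=
  ∑ i : Fin (n + 1), MvPolynomial.X i.succ ^ 2

theorem pderiv_zero_axisDistSq : MvPolynomial.pderiv 0 (axisDistSq n) = 0 := by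
  simp [axisDistSq, Derivation.leibniz_pow, MvPolynomial.pderiv_X]

theorem pderiv_succ_axisDistSq (i : Fin (n + 1)) :
    MvPolynomial.pderiv i.succ (axisDistSq n) = 2 * MvPolynomial.X i.succ := by
  simp [axisDistSq, Derivation.leibniz_pow, MvPolynomial.pderiv_X, Pi.single_apply]

/-- The truncated subtractions are harmless: the coefficient k(k-1) vanishes for k ≤ 1, and the
factor j vanishes for j = 0. -/
theorem polyLaplacian_zonal (k j : ℕ) :
    polyLaplacian (n + 2) (MvPolynomial.X 0 ^ k * axisDistSq n ^ j) =
      ((k * (k - 1) : ℕ) : MvPolynomial (Fin (n + 2)) ℂ) *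
        (MvPolynomial.X 0 ^ (k - 2) * axisDistSq n ^ j) +
      ((2 * j * (2 * (j - 1) + n + 1) : ℕ) : MvPolynomial (Fin (n + 2)) ℂ) *
        (MvPolynomial.X 0 ^ k * axisDistSq n ^ (j - 1)) := by
  have h0 : MvPolynomial.pderiv 0 (MvPolynomial.pderiv 0 (MvPolynomial.X 0 ^ k *
      axisDistSq n ^ j)) = ((k * (k - 1) : ℕ) : MvPolynomial (Fin (n + 2)) ℂ) *
      (MvPolynomial.X 0 ^ (k - 2) * axisDistSq n ^ j) := by
    simp only [Derivation.leibniz, Derivation.leibniz_pow, pderiv_zero_axisDistSq, smul_zero,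
      MvPolynomial.pderiv_X_self, smul_eq_mul, mul_zero, zero_add, mul_one, nsmul_eq_mul,
      Derivation.map_natCast, Nat.sub_sub, add_zero]
    push_cast
    ring
  have hs : ∀ i : Fin (n + 1), MvPolynomial.pderiv i.succ (MvPolynomial.pderiv i.succ
      (MvPolynomial.X 0 ^ k * axisDistSq n ^ j)) =
      ((4 * j * (j - 1) : ℕ) : MvPolynomial (Fin (n + 2)) ℂ) *
        (MvPolynomial.X 0 ^ k * axisDistSq n ^ (j - 2) * MvPolynomial.X i.succ ^ 2) +
      ((2 * j : ℕ) : MvPolynomial (Fin (n + 2)) ℂ) *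
        (MvPolynomial.X 0 ^ k * axisDistSq n ^ (j - 1)) := by
    intro i
    have hX : MvPolynomial.pderiv i.succ (MvPolynomial.X 0 : MvPolynomial (Fin (n + 2)) ℂ) = 0 :=
      MvPolynomial.pderiv_X_of_ne (Fin.succ_ne_zero i).symm
    have h2 : MvPolynomial.pderiv i.succ (2 : MvPolynomial (Fin (n + 2)) ℂ) = 0 :=
      Derivation.map_natCast _ 2
    simp only [Derivation.leibniz, Derivation.leibniz_pow, pderiv_succ_axisDistSq, smul_zero, hX,
      MvPolynomial.pderiv_X_self, smul_eq_mul, mul_zero, mul_one, nsmul_eq_mul,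
      Derivation.map_natCast, Nat.sub_sub, add_zero, h2]
    push_cast
    ring
  rw [polyLaplacian_apply, Fin.sum_univ_succ, h0]
  congr 1
  rw [Finset.sum_congr rfl fun i _ => hs i, Finset.sum_add_distrib, ← Finset.mul_sum,
    ← Finset.mul_sum]
  change _ * (_ * axisDistSq n) + _ = _
  rw [Finset.sum_const, Finset.card_univ, Fintype.card_fin, nsmul_eq_mul]
  rcases j with _ | _ | j
  · simp
  · simp; ring
  · simp only [Nat.add_sub_cancel, Nat.reduceSubDiff]
    push_cast
    ring

/-- The right side is that of `polyLaplacian_zonal` with X for the first coordinate and 1 - X² for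
`axisDistSq`. So on the unit sphere the Laplacian of a zonal polynomial of degree k + 2j acts as the
Gegenbauer operator on its profile. -/
theorem derivative_zonal (k j : ℕ) :
    (1 - X ^ 2) * derivative (derivative (X ^ k * (1 - X ^ 2) ^ j)) -
      ((n : ℂ[X]) + 1) * X * derivative (X ^ k * (1 - X ^ 2) ^ j) +
      ((k : ℂ[X]) + 2 * (j : ℂ[X])) * ((k : ℂ[X]) + 2 * (j : ℂ[X]) + (n : ℂ[X])) *
        (X ^ k * (1 - X ^ 2) ^ j) =
    ((k * (k - 1) : ℕ) : ℂ[X]) * (X ^ (k - 2) * (1 - X ^ 2) ^ j) +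
      ((2 * j * (2 * (j - 1) + n + 1) : ℕ) : ℂ[X]) * (X ^ k * (1 - X ^ 2) ^ (j - 1)) := by
  have h1 : derivative (1 - X ^ 2 : ℂ[X]) = -2 * X := by simp; ring
  rcases k with _ | _ | k <;> rcases j with _ | _ | j <;>
  · simp only [derivative_mul, derivative_pow, derivative_X, h1, derivative_natCast, derivative_neg,
      derivative_ofNat, derivative_one, pow_zero, pow_one,
      Nat.add_sub_cancel, Nat.cast_add, Nat.cast_one, Nat.cast_zero, map_add, map_natCast, map_one,
      zero_add, Nat.reduceSubDiff, zero_mul, mul_zero, one_mul, mul_one, add_zero,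
      Nat.cast_mul, Nat.cast_ofNat, Nat.zero_sub, tsub_self, derivative_zero]
    ring

/-- The point `(a, b, 0, …, 0)`. -/
noncomputable def planePoint (n : ℕ) (a b : ℝ) : EuclideanSpace ℝ (Fin (n + 2)) :=
  a • EuclideanSpace.single 0 1 + b • EuclideanSpace.single 1 1

theorem planePoint_zero (a b : ℝ) : planePoint n a b 0 = a := by simp [planePoint]

theorem planePoint_one (a b : ℝ) : planePoint n a b 1 = b := by simp [planePoint]

theorem planePoint_succ_succ (a b : ℝ) (i : Fin n) : planePoint n a b i.succ.succ = 0 := by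
  have h : i.succ.succ ≠ 1 := fun h => Fin.succ_ne_zero i (Fin.succ_injective _ h)
  simp [planePoint, h]

theorem smul_planePoint (c a b : ℝ) : c • planePoint n a b = planePoint n (c * a) (c * b) := by
  simp [planePoint, mul_smul]

theorem norm_sq_planePoint (a b : ℝ) : ‖planePoint n a b‖ ^ 2 = a ^ 2 + b ^ 2 := by
  rw [EuclideanSpace.real_norm_sq_eq, Fin.sum_univ_succ, Fin.sum_univ_succ]
  simp only [planePoint_zero, planePoint_succ_succ]
  rw [show (Fin.succ 0 : Fin (n + 2)) = 1 from rfl, planePoint_one]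
  simp

theorem evalAt_axisDistSq (x : EuclideanSpace ℝ (Fin (n + 2))) :
    evalAt x (axisDistSq n) = ((‖x‖ ^ 2 - x 0 ^ 2 : ℝ) : ℂ) := by
  rw [EuclideanSpace.real_norm_sq_eq, Fin.sum_univ_succ, add_sub_cancel_left]
  simp [axisDistSq, evalAt_X]

/-- A polynomial is invariant under the orthogonal maps that fix the first coordinate axis. -/
def IsZonal (W : MvPolynomial (Fin (n + 2)) ℂ) : Prop :=
  ∀ R : OrthGroup (n + 2), R.1 (EuclideanSpace.single 0 1) = EuclideanSpace.single 0 1 →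
    ∀ x, evalAt (R.1 x) W = evalAt x W

theorem IsZonal.evalAt_eq {W : MvPolynomial (Fin (n + 2)) ℂ} (hW : IsZonal W)
    {x y : EuclideanSpace ℝ (Fin (n + 2))} (h : ‖x‖ = ‖y‖) (h0 : x 0 = y 0) :
    evalAt x W = evalAt y W := by
  obtain ⟨R, hR, hfix⟩ := exists_orthGroup_map_eq h
  rw [← hR, hW R (hfix _ (by simp [EuclideanSpace.inner_single_right, h0]))]

theorem exists_polynomial_evalAt_planePoint {W : MvPolynomial (Fin (n + 2)) ℂ} {m : ℕ}
    (hm : W.IsHomogeneous m) : ∃ z : ℂ[X], z.natDegree ≤ m ∧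
      ∀ a : ℝ, evalAt (planePoint n a 1) W = z.eval (a : ℂ) := by
  set g : Fin (n + 2) → ℂ[X] := fun i => if i = 0 then X else if i = 1 then 1 else 0 with hg
  refine ⟨MvPolynomial.aeval g W, ?_, fun a => ?_⟩
  · rw [MvPolynomial.aeval_def, MvPolynomial.eval₂_eq']
    refine natDegree_sum_le_of_forall_le _ _ fun α hα => ?_
    have hdeg : ∑ i, α i = m := by
      have := hm (MvPolynomial.mem_support_iff.1 hα)
      rw [Finsupp.weight_apply, Finsupp.sum_fintype _ _ (by simp)] at this
      simpa using this
    rw [algebraMap_eq]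
    refine (natDegree_C_mul_le _ _).trans ((natDegree_prod_le _ _).trans ?_)
    rw [← hdeg]
    refine Finset.sum_le_sum fun i _ => natDegree_pow_le.trans ?_
    have : (g i).natDegree ≤ 1 := by
      simp only [hg]
      split_ifs <;> simp
    exact (Nat.mul_le_mul_left _ this).trans (mul_one _).le
  · have : evalAt (planePoint n a 1) = (Polynomial.aeval (a : ℂ)).comp
        ((MvPolynomial.aeval g).restrictScalars ℂ) := by
      refine MvPolynomial.algHom_ext fun i => ?_
      rw [evalAt_X, AlgHom.comp_apply]
      refine Fin.cases ?_ (fun i => Fin.cases ?_ (fun i => ?_) i) i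
      · simp [hg, planePoint_zero]
      · simp [hg, planePoint_one]
      · have h : i.succ.succ ≠ 1 := fun h => Fin.succ_ne_zero i (Fin.succ_injective _ h)
        simp [hg, planePoint_succ_succ, h]
    rw [this]
    simp

theorem infinite_image_ofReal {s : Set ℝ} (hs : s.Infinite) :
    (((↑) : ℝ → ℂ) '' s).Infinite :=
  hs.image Complex.ofReal_injective.injOn

/-- By invariance W is determined by its values at (a, b, 0, …, 0) with b > 0, and by homogeneity by
the polynomial z(a) = W(a, 1, 0, …, 0). Invariance under b ↦ -b forces z to have the parity of m, so
that b^(m-k) is a power of b², the squared distance to the axis. -/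
theorem IsZonal.exists_coeff {W : MvPolynomial (Fin (n + 2)) ℂ} {m : ℕ} (hW : IsZonal W)
    (hm : W.IsHomogeneous m) : ∃ z : ℕ → ℂ, (∀ k ≤ m, z k ≠ 0 → Even (m - k)) ∧
      W = ∑ k ∈ Finset.range (m + 1), MvPolynomial.C (z k) *
        (MvPolynomial.X 0 ^ k * axisDistSq n ^ ((m - k) / 2)) := by
  obtain ⟨z, hz, hev⟩ := exists_polynomial_evalAt_planePoint hm
  have hpar : ∀ k ≤ m, z.coeff k ≠ 0 → Even (m - k) := by
    have hcomp : z.comp (C (-1) * X) = C ((-1) ^ m) * z := by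
      refine eq_of_infinite_eval_eq _ _ ((infinite_image_ofReal infinite_univ).mono ?_)
      rintro _ ⟨a, -, rfl⟩
      have h1 : evalAt (planePoint n (-a) 1) W = (-1) ^ m * evalAt (planePoint n a 1) W := by
        rw [← hW.evalAt_eq (x := planePoint n a (-1)) (y := planePoint n a 1) ?_
          (by simp [planePoint_zero])]
        · have := evalAt_smul hm (-1) (planePoint n a (-1))
          rw [smul_planePoint] at this
          simpa using this
        · rw [← sq_eq_sq₀ (norm_nonneg _) (norm_nonneg _), norm_sq_planePoint, norm_sq_planePoint]
          ring
      rw [hev, hev] at h1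
      simpa using h1
    intro k hk hne
    have h := congrArg (fun p => p.coeff k) hcomp
    simp only [coeff_C_mul, comp_C_mul_X_coeff] at h
    by_contra hodd
    have hodd : Odd (m - k) := Nat.not_even_iff_odd.1 hodd
    have hmk : (-1 : ℂ) ^ m = -(-1) ^ k := by
      rw [← Nat.sub_add_cancel hk, pow_add, hodd.neg_one_pow]; ring
    have h2 : (-1 : ℂ) ^ k * z.coeff k = 0 := by
      rw [hmk] at h
      linear_combination h / 2
    simp [hne] at h2
  refine ⟨z.coeff, hpar, ?_⟩
  have hρ : axisDistSq n ≠ 0 := by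
    intro h
    have := evalAt_axisDistSq (planePoint n 0 1)
    rw [h, norm_sq_planePoint, planePoint_zero] at this
    simp at this
  rw [← sub_eq_zero]
  -- The factor `axisDistSq` disposes of the points on the axis, where division by b is impossible;
  -- it is cancelled afterwards in the polynomial ring.
  refine (mul_eq_zero.1 (eq_zero_of_forall_evalAt_eq_zero fun x => ?_)).resolve_left hρ
  rw [map_mul, evalAt_axisDistSq]
  rcases eq_or_ne (‖x‖ ^ 2 - x 0 ^ 2) 0 with h0 | h0
  · rw [h0, Complex.ofReal_zero, zero_mul]
  have hle : x 0 ^ 2 ≤ ‖x‖ ^ 2 := by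
    rw [EuclideanSpace.real_norm_sq_eq]
    exact Finset.single_le_sum (f := fun i => x i ^ 2) (fun i _ => sq_nonneg _) (Finset.mem_univ _)
  have hpos : 0 < ‖x‖ ^ 2 - x 0 ^ 2 := lt_of_le_of_ne (sub_nonneg.2 hle) h0.symm
  set b := √(‖x‖ ^ 2 - x 0 ^ 2) with hb
  have hbpos : 0 < b := Real.sqrt_pos.2 hpos
  have hbsq : b ^ 2 = ‖x‖ ^ 2 - x 0 ^ 2 := Real.sq_sqrt hpos.le
  refine mul_eq_zero_of_right _ ?_
  rw [map_sub, sub_eq_zero, hW.evalAt_eq (y := b • planePoint n (x 0 / b) 1), evalAt_smul hm, hev,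
    eval_eq_sum_range' (Nat.lt_succ_of_le hz), map_sum, Finset.mul_sum]
  · refine Finset.sum_congr rfl fun k hk => ?_
    have hk : k ≤ m := Nat.lt_succ_iff.1 (Finset.mem_range.1 hk)
    rw [map_mul, map_mul, map_pow, map_pow, evalAt_X, evalAt_axisDistSq, ← hbsq]
    rcases eq_or_ne (z.coeff k) 0 with hz0 | hz0
    · simp [hz0]
    · have he := hpar k hk hz0
      rw [Complex.ofReal_pow, ← pow_mul, Nat.mul_div_cancel' he.two_dvd, Complex.ofReal_div,
        div_pow]
      have hb0 : (b : ℂ) ≠ 0 := Complex.ofReal_ne_zero.2 hbpos.ne'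
      conv_lhs => rw [← Nat.sub_add_cancel hk, pow_add]
      simp only [evalAt, MvPolynomial.aeval_C, Algebra.algebraMap_self, RingHom.id_apply]
      field_simp
  · rw [← sq_eq_sq₀ (norm_nonneg _) (norm_nonneg _), smul_planePoint, norm_sq_planePoint,
      mul_div_cancel₀ _ hbpos.ne', mul_one, hbsq]
    ring
  · rw [smul_planePoint, planePoint_zero, mul_div_cancel₀ _ hbpos.ne']

/-- On the unit sphere W is a polynomial v of the first coordinate. Harmonicity of W becomes the
Gegenbauer equation for v with ν = n/2 (the dimension is n + 2), whose polynomial solutions are the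
multiples of the Gegenbauer polynomial. -/
theorem IsZonal.evalAt_eq_gegenbauer {W : MvPolynomial (Fin (n + 2)) ℂ} {m : ℕ} (hW : IsZonal W)
    (hm : W.IsHomogeneous m) (hΔ : polyLaplacian (n + 2) W = 0)
    {x : EuclideanSpace ℝ (Fin (n + 2))} (hx : ‖x‖ = 1) :
    evalAt x W = (((gegenbauer (n / 2) m).eval (x 0) : ℝ) : ℂ) *
      evalAt (EuclideanSpace.single 0 1) W := by
  obtain ⟨z, hz, hWz⟩ := hW.exists_coeff hm
  set v : ℂ[X] := ∑ k ∈ Finset.range (m + 1), C (z k) * (X ^ k * (1 - X ^ 2) ^ ((m - k) / 2))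
    with hv
  have hWv : ∀ y : EuclideanSpace ℝ (Fin (n + 2)), ‖y‖ = 1 →
      evalAt y W = v.eval ((y 0 : ℝ) : ℂ) := by
    intro y hy
    rw [hWz, hv, map_sum, eval_finsetSum]
    refine Finset.sum_congr rfl fun k _ => ?_
    rw [map_mul, map_mul, map_pow, map_pow, evalAt_X, evalAt_axisDistSq, hy]
    simp [evalAt]
  have hode : (1 - X ^ 2) * derivative (derivative v) -
      C ((2 * (n / 2 : ℝ) + 1 : ℝ) : ℂ) * X * derivative v +
      C ((m * (m + 2 * (n / 2 : ℝ)) : ℝ) : ℂ) * v = 0 := by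
    have e1 : C ((2 * (n / 2 : ℝ) + 1 : ℝ) : ℂ) = (n : ℂ[X]) + 1 := by
      rw [mul_div_cancel₀ _ two_ne_zero]; simp
    have e2 : C ((m * (m + 2 * (n / 2 : ℝ)) : ℝ) : ℂ) = (m : ℂ[X]) * ((m : ℂ[X]) + (n : ℂ[X])) := by
      rw [mul_div_cancel₀ _ two_ne_zero]; simp
    have hsum : (1 - X ^ 2) * derivative (derivative v) -
        C ((2 * (n / 2 : ℝ) + 1 : ℝ) : ℂ) * X * derivative v +
        C ((m * (m + 2 * (n / 2 : ℝ)) : ℝ) : ℂ) * v =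
        ∑ k ∈ Finset.range (m + 1), C (z k) *
          (((k * (k - 1) : ℕ) : ℂ[X]) * (X ^ (k - 2) * (1 - X ^ 2) ^ ((m - k) / 2)) +
          ((2 * ((m - k) / 2) * (2 * ((m - k) / 2 - 1) + n + 1) : ℕ) : ℂ[X]) *
            (X ^ k * (1 - X ^ 2) ^ ((m - k) / 2 - 1))) := by
      rw [e1, e2, hv]
      simp only [derivative_sum, derivative_C_mul, Finset.mul_sum]
      rw [← Finset.sum_sub_distrib, ← Finset.sum_add_distrib]
      refine Finset.sum_congr rfl fun k hk => ?_
      have hk : k ≤ m := Nat.lt_succ_iff.1 (Finset.mem_range.1 hk)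
      rw [← derivative_zonal]
      rcases eq_or_ne (z k) 0 with hz0 | hz0
      · simp [hz0]
      · have hmk : (m : ℂ[X]) = (k : ℂ[X]) + 2 * (((m - k) / 2 : ℕ) : ℂ[X]) := by
          have := Nat.mul_div_cancel' (hz k hk hz0).two_dvd
          exact_mod_cast (by omega : m = k + 2 * ((m - k) / 2))
        rw [hmk]
        ring
    rw [hsum]
    -- The polynomial identity is checked at the infinitely many τ in [-1, 1], where it is the
    -- Laplacian of W at the unit vector (τ, √(1-τ²), 0, …, 0).
    refine eq_of_infinite_eval_eq _ _
      ((infinite_image_ofReal (Icc_infinite (neg_one_lt_zero (R := ℝ)))).mono ?_)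
    rintro _ ⟨τ, hτ, rfl⟩
    have hτ' : 0 ≤ 1 - τ ^ 2 := by nlinarith [hτ.1, hτ.2]
    have h := congrArg (evalAt (planePoint n τ √(1 - τ ^ 2))) hΔ
    have hn : ‖planePoint n τ √(1 - τ ^ 2)‖ ^ 2 = 1 := by
      rw [norm_sq_planePoint, Real.sq_sqrt hτ']; ring
    rw [hWz, map_sum, map_sum, map_zero] at h
    rw [mem_ofPred_eq, eval_zero, eval_finsetSum, ← h]
    refine Finset.sum_congr rfl fun k _ => ?_
    rw [← MvPolynomial.smul_eq_C_mul, map_smul, polyLaplacian_zonal, map_smul]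
    simp only [map_add, map_mul, map_pow, map_natCast, evalAt_X, evalAt_axisDistSq, hn,
      planePoint_zero]
    simp
  have h1 : ‖(EuclideanSpace.single 0 1 : EuclideanSpace ℝ (Fin (n + 2)))‖ = 1 := by simp
  have hν : -(1 / 2) < (n : ℝ) / 2 := by
    have : (0 : ℝ) ≤ n := n.cast_nonneg
    linarith
  rw [hWv x hx, hWv _ h1, mul_comm]
  conv_lhs => rw [eq_gegenbauer_of_ode hν m hode]
  rw [eval_mul, eval_C, eval_map_algebraMap, ← Complex.coe_algebraMap, aeval_algebraMap_apply,
    Polynomial.coe_aeval_eq_eval]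
  simp

end Zonal

/-! ### Averages of spherical harmonics over the orthogonal group -/

section ZonalAverage

variable {d : ℕ}

theorem inner_rotate (R : OrthGroup d) (x y : sphere (0 : EuclideanSpace ℝ (Fin d)) 1) :
    inner ℝ (rotate R x : EuclideanSpace ℝ (Fin d)) (rotate R y) =
      inner ℝ (x : EuclideanSpace ℝ (Fin d)) y := by
  rw [coe_rotate, coe_rotate]
  exact Unitary.inner_map_map R _ _

theorem coe_mul_apply (R T : OrthGroup d) (x : EuclideanSpace ℝ (Fin d)) :
    (R * T).1 x = R.1 (T.1 x) := rfl

theorem inv_apply_apply (R : OrthGroup d) (x : EuclideanSpace ℝ (Fin d)) :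
    (R⁻¹).1 (R.1 x) = x := by
  rw [← coe_mul_apply, inv_mul_cancel]; rfl

theorem continuous_rotate_inv_left (x : sphere (0 : EuclideanSpace ℝ (Fin d)) 1) :
    Continuous fun R : OrthGroup d => rotate R⁻¹ x :=
  Continuous.comp (f := fun R : OrthGroup d => (R, x)) continuous_rotate_inv
    (Continuous.prodMk continuous_id continuous_const)

/-- The first standard unit vector. -/
noncomputable def pole (n : ℕ) : sphere (0 : EuclideanSpace ℝ (Fin (n + 2))) 1 :=
  ⟨EuclideanSpace.single 0 1, by simp⟩

/-- The Funk-Hecke argument: as a function of x, the average W(x) of G(R⁻¹ pole) P(R⁻¹x) is a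
homogeneous harmonic polynomial of degree m. If T fixes the pole, replacing R by TR leaves the
weight G(R⁻¹ pole) alone and shows W(Tx) = W(x), so W is zonal. -/
theorem integral_haarProb_pole {n m : ℕ} {P : MvPolynomial (Fin (n + 2)) ℂ}
    (hP : P.IsHomogeneous m) (hΔ : polyLaplacian (n + 2) P = 0)
    {G : sphere (0 : EuclideanSpace ℝ (Fin (n + 2))) 1 → ℂ} (hG : Continuous G)
    (e : sphere (0 : EuclideanSpace ℝ (Fin (n + 2))) 1) :
    ∫ R, G (rotate R⁻¹ (pole n)) * evalAt (rotate R⁻¹ e) P ∂haarProb (n + 2) =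
      (((gegenbauer (n / 2) m).eval ((e : EuclideanSpace ℝ (Fin (n + 2))) 0) : ℝ) : ℂ) *
      ∫ R, G (rotate R⁻¹ (pole n)) * evalAt (rotate R⁻¹ (pole n)) P ∂haarProb (n + 2) := by
  obtain ⟨W, hWm, hW⟩ := exists_isHomogeneous_average (haarProb (n + 2))
    (Q := fun R : OrthGroup (n + 2) => linSubst (R⁻¹).1 P)
    (fun R => isHomogeneous_linSubst _ hP)
    (fun α => continuous_coeff_linSubst (continuous_subtype_val.comp continuous_inv) P α)
    (hG.comp (continuous_rotate_inv_left (pole n)))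
  have hev : ∀ x, evalAt x W = ∫ R : OrthGroup (n + 2), G (rotate R⁻¹ (pole n)) *
      evalAt ((R⁻¹).1 x) P ∂haarProb (n + 2) := by
    intro x
    have := hW (evalAt x).toLinearMap
    simp only [AlgHom.toLinearMap_apply, evalAt_linSubst] at this
    exact this
  have hzonal : IsZonal W := by
    intro T hT x
    have hT' : rotate T (pole n) = pole n := Subtype.ext hT
    rw [hev, hev, ← integral_mul_left_eq_self _ T]
    congr 1
    ext R
    rw [mul_inv_rev, rotate_mul, coe_mul_apply, inv_apply_apply]
    conv_lhs => rw [← hT', rotate_inv_rotate]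
  have hΔW : polyLaplacian (n + 2) W = 0 := by
    ext α
    have := hW (MvPolynomial.lcoeff ℂ α ∘ₗ polyLaplacian (n + 2))
    simpa [polyLaplacian_linSubst, hΔ] using this
  have key := hzonal.evalAt_eq_gegenbauer hWm hΔW (norm_eq_of_mem_sphere e)
  rw [hev, hev] at key
  exact key

theorem integral_haarProb_mul_harmonic (hd : 2 ≤ d) {m : ℕ}
    {Y : sphere (0 : EuclideanSpace ℝ (Fin d)) 1 → ℂ} (hY : Y ∈ sphericalHarmonics d m)
    {G : sphere (0 : EuclideanSpace ℝ (Fin d)) 1 → ℂ} (hG : Continuous G)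
    (η e : sphere (0 : EuclideanSpace ℝ (Fin d)) 1) :
    ∫ R, G (rotate R⁻¹ η) * Y (rotate R⁻¹ e) ∂haarProb d =
      (((gegenbauer (((d : ℝ) - 2) / 2) m).eval
        (inner ℝ (η : EuclideanSpace ℝ (Fin d)) e) : ℝ) : ℂ) *
      ∫ R, G (rotate R⁻¹ η) * Y (rotate R⁻¹ η) ∂haarProb d := by
  obtain ⟨n, rfl⟩ := Nat.exists_eq_add_of_le' hd
  obtain ⟨P, ⟨hP, hΔ⟩, rfl⟩ := hY
  obtain ⟨T, hT⟩ := exists_rotate_eq η (pole n)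
  have h1 : ∀ x, ∫ R, G (rotate R⁻¹ η) * restrictToSphere (n + 2) P (rotate R⁻¹ x)
      ∂haarProb (n + 2) = ∫ R, G (rotate R⁻¹ (pole n)) *
        restrictToSphere (n + 2) P (rotate R⁻¹ (rotate T x)) ∂haarProb (n + 2) := by
    intro x
    rw [← integral_mul_left_eq_self (fun R => G (rotate R⁻¹ (pole n)) *
        restrictToSphere (n + 2) P (rotate R⁻¹ (rotate T x))) T]
    simp_rw [mul_inv_rev, rotate_mul, rotate_inv_rotate, ← hT, rotate_inv_rotate]
  have h2 : inner ℝ (η : EuclideanSpace ℝ (Fin (n + 2))) e =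
      (rotate T e : EuclideanSpace ℝ (Fin (n + 2))) 0 := by
    rw [← inner_rotate T, hT]
    simp [pole, EuclideanSpace.inner_single_left]
  have h3 : (((n + 2 : ℕ) : ℝ) - 2) / 2 = n / 2 := by push_cast; ring
  rw [h1, h1, h2, h3, hT]
  exact integral_haarProb_pole (m := m) hP hΔ hG (rotate T e)

/-- Conjugate the preceding identity for conj G; the Gegenbauer value is real. -/
theorem integral_haarProb_mul_conj_harmonic (hd : 2 ≤ d) {m : ℕ}
    {Y : sphere (0 : EuclideanSpace ℝ (Fin d)) 1 → ℂ} (hY : Y ∈ sphericalHarmonics d m)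
    {G : sphere (0 : EuclideanSpace ℝ (Fin d)) 1 → ℂ} (hG : Continuous G)
    (η e : sphere (0 : EuclideanSpace ℝ (Fin d)) 1) :
    ∫ R, G (rotate R⁻¹ η) * conj (Y (rotate R⁻¹ e)) ∂haarProb d =
      (((gegenbauer (((d : ℝ) - 2) / 2) m).eval
        (inner ℝ (η : EuclideanSpace ℝ (Fin d)) e) : ℝ) : ℂ) *
      ∫ R, G (rotate R⁻¹ η) * conj (Y (rotate R⁻¹ η)) ∂haarProb d := by
  have h := congrArg conj (integral_haarProb_mul_harmonic hd hY
    (Complex.continuous_conj.comp hG) η e)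
  rw [map_mul, Complex.conj_ofReal, ← integral_conj, ← integral_conj] at h
  simpa using h

theorem continuous_of_mem_sphericalHarmonics {m : ℕ}
    {Y : sphere (0 : EuclideanSpace ℝ (Fin d)) 1 → ℂ} (hY : Y ∈ sphericalHarmonics d m) :
    Continuous Y := by
  obtain ⟨P, -, rfl⟩ := hY
  exact (continuous_evalAt P).comp continuous_subtype_val

end ZonalAverage

/-! ### The data of a function in terms of its harmonic coefficients -/

section Data

open scoped NNReal

variable {d : ℕ}

theorem continuous_comp_stereoInv {f : EuclideanSpace ℝ (Fin (d + 1)) → ℂ}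
    (hf : ContinuousOn f (sphere 0 1)) :
    Continuous fun y : EuclideanSpace ℝ (Fin d) => f (stereoInv y) :=
  hf.comp_continuous continuous_stereoInv fun y => by simp [norm_stereoInv]

/-- The product of `f ∘ Λ⁻¹` and the power of the conformal factor that occurs in the spherical
transform. -/
noncomputable def weightedPullback (f : EuclideanSpace ℝ (Fin (d + 1)) → ℂ)
    (y : EuclideanSpace ℝ (Fin d)) : ℂ :=
  f (stereoInv y) / (((1 + ‖y‖ ^ 2) ^ (d - 1) : ℝ) : ℂ)

theorem continuous_weightedPullback {f : EuclideanSpace ℝ (Fin (d + 1)) → ℂ}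
    (hf : ContinuousOn f (sphere 0 1)) : Continuous (weightedPullback f) := by
  refine (continuous_comp_stereoInv hf).div (by fun_prop) fun y => ?_
  exact Complex.ofReal_ne_zero.2 (by positivity)

/-- The parametrization ω ↦ Λ⁻¹(cψ + ctω) has the two-point distance form with g = √(ct) times
`stereoFactor`, and g^(2(d-1)) is the power of 2ct times the weight in `weightedPullback`. -/
theorem sphericalTransform_subsphere {lam : ℝ} (hlam : 0 < lam)
    (f : EuclideanSpace ℝ (Fin (d + 1)) → ℂ) (ψ : sphere (0 : EuclideanSpace ℝ (Fin d)) 1) {c : ℝ}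
    (hc : 0 < c) :
    sphericalTransform f (subsphere lam ψ c) = (((2 * c * Real.tanh lam) ^ (d - 1) : ℝ) : ℂ) *
      ∫ ω : sphere (0 : EuclideanSpace ℝ (Fin d)) 1,
        weightedPullback f (c • (ψ : EuclideanSpace ℝ (Fin d)) +
          (c * Real.tanh lam) • (ω : EuclideanSpace ℝ (Fin d))) ∂μHE[d - 1] := by
  have ht := tanh_pos hlam
  set y : sphere (0 : EuclideanSpace ℝ (Fin d)) 1 → EuclideanSpace ℝ (Fin d) := fun ω =>
    c • (ψ : EuclideanSpace ℝ (Fin d)) + (c * Real.tanh lam) • (ω : EuclideanSpace ℝ (Fin d))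
    with hy
  have hyc : Continuous y := by fun_prop
  have hydist : ∀ ω ω', dist (y ω) (y ω') = c * Real.tanh lam * dist ω ω' := by
    intro ω ω'
    rw [hy, dist_add_left, dist_smul₀, Real.norm_of_nonneg (by positivity)]
    rfl
  have hyinj : Function.Injective y := by
    intro ω ω' h
    have := hydist ω ω'
    rw [h, dist_self] at this
    have h0 : 0 < c * Real.tanh lam := by positivity
    exact dist_eq_zero.1 ((mul_eq_zero.1 this.symm).resolve_left h0.ne')
  set g : sphere (0 : EuclideanSpace ℝ (Fin d)) 1 → ℝ≥0 := fun ω =>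
    (√(c * Real.tanh lam)).toNNReal * stereoFactor (y ω) with hg
  have hgc : ∀ ω, (g ω : ℝ) = √(c * Real.tanh lam) * √(2 / (1 + ‖y ω‖ ^ 2)) := by
    intro ω
    rw [hg, NNReal.coe_mul, Real.coe_toNNReal _ (Real.sqrt_nonneg _)]
    rfl
  have hgpow : ∀ ω, (g ω : ℝ) ^ (2 * (d - 1)) =
      (2 * c * Real.tanh lam) ^ (d - 1) / (1 + ‖y ω‖ ^ 2) ^ (d - 1) := by
    intro ω
    rw [hgc, pow_mul, mul_pow, Real.sq_sqrt (by positivity), Real.sq_sqrt (by positivity),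
      ← div_pow]
    congr 1
    ring
  have hmain := setIntegral_range_euclideanHausdorffMeasure (Φ := fun ω => stereoInv (y ω)) (g := g)
    ((continuous_stereoInv.comp hyc).measurableEmbedding (injective_stereoInv.comp hyinj))
    (measurable_const.mul (continuous_stereoFactor.comp hyc).measurable)
    (fun ω => mul_pos (Real.toNNReal_pos.2 (Real.sqrt_pos.2 (by positivity))) (stereoFactor_pos _))
    (fun ω ω' => edist_eq_of_dist_eq (by
      rw [dist_stereoInv, hydist, hgc, hgc]
      have := Real.mul_self_sqrt (by positivity : 0 ≤ c * Real.tanh lam)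
      linear_combination (-√(2 / (1 + ‖y ω‖ ^ 2)) * √(2 / (1 + ‖y ω'‖ ^ 2)) * dist ω ω') * this))
    (d - 1) f
  rw [sphericalTransform, subsphere, hmain, ← integral_const_mul]
  congr 1
  ext ω
  rw [hgpow, weightedPullback]
  push_cast
  ring

theorem sphereVolume_pos (k : ℕ) : 0 < sphereVolume k := by
  have : 0 < Real.Gamma (((k : ℝ) + 1) / 2) := Real.Gamma_pos_of_pos (by positivity)
  rw [sphereVolume]
  positivity

theorem dataCoeff_eq_integral (hd : 2 ≤ d) {lam : ℝ} (hlam : 0 < lam)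
    (f : EuclideanSpace ℝ (Fin (d + 1)) → ℂ) (Y : sphere (0 : EuclideanSpace ℝ (Fin d)) 1 → ℂ)
    {c : ℝ} (hc : 0 < c) :
    dataCoeff lam f Y c = 1 / (sphereVolume (d - 2) : ℂ) *
      ∫ ψ, (∫ ω, weightedPullback f (c • (ψ : EuclideanSpace ℝ (Fin d)) +
        (c * Real.tanh lam) • (ω : EuclideanSpace ℝ (Fin d))) * conj (Y ψ)
        ∂(volume : Measure (EuclideanSpace ℝ (Fin d))).toSphere)
        ∂(volume : Measure (EuclideanSpace ℝ (Fin d))).toSphere := by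
  obtain ⟨n, rfl⟩ := Nat.exists_eq_add_of_le' (show 1 ≤ d by omega)
  have ht := tanh_pos hlam
  have hμ := euclideanHausdorffMeasure_sphere (n := n) (by omega)
  rw [dataCoeff]
  simp_rw [sphericalTransform_subsphere hlam f _ hc, Nat.add_sub_cancel, hμ,
    mul_assoc (Complex.ofReal _)]
  rw [integral_const_mul, ← mul_assoc]
  simp_rw [integral_mul_const]
  congr 1
  have h1 : (((2 * c * Real.tanh lam) ^ n : ℝ) : ℂ) ≠ 0 :=
    Complex.ofReal_ne_zero.2 (by positivity)
  rw [Complex.ofReal_mul]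
  field_simp

/-- The harmonic coefficient of `weightedPullback f`. -/
noncomputable def weightedCoeff (f : EuclideanSpace ℝ (Fin (d + 1)) → ℂ)
    (Y : sphere (0 : EuclideanSpace ℝ (Fin d)) 1 → ℂ) (r : ℝ) : ℂ :=
  (((1 + r ^ 2) ^ (d - 1) : ℝ) : ℂ)⁻¹ * harmonicCoeff f Y r

theorem weightedCoeff_eq_integral (f : EuclideanSpace ℝ (Fin (d + 1)) → ℂ)
    (Y : sphere (0 : EuclideanSpace ℝ (Fin d)) 1 → ℂ) (r : ℝ) :
    weightedCoeff f Y r = ∫ ζ, weightedPullback f (r • (ζ : EuclideanSpace ℝ (Fin d))) *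
      conj (Y ζ) ∂(volume : Measure (EuclideanSpace ℝ (Fin d))).toSphere := by
  rw [weightedCoeff, harmonicCoeff, ← integral_const_mul]
  congr 1
  ext ζ
  rw [weightedPullback, norm_smul, norm_eq_of_mem_sphere, mul_one, Real.norm_eq_abs, sq_abs]
  ring

theorem continuous_integral_of_compactSpace {X K : Type*} [TopologicalSpace X]
    [FirstCountableTopology X] [LocallyCompactSpace X] [TopologicalSpace K] [CompactSpace K]
    [MeasurableSpace K] [BorelSpace K] [SecondCountableTopology K] {μ : Measure K}
    [IsFiniteMeasure μ] {F : X → K → ℂ} (hF : Continuous (Function.uncurry F)) :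
    Continuous fun x => ∫ k, F x k ∂μ := by
  have := continuous_parametric_integral_of_continuous (μ := μ) hF isCompact_univ
  simpa using this

theorem continuous_harmonicCoeff {f : EuclideanSpace ℝ (Fin (d + 1)) → ℂ}
    (hf : ContinuousOn f (sphere 0 1)) {Y : sphere (0 : EuclideanSpace ℝ (Fin d)) 1 → ℂ}
    (hY : Continuous Y) : Continuous (harmonicCoeff f Y) := by
  refine continuous_integral_of_compactSpace (F := fun (r : ℝ)
    (ζ : sphere (0 : EuclideanSpace ℝ (Fin d)) 1) =>
    f (stereoInv (r • (ζ : EuclideanSpace ℝ (Fin d)))) * conj (Y ζ)) ?_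
  have h1 := (continuous_comp_stereoInv hf).comp (show Continuous fun p : ℝ ×
    sphere (0 : EuclideanSpace ℝ (Fin d)) 1 => p.1 • (p.2 : EuclideanSpace ℝ (Fin d)) by fun_prop)
  exact h1.mul (Complex.continuous_conj.comp (hY.comp continuous_snd))

theorem integral_weightedPullback_rotate (hd : 2 ≤ d) {m : ℕ}
    {f : EuclideanSpace ℝ (Fin (d + 1)) → ℂ} (hf : ContinuousOn f (sphere 0 1))
    {Y : sphere (0 : EuclideanSpace ℝ (Fin d)) 1 → ℂ} (hY : Y ∈ sphericalHarmonics d m)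
    (e η : sphere (0 : EuclideanSpace ℝ (Fin d)) 1) (r : ℝ) :
    ((volume : Measure (EuclideanSpace ℝ (Fin d))).toSphere.real univ : ℂ) *
      ∫ R : OrthGroup d, weightedPullback f ((R⁻¹).1 (r • (η : EuclideanSpace ℝ (Fin d)))) *
        conj (Y (rotate R⁻¹ e)) ∂haarProb d =
    (((gegenbauer (((d : ℝ) - 2) / 2) m).eval
      (inner ℝ (η : EuclideanSpace ℝ (Fin d)) e) : ℝ) : ℂ) * weightedCoeff f Y r := by
  have hG : Continuous fun ζ : sphere (0 : EuclideanSpace ℝ (Fin d)) 1 =>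
      weightedPullback f (r • (ζ : EuclideanSpace ℝ (Fin d))) :=
    (continuous_weightedPullback hf).comp (by fun_prop)
  have hYc := continuous_of_mem_sphericalHarmonics hY
  have h := integral_haarProb_mul_conj_harmonic hd hY hG η e
  have havg := integral_eq_haar_average isRotationInvariant_toSphere
    (F := fun ζ => weightedPullback f (r • (ζ : EuclideanSpace ℝ (Fin d))) * conj (Y ζ))
    (hG.mul (Complex.continuous_conj.comp hYc)) η
  rw [weightedCoeff_eq_integral, havg, Complex.real_smul]
  simp only [coe_rotate] at h ⊢
  simp_rw [map_smul]
  rw [h]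
  ring

/-- Write the integral over ψ as an average over rotations of a fixed e, rotate ω along, and average
over R before integrating over ω. The inner average depends only on the latitude of ω with respect
to e, and the latitude integral becomes the kernel integral with x = |e + tω|. -/
theorem dataCoeff_eq_integral_kernel (hd : 2 ≤ d) {lam : ℝ} (hlam : 0 < lam) {m : ℕ}
    {f : EuclideanSpace ℝ (Fin (d + 1)) → ℂ} (hf : ContinuousOn f (sphere 0 1))
    {Y : sphere (0 : EuclideanSpace ℝ (Fin d)) 1 → ℂ} (hY : Y ∈ sphericalHarmonics d m)
    {c : ℝ} (hc : 0 < c) :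
    dataCoeff lam f Y c =
      ∫ x in Ioi (0 : ℝ), (kernel d m lam x : ℂ) * weightedCoeff f Y (c * x) := by
  obtain ⟨n, rfl⟩ := Nat.exists_eq_add_of_le' (show 1 ≤ d by omega)
  have ht := tanh_pos hlam
  have ht1 := Real.tanh_lt_one lam
  have hYc := continuous_of_mem_sphericalHarmonics hY
  have hGc := continuous_weightedPullback hf
  set t := Real.tanh lam with htdef
  set σ := (volume : Measure (EuclideanSpace ℝ (Fin (n + 1)))).toSphere with hσ
  -- The last unit vector, since latitude is measured along the last coordinate.
  let e : sphere (0 : EuclideanSpace ℝ (Fin (n + 1))) 1 :=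
    ⟨EuclideanSpace.single (Fin.last n) 1, by simp⟩
  rw [dataCoeff_eq_integral hd hlam f Y hc, ← htdef]
  have hcont : Continuous fun ψ : sphere (0 : EuclideanSpace ℝ (Fin (n + 1))) 1 =>
      ∫ ω, weightedPullback f (c • (ψ : EuclideanSpace ℝ (Fin (n + 1))) +
        (c * t) • (ω : EuclideanSpace ℝ (Fin (n + 1)))) * conj (Y ψ) ∂σ := by
    refine continuous_integral_of_compactSpace (F := fun
      (ψ ω : sphere (0 : EuclideanSpace ℝ (Fin (n + 1))) 1) =>
      weightedPullback f (c • (ψ : EuclideanSpace ℝ (Fin (n + 1))) +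
        (c * t) • (ω : EuclideanSpace ℝ (Fin (n + 1)))) * conj (Y ψ)) ?_
    exact (hGc.comp (show Continuous fun p : sphere (0 : EuclideanSpace ℝ (Fin (n + 1))) 1 ×
      sphere (0 : EuclideanSpace ℝ (Fin (n + 1))) 1 =>
        c • (p.1 : EuclideanSpace ℝ (Fin (n + 1))) + (c * t) •
          (p.2 : EuclideanSpace ℝ (Fin (n + 1))) by fun_prop)).mul
      (Complex.continuous_conj.comp (hYc.comp continuous_fst))
  -- Replacing ω by Tω turns the argument into T(ce + ctω).
  have hinv : ∀ T : OrthGroup (n + 1), ∫ ω, weightedPullback f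
        (c • (rotate T e).1 +
        (c * t) • (ω : EuclideanSpace ℝ (Fin (n + 1)))) * conj (Y (rotate T e)) ∂σ =
      ∫ ω, weightedPullback f (T.1 (c • (e : EuclideanSpace ℝ (Fin (n + 1))) +
        (c * t) • (ω : EuclideanSpace ℝ (Fin (n + 1))))) * conj (Y (rotate T e)) ∂σ := by
    intro T
    rw [← (isRotationInvariant_toSphere T).integral_comp (measurableEmbedding_rotate T)]
    simp only [coe_rotate, map_add, map_smul, hσ]
  have hswap : Continuous fun p : OrthGroup (n + 1) ×
      sphere (0 : EuclideanSpace ℝ (Fin (n + 1))) 1 =>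
      weightedPullback f ((p.1⁻¹).1 (c • (e : EuclideanSpace ℝ (Fin (n + 1))) +
        (c * t) • (p.2 : EuclideanSpace ℝ (Fin (n + 1))))) * conj (Y (rotate p.1⁻¹ e)) := by
    refine Continuous.mul (hGc.comp ?_) (Complex.continuous_conj.comp (hYc.comp
      ((continuous_rotate_inv_left e).comp continuous_fst)))
    exact (continuous_subtype_val.comp (continuous_inv.comp continuous_fst)).clm_apply
      (by fun_prop)
  let φ : ℝ → ℂ := fun τ => (((gegenbauer ((((n + 1 : ℕ) : ℝ) - 2) / 2) m).eval
    ((1 + t * τ) / √(1 + t ^ 2 + 2 * t * τ)) : ℝ) : ℂ) *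
      weightedCoeff f Y (c * √(1 + t ^ 2 + 2 * t * τ))
  have hω : ∀ ω : sphere (0 : EuclideanSpace ℝ (Fin (n + 1))) 1,
      (σ.real univ : ℂ) * ∫ R : OrthGroup (n + 1), weightedPullback f
        ((R⁻¹).1 (c • (e : EuclideanSpace ℝ (Fin (n + 1))) +
        (c * t) • (ω : EuclideanSpace ℝ (Fin (n + 1))))) * conj (Y (rotate R⁻¹ e))
        ∂haarProb (n + 1) =
      φ ((ω : EuclideanSpace ℝ (Fin (n + 1))) (Fin.last n)) := by
    intro ω
    set τ := (ω : EuclideanSpace ℝ (Fin (n + 1))) (Fin.last n) with hτ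
    have hin : inner ℝ (e : EuclideanSpace ℝ (Fin (n + 1))) ω = τ := by
      simp [e, EuclideanSpace.inner_single_left, hτ]
    set q : EuclideanSpace ℝ (Fin (n + 1)) := (e : EuclideanSpace ℝ (Fin (n + 1))) +
      t • (ω : EuclideanSpace ℝ (Fin (n + 1))) with hq
    have hnq : ‖q‖ = √(1 + t ^ 2 + 2 * t * τ) := by
      have : ‖q‖ ^ 2 = 1 + t ^ 2 + 2 * t * τ := by
        rw [hq, norm_add_sq_real, inner_smul_right, hin, norm_smul, norm_eq_of_mem_sphere,
          norm_eq_of_mem_sphere, Real.norm_of_nonneg ht.le]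
        ring
      rw [← this, Real.sqrt_sq (norm_nonneg _)]
    -- Here t < 1 enters: e + tω never vanishes, so its direction η is defined.
    have hqpos : 0 < ‖q‖ := by
      have h := norm_sub_le q (t • (ω : EuclideanSpace ℝ (Fin (n + 1))))
      rw [hq, add_sub_cancel_right, norm_smul, norm_eq_of_mem_sphere, norm_eq_of_mem_sphere,
        Real.norm_of_nonneg ht.le] at h
      linarith
    let η : sphere (0 : EuclideanSpace ℝ (Fin (n + 1))) 1 :=
      ⟨‖q‖⁻¹ • q, by simp [norm_smul, hqpos.ne']⟩
    have hη : c • (e : EuclideanSpace ℝ (Fin (n + 1))) +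
        (c * t) • (ω : EuclideanSpace ℝ (Fin (n + 1))) = (c * ‖q‖) • (η : EuclideanSpace ℝ _) := by
      change _ = (c * ‖q‖) • (‖q‖⁻¹ • q)
      rw [smul_smul, mul_assoc, mul_inv_cancel₀ hqpos.ne', mul_one, hq, smul_add, smul_smul]
    have hηe : inner ℝ (η : EuclideanSpace ℝ (Fin (n + 1))) e = (1 + t * τ) / ‖q‖ := by
      have h1 : inner ℝ q (e : EuclideanSpace ℝ (Fin (n + 1))) = 1 + t * τ := by
        rw [hq, inner_add_left, real_inner_self_eq_norm_sq, norm_eq_of_mem_sphere,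
          real_inner_smul_left, real_inner_comm, hin, one_pow]
      rw [real_inner_smul_left, h1]
      ring
    rw [hη, integral_weightedPullback_rotate hd hf hY e η, hηe, hnq]
  rw [(integral_eq_haar_average isRotationInvariant_toSphere hcont e).trans
    (congrArg (σ.real univ • ·) (integral_congr_ae (.of_forall fun R => hinv R⁻¹))),
    integral_integral_swap (hswap.integrable_of_hasCompactSupport
    (HasCompactSupport.of_compactSpace _)), Complex.real_smul, ← integral_const_mul]
  rw [(integral_congr_ae (.of_forall hω)).trans (integral_latitude_toSphere (n := n) (by omega) φ),
    ← mul_assoc, integral_kernel_mul m hlam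
    (fun x => weightedCoeff f Y (c * x)), ← htdef]
  have hv : (sphereVolume (n - 1) : ℂ) ≠ 0 := Complex.ofReal_ne_zero.2 (sphereVolume_pos _).ne'
  rw [show n + 1 - 2 = n - 1 by omega, one_div_mul_cancel hv, one_mul]
  rw [show (((n + 1 : ℕ) : ℝ) - 3) / 2 = ((n : ℝ) - 2) / 2 by push_cast; ring]

end Data

/-! ### Inversion -/

section Inversion

variable {d : ℕ}

theorem exists_norm_harmonicCoeff_le {f : EuclideanSpace ℝ (Fin (d + 1)) → ℂ}
    (hf : ContinuousOn f (sphere 0 1)) {Y : sphere (0 : EuclideanSpace ℝ (Fin d)) 1 → ℂ}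
    (hY : Continuous Y) : ∃ M, ∀ r, ‖harmonicCoeff f Y r‖ ≤ M := by
  obtain ⟨B, hB⟩ :=
    (isCompact_sphere (0 : EuclideanSpace ℝ (Fin (d + 1))) 1).exists_bound_of_continuousOn hf
  have hinteg : Integrable (fun ζ => B * ‖Y ζ‖)
      (volume : Measure (EuclideanSpace ℝ (Fin d))).toSphere :=
    (continuous_const.mul hY.norm).integrable_of_hasCompactSupport
      (HasCompactSupport.of_compactSpace _)
  refine ⟨∫ ζ, B * ‖Y ζ‖ ∂(volume : Measure (EuclideanSpace ℝ (Fin d))).toSphere, fun r => ?_⟩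
  refine norm_integral_le_of_norm_le hinteg (.of_forall fun ζ => ?_)
  rw [norm_mul, RCLike.norm_conj]
  exact mul_le_mul_of_nonneg_right (hB _ (by simp [norm_stereoInv])) (norm_nonneg _)

theorem continuous_weight (d : ℕ) :
    Continuous fun r : ℝ => (((1 + r ^ 2) ^ (d - 1) : ℝ) : ℂ)⁻¹ :=
  Continuous.inv₀ (by fun_prop) fun r => Complex.ofReal_ne_zero.2 (by positivity)

theorem continuous_weightedCoeff {f : EuclideanSpace ℝ (Fin (d + 1)) → ℂ}
    (hf : ContinuousOn f (sphere 0 1)) {Y : sphere (0 : EuclideanSpace ℝ (Fin d)) 1 → ℂ}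
    (hY : Continuous Y) : Continuous (weightedCoeff f Y) :=
  (continuous_weight d).mul (continuous_harmonicCoeff hf hY)

/-- The harmonic coefficient is bounded, so the weighted one is at most M/(1+r²), because d - 1 ≥ 1.
Boundedness near 0 and decay like 1/r at infinity give the strip 0 < Re s < 1. -/
theorem mellinConvergent_weightedCoeff (hd : 2 ≤ d) {f : EuclideanSpace ℝ (Fin (d + 1)) → ℂ}
    (hf : ContinuousOn f (sphere 0 1)) {Y : sphere (0 : EuclideanSpace ℝ (Fin d)) 1 → ℂ}
    (hY : Continuous Y) {s : ℂ} (h0 : 0 < s.re) (h1 : s.re < 1) :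
    MellinConvergent (weightedCoeff f Y) s := by
  obtain ⟨M, hM⟩ := exists_norm_harmonicCoeff_le hf hY
  have hM0 : 0 ≤ M := (norm_nonneg _).trans (hM 0)
  have hle : ∀ r, ‖weightedCoeff f Y r‖ ≤ M / (1 + r ^ 2) := by
    intro r
    rw [weightedCoeff, norm_mul, norm_inv, Complex.norm_of_nonneg (by positivity),
      div_eq_inv_mul]
    refine mul_le_mul (inv_anti₀ (by positivity) ?_) (hM r) (norm_nonneg _) (by positivity)
    exact le_self_pow₀ (by nlinarith [sq_nonneg r]) (by omega)
  refine mellinConvergent_of_isBigO_rpow (a := 1) (b := 0)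
    ((continuous_weightedCoeff hf hY).continuousOn.locallyIntegrableOn measurableSet_Ioi)
    ?_ h1 ?_ h0
  · refine Asymptotics.IsBigO.of_bound M ?_
    filter_upwards [eventually_gt_atTop 0] with r hr
    refine (hle r).trans ?_
    rw [Real.rpow_neg_one, norm_inv, Real.norm_of_nonneg hr.le, ← div_eq_mul_inv]
    refine div_le_div_of_nonneg_left hM0 hr ?_
    nlinarith [sq_nonneg (r - 1)]
  · refine Asymptotics.IsBigO.of_bound M (.of_forall fun r => (hle r).trans ?_)
    rw [neg_zero, Real.rpow_zero, norm_one, mul_one]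
    exact div_le_self hM0 (by nlinarith [sq_nonneg r])

theorem weight_mul_weightedCoeff (f : EuclideanSpace ℝ (Fin (d + 1)) → ℂ)
    (Y : sphere (0 : EuclideanSpace ℝ (Fin d)) 1 → ℂ) (r : ℝ) :
    (1 + (r : ℂ) ^ 2) ^ (d - 1) * weightedCoeff f Y r = harmonicCoeff f Y r := by
  have h : (((1 + r ^ 2) ^ (d - 1) : ℝ) : ℂ) ≠ 0 := Complex.ofReal_ne_zero.2 (by positivity)
  rw [weightedCoeff, ← mul_assoc]
  push_cast at h ⊢
  rw [mul_inv_cancel₀ h, one_mul]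

theorem hasMellin_dataCoeff (hd : 2 ≤ d) {lam : ℝ} (hlam : 0 < lam) {m : ℕ}
    {f : EuclideanSpace ℝ (Fin (d + 1)) → ℂ} (hf : ContinuousOn f (sphere 0 1))
    {Y : sphere (0 : EuclideanSpace ℝ (Fin d)) 1 → ℂ} (hY : Y ∈ sphericalHarmonics d m) {s : ℂ}
    (h0 : 0 < s.re) (h1 : s.re < 1) :
    MellinConvergent (dataCoeff lam f Y) s ∧ mellin (dataCoeff lam f Y) s =
      mellin (fun x => (kernel d m lam x : ℂ)) (1 - s) * mellin (weightedCoeff f Y) s := by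
  have hYc := continuous_of_mem_sphericalHarmonics hY
  exact hasMellin_convolution (Complex.measurable_ofReal.comp (measurable_kernel d m lam))
    (continuous_weightedCoeff hf hYc).measurable (mellinConvergent_kernel hd m hlam _)
    (mellinConvergent_weightedCoeff hd hf hYc h0 h1)
    fun c hc => dataCoeff_eq_integral_kernel hd hlam hf hY hc

theorem ae_mellinQuotient_eq (hd : 2 ≤ d) {lam : ℝ} (hlam : 0 < lam) {m : ℕ}
    {f : EuclideanSpace ℝ (Fin (d + 1)) → ℂ} (hf : ContinuousOn f (sphere 0 1))
    {Y : sphere (0 : EuclideanSpace ℝ (Fin d)) 1 → ℂ} (hY : Y ∈ sphericalHarmonics d m) {ϱ : ℝ}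
    (h0 : 0 < ϱ) (h1 : ϱ < 1) :
    ∀ᵐ y : ℝ, mellinQuotient m lam f Y ((ϱ : ℂ) + y * Complex.I) =
      mellin (weightedCoeff f Y) ((ϱ : ℂ) + y * Complex.I) := by
  filter_upwards [ae_mellin_kernel_ne_zero hd m hlam ϱ] with y hy
  have hre : ((ϱ : ℂ) + y * Complex.I).re = ϱ := by simp
  rw [mellinQuotient, (hasMellin_dataCoeff hd hlam hf hY (by rwa [hre]) (by rwa [hre])).2,
    mul_div_cancel_left₀ _ hy]

end Inversion

end SpheroidTransform

theorem theorem2p1 (d : ℕ) (hd : 2 ≤ d) (lam : ℝ) (hlam : 0 < lam)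
    (f : EuclideanSpace ℝ (Fin (d + 1)) → ℂ) (hf : ContinuousOn f (Metric.sphere 0 1))
    (hfint : MeasureTheory.IntegrableOn (fStarStar f) {0}ᶜ)
    (Y : ∀ m : ℕ, Fin (harmonicDim d m) →
      Metric.sphere (0 : EuclideanSpace ℝ (Fin d)) 1 → ℂ)
    (hY : IsSphericalHarmonicBasis Y) :
    tangentSubspheres d lam =
      {T | ∃ (ψ : Metric.sphere (0 : EuclideanSpace ℝ (Fin d)) 1) (c : ℝ),
        0 < c ∧ T = subsphere lam ψ c} ∧
    ∀ (m : ℕ) (l : Fin (harmonicDim d m)) (ϱ : ℝ), 0 < ϱ → ϱ < 1 →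
      (∀ s : ℂ, s.re = ϱ → MellinConvergent (dataCoeff lam f (Y m l)) s ∧
        MellinConvergent (fun x => (kernel d m lam x : ℂ)) (1 - s)) ∧
      (∀ᵐ y : ℝ, mellin (fun x => (kernel d m lam x : ℂ)) (1 - ((ϱ : ℂ) + y * Complex.I)) ≠ 0) ∧
      (∀ r : ℝ, 0 < r →
        MeasureTheory.IntegrableAtFilter
          (fun u => (harmonicCoeff f (Y m l) u - harmonicCoeff f (Y m l) r) / ((u - r : ℝ) : ℂ))
          (nhds r) →
        Filter.Tendsto
          (fun T : ℝ => (1 + (r : ℂ) ^ 2) ^ (d - 1) *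
            truncatedMellinInv ϱ (mellinQuotient m lam f (Y m l)) r T)
          Filter.atTop (nhds (harmonicCoeff f (Y m l) r))) ∧
      (∀ r : ℝ, 0 < r →
        Filter.Tendsto
          (fun T : ℝ => (1 + (r : ℂ) ^ 2) ^ (d - 1) * ((1 / (T : ℂ)) *
            ∫ τ in (0 : ℝ)..T, truncatedMellinInv ϱ (mellinQuotient m lam f (Y m l)) r τ))
          Filter.atTop (nhds (harmonicCoeff f (Y m l) r))) := by
  refine ⟨tangentSubspheres_eq hlam, fun m l ϱ h0 h1 => ?_⟩
  have hYm := hY.mem m l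
  have hYc := continuous_of_mem_sphericalHarmonics hYm
  have hQ := ae_mellinQuotient_eq hd hlam hf hYm h0 h1
  have hg : MellinConvergent (weightedCoeff f (Y m l)) (ϱ : ℂ) :=
    mellinConvergent_weightedCoeff hd hf hYc (by simpa using h0) (by simpa using h1)
  refine ⟨fun s hs => ⟨(hasMellin_dataCoeff hd hlam hf hYm (by rwa [hs]) (by rwa [hs])).1,
    mellinConvergent_kernel hd m hlam _⟩, ae_mellin_kernel_ne_zero hd m hlam ϱ,
    fun r hr hdini => ?_, fun r hr => ?_⟩
  · rw [← weight_mul_weightedCoeff]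
    refine (tendsto_truncatedMellinInv_of_dini hr hQ hg ?_).const_mul _
    -- The inversion is applied to g(r) = f_{m,l}(r)/(1+r²)^(d-1), so the Dini condition has to be
    -- carried over from the harmonic coefficient through the smooth weight.
    refine integrableAtFilter_dini_mul (continuous_weight d) ?_ hdini
    refine DifferentiableAt.inv ?_ (Complex.ofReal_ne_zero.2 (by positivity))
    have h : DifferentiableAt ℝ (fun u : ℝ => (1 + u ^ 2) ^ (d - 1)) r := by fun_prop
    exact Complex.ofRealCLM.differentiableAt.comp r h
  · rw [← weight_mul_weightedCoeff]
    exact (tendsto_cesaro_truncatedMellinInv hr hQ hg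
      (continuous_weightedCoeff hf hYc).continuousAt).const_mul _
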